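/- For an even integer $k\ge 12$ let $\mathcal H_k$ be the set of Hecke eigencuspforms $f$ of weight $k$ for $SL(2,\mathbb Z)$, i.e. the cusp forms that are eigenfunctions of all Hecke operators, normalised so that their Fourier expansion is $f(z)=\sum_{n\ge1}\lambda_f(n)n^{(k-1)/2}e^{2\pi i nz}$ with $\lambda_f(1)=1$. Let $L(s,f)$ be the entire continuation of $\sum_{n\ge 1}\lambda_f(n)n^{-s}$, so that the centre of its functional equation is $s=\tfrac12$, and let $$\omega_f=\frac{(4\pi)^{k-1}}{\Gamma(k-1)}\langle f,f\rangle,\qquad \langle f,f\rangle=\int_{SL(2,\mathbb Z)\backslash\mathbb H}|f(x+iy)|^2y^{k}\,\frac{dx\,dy}{y^2}.$$ **Theorem 1.** For every even positive integer $r$ there is a constant $C=C(r)>0$ such that, for every integer $k\ge 12$ with $k\equiv 0\pmod 4$, the harmonic moment $\sum_{f\in\mathcal H_k}\frac1{\omega_f}L(\tfrac12,f)^r$ is a real number and $$\sum_{f\in\mathcal H_k}\frac{1}{\omega_f}\,L(\tfrac12,f)^r\ \ge\ C\,(\log k)^{r(r-1)/2}.$$ -/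

import Mathlib

open UpperHalfPlane hiding I
open scoped MatrixGroups

namespace HeckeMoment

noncomputable section

/-- The Hecke operator `T_n` in weight `k` for `SL(2, ℤ)`, acting on functions on the upper half
plane: `(T_n f)(z) = n ^ (k - 1) ∑_{a d = n} d ^ (-k) ∑_{0 ≤ b < d} f ((a z + b) / d)`. -/
def heckeOperator (k : ℤ) (n : ℕ) (f : ℍ → ℂ) : ℍ → ℂ := fun z ↦
  (n : ℂ) ^ (k - 1) * ∑ p ∈ n.divisorsAntidiagonal, (p.2 : ℂ) ^ (-k) *
    ∑ b ∈ Finset.range p.2, f (ofComplex (((p.1 : ℂ) * (z : ℂ) + (b : ℂ)) / (p.2 : ℂ)))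

/-- `H_k`: the cusp forms of weight `k` for `SL(2, ℤ)` that are eigenfunctions of all Hecke
operators, normalised so that the first Fourier coefficient is `1`. -/
def heckeEigenforms (k : ℕ) : Set (CuspForm 𝒮ℒ (k : ℤ)) :=
  {f | (qExpansion 1 f).coeff 1 = 1 ∧
    ∀ n : ℕ, 0 < n → ∃ c : ℂ, heckeOperator (k : ℤ) n f = c • (f : ℍ → ℂ)}

/-- The Petersson inner product
`⟨f, g⟩ = ∫ conj (f z) g(z) y ^ k dx dy / y ^ 2` over the standard fundamental domain of `SL(2, ℤ)`
(the volume on `ℍ` is the hyperbolic measure `dx dy / y ^ 2`). -/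
def peterssonInner {k : ℕ} (f g : CuspForm 𝒮ℒ (k : ℤ)) : ℂ :=
  ∫ z in ModularGroup.fd, petersson (k : ℤ) f g z

/-- The harmonic weight `ω_f = (4 π) ^ (k - 1) / Γ(k - 1) * ⟨f, f⟩`. -/
def harmonicWeight {k : ℕ} (f : CuspForm 𝒮ℒ (k : ℤ)) : ℝ :=
  (4 * Real.pi) ^ ((k : ℝ) - 1) / Real.Gamma ((k : ℝ) - 1) * (peterssonInner f f).re

/-- The normalised Fourier coefficient `λ_f(n)`, where
`f(z) = ∑ λ_f(n) n ^ ((k - 1) / 2) e(n z)`. -/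
def normalizedCoeff {k : ℕ} (f : CuspForm 𝒮ℒ (k : ℤ)) (n : ℕ) : ℂ :=
  (qExpansion 1 f).coeff n / (n : ℂ) ^ (((k : ℂ) - 1) / 2)

/-- The `L`-function `L(s, f)`, the entire continuation of `∑ λ_f(n) n ^ (-s)`: Mathlib's
`L`-function of `f` (whose Dirichlet coefficients are the Fourier coefficients themselves) shifted
so that the functional equation relates `s` to `1 - s`. -/
def LFunction {k : ℕ} (hk : 0 < k) (f : CuspForm 𝒮ℒ (k : ℤ)) (s : ℂ) : ℂ :=
  ModularForm.L (Int.natCast_pos.mpr hk) f (s + ((k : ℂ) - 1) / 2)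

/-- The harmonic `r`-th moment `∑_{f ∈ H_k} L(1/2, f) ^ r / ω_f`. -/
def harmonicMoment {k : ℕ} (hk : 0 < k) (r : ℕ) : ℂ :=
  ∑ᶠ f ∈ heckeEigenforms k, (1 / (harmonicWeight f : ℂ)) * LFunction hk f (1 / 2) ^ r

/-- `L(s, f)` is entire. -/
theorem differentiable_LFunction {k : ℕ} (hk : 0 < k) (f : CuspForm 𝒮ℒ (k : ℤ)) :
    Differentiable ℂ (LFunction hk f) :=
  (CuspForm.differentiable_L (Int.natCast_pos.mpr hk) f).comp (differentiable_id.add_const _)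

/-- `L(s, f)` is the Dirichlet series `∑ λ_f(n) n ^ (-s)` in a right half plane. -/
theorem hasSum_LFunction {k : ℕ} (hk : 0 < k) (f : CuspForm 𝒮ℒ (k : ℤ)) {s : ℂ}
    (hs : 3 / 2 < s.re) :
    HasSum (fun n : ℕ ↦ normalizedCoeff f n * (n : ℂ) ^ (-s)) (LFunction hk f s) := by
  have hre : (((k : ℤ) : ℝ)) / 2 + 1 < (s + ((k : ℂ) - 1) / 2).re := by
    have : (((k : ℂ) - 1) / 2).re = ((k : ℝ) - 1) / 2 := by
      simp
    rw [Complex.add_re, this]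
    push_cast
    linarith
  have h := CuspForm.hasSum_L (Int.natCast_pos.mpr hk) f hre
  rw [Subgroup.strictWidthInfty_SL2Z] at h
  simp only [Complex.ofReal_one, Complex.one_cpow, one_mul] at h
  change HasSum _ (ModularForm.L _ f _)
  convert h using 2 with n
  rw [normalizedCoeff, Complex.cpow_neg]
  rcases Nat.eq_zero_or_pos n with rfl | hn
  · have h0 : s ≠ 0 := by
      rintro rfl
      norm_num at hs
    have h1 : s + ((k : ℂ) - 1) / 2 ≠ 0 := by
      intro h
      rw [h, Complex.zero_re] at hre
      have : (0 : ℝ) ≤ ((k : ℤ) : ℝ) / 2 := by positivity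
      linarith
    simp [h0, h1]
  · rw [Complex.cpow_add _ _ (by exact_mod_cast hn.ne')]
    field_simp

end

end HeckeMoment

/-!
The lower bound is proved by comparing the central value with a short Dirichlet polynomial. For an
eigenform `f` let `A = ∑ λ_f(m) / √m`, summed over squarefree `m ≤ X`, where `X` is a small power of
`k`. Since `r` is even, `t ↦ t ^ r` lies above its tangent at `A` (`tangent_le_pow`), hence
`L(1/2, f) ^ r ≥ r L(1/2, f) A ^ (r - 1) - (r - 1) A ^ r`, and it remains to average
`L(1/2, f) A ^ (r - 1)` and `A ^ r` over the eigenforms with the weights `1 / ω_f`.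

By Hecke's multiplication rule `A ^ j = ∑ b_n λ_f(n)` with nonnegative coefficients `b_n`
(`dirichletPoly_pow`), so only the averages of `λ_f(n)` and of `λ_f(n) L(1/2, f)` are needed. Both
come from the first Poincaré series `P`, whose spectral expansion is `∑ f / ω_f`
(`poincare_eq_sum`). As `k` grows, `P(z)` is very close to `e(z)` (`norm_poincareFun_sub_le`). Its
Fourier coefficients show that the average of `λ_f(n)` is about `1` for `n = 1` and `0` otherwise
(`abs_harmonicAverage_eigenvalue_sub_le`). For `4 ∣ k` the central value is the linear functional
`f ↦ c ∫_1^∞ f(it) t ^ (k / 2 - 1) dt`, and applying it to `T_n P` shows that the average of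
`λ_f(n) L(1/2, f)` is about `2 / √n` (`abs_harmonicAverage_eigenvalue_mul_centralValue_sub_le`).
These approximations are crude in `n` but gain a factor `k ^ (-c k)` or `c ^ (-k)`, which is enough
because every `n` that occurs is at most `k ^ (1 / 8)`. With `b_1` denoting the coefficient of `λ(1)`
in `A ^ r`, the two averages are at least about `2 b_1` and at most about `b_1`, so the moment is at
least `b_1` for large `k` (`powCoeff_one_le_harmonicAverage`).

The coefficient `b_1` is at least `∑ R ^ ω(m) / m` over squarefree `m ≤ X`, where
`R = r (r - 1) / 2` (`squarefreeSum_le_powCoeff_one`), and this sum has order `(log X) ^ R`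
(`exists_mul_log_pow_le_squarefreeSum`).

For the finitely many remaining `k` it suffices that the moment is positive. Some central value does
not vanish, because the eigenforms span the cusp forms (`span_heckeEigenforms`, from the symmetry of
the Hecke operators for the Petersson inner product) and `Δ E₄ ^ n` is positive on the imaginary
axis.
-/


namespace HeckeMoment

open MeasureTheory ModularGroup Set
open scoped ENNReal

/-! ### The hyperbolic measure -/

/-- The hyperbolic measure `dx dy / y ^ 2` in the coordinates `(x, y)`. -/
noncomputable def hypMeasure : Measure (ℝ × ℝ) :=
  (volume.restrict (univ ×ˢ Ioi (0 : ℝ))).withDensity fun p ↦ ENNReal.ofReal ((p.2 ^ 2)⁻¹)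

theorem measurePreserving_re_im :
    MeasurePreserving (fun z : ℍ ↦ (z.re, z.im)) volume hypMeasure := by
  have hm : Measurable (fun z : ℍ ↦ (z.re, z.im)) := by
    have := (Complex.measurable_re.comp measurable_coe).prodMk
      (Complex.measurable_im.comp measurable_coe)
    exact this
  refine ⟨hm, ?_⟩
  ext s hs
  have hms : MeasurableSet (s ∩ univ ×ˢ Ioi (0 : ℝ)) :=
    hs.inter (MeasurableSet.univ.prod measurableSet_Ioi)
  rw [Measure.map_apply hm hs, volume_eq_lintegral, hypMeasure, withDensity_apply _ hs,
    Measure.restrict_restrict hs,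
    ← Complex.volume_preserving_equiv_real_prod.setLIntegral_comp_preimage_emb
      Complex.measurableEquivRealProd.measurableEmbedding]
  have h1 : ((↑) '' ((fun z : ℍ ↦ (z.re, z.im)) ⁻¹' s) : Set ℂ) =
      Complex.measurableEquivRealProd ⁻¹' (s ∩ univ ×ˢ Ioi (0 : ℝ)) := by
    ext w
    constructor
    · rintro ⟨z, hz, rfl⟩
      exact ⟨hz, mem_univ _, z.im_pos⟩
    · rintro ⟨h1, -, h2⟩
      exact ⟨⟨w, h2⟩, h1, rfl⟩
  rw [h1]
  refine setLIntegral_congr_fun (Complex.measurableEquivRealProd.measurable hms) ?_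
  rintro w ⟨-, -, h2⟩
  have h2 : 0 < w.im := h2
  change (((1 / ‖w.im‖₊) ^ 2 : NNReal) : ℝ≥0∞) = ENNReal.ofReal ((w.im ^ 2)⁻¹)
  rw [ENNReal.ofReal, ENNReal.coe_inj]
  ext
  rw [Real.coe_toNNReal _ (by positivity)]
  simp [abs_of_pos h2]

theorem measurableEmbedding_re_im : MeasurableEmbedding (fun z : ℍ ↦ (z.re, z.im)) :=
  Complex.measurableEquivRealProd.measurableEmbedding.comp measurableEmbedding_coe

/-- The hyperbolic measure in the coordinates `(x, y)`, for lower integrals. -/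
theorem lintegral_eq (G : ℝ → ℝ → ℝ≥0∞) (hG : Measurable (Function.uncurry G)) :
    ∫⁻ z : ℍ, G z.re z.im =
      ∫⁻ y in Ioi (0 : ℝ), ∫⁻ x : ℝ, ENNReal.ofReal ((y ^ 2)⁻¹) * G x y := by
  have h1 := measurePreserving_re_im.lintegral_comp (f := Function.uncurry G) hG
  change ∫⁻ z : ℍ, G z.re z.im = _ at h1
  have hw : Measurable fun p : ℝ × ℝ ↦ ENNReal.ofReal ((p.2 ^ 2)⁻¹) := by fun_prop
  rw [h1, hypMeasure, lintegral_withDensity_eq_lintegral_mul _ hw hG, Measure.volume_eq_prod,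
    ← Measure.prod_restrict, lintegral_prod_symm _ (hw.mul hG).aemeasurable, Measure.restrict_univ]
  rfl

/-- The hyperbolic measure in the coordinates `(x, y)`, for Bochner integrals. -/
theorem integral_eq {G : ℝ → ℝ → ℂ} (hG : Integrable (fun z : ℍ ↦ G z.re z.im)) :
    ∫ z : ℍ, G z.re z.im = ∫ y in Ioi (0 : ℝ), ∫ x : ℝ, ((y ^ 2)⁻¹ : ℝ) * G x y := by
  have hw : Measurable fun p : ℝ × ℝ ↦ Real.toNNReal ((p.2 ^ 2)⁻¹) := by fun_prop
  have h0 : Integrable (Function.uncurry G) hypMeasure :=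
    (measurePreserving_re_im.integrable_comp_emb measurableEmbedding_re_im).1 hG
  have h1 := measurePreserving_re_im.integral_comp measurableEmbedding_re_im (Function.uncurry G)
  change ∫ z : ℍ, G z.re z.im = _ at h1
  have h2 : hypMeasure = (volume.restrict (univ ×ˢ Ioi (0 : ℝ))).withDensity
    fun p ↦ (Real.toNNReal ((p.2 ^ 2)⁻¹) : ℝ≥0∞) := rfl
  rw [h2, integrable_withDensity_iff_integrable_smul hw, Measure.volume_eq_prod,
    ← Measure.prod_restrict] at h0
  rw [h1, h2, integral_withDensity_eq_integral_smul hw, Measure.volume_eq_prod,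
    ← Measure.prod_restrict, integral_prod_symm _ h0, Measure.restrict_univ]
  refine setIntegral_congr_fun measurableSet_Ioi fun y hy ↦ integral_congr_ae (.of_forall fun x ↦ ?_)
  change (Real.toNNReal ((y ^ 2)⁻¹)) • G x y = _
  rw [NNReal.smul_def, Real.coe_toNNReal _ (by positivity), Complex.real_smul]

theorem measurableSet_fd : MeasurableSet fd := isClosed_fd.measurableSet

theorem volume_fd_lt_top : volume fd < ∞ := by
  have h1 : fd ⊆ {z : ℍ | z.re ∈ Icc (-1 : ℝ) 1 ∧ z.im ∈ Ici (1 / 2 : ℝ)} := by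
    intro z hz
    have h3 := three_le_four_mul_im_sq_of_mem_fd hz
    have h4 := abs_le.1 hz.2
    refine ⟨⟨by linarith, by linarith⟩, ?_⟩
    simp only [mem_Ici]
    nlinarith [z.im_pos]
  refine (measure_mono h1).trans_lt ?_
  have h2 := measurePreserving_re_im.measure_preimage (s := Icc (-1 : ℝ) 1 ×ˢ Ici (1 / 2 : ℝ))
    (measurableSet_Icc.prod measurableSet_Ici).nullMeasurableSet
  change volume {z : ℍ | z.re ∈ Icc (-1 : ℝ) 1 ∧ z.im ∈ Ici (1 / 2 : ℝ)} = _ at h2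
  rw [h2, hypMeasure, withDensity_apply _ (measurableSet_Icc.prod measurableSet_Ici),
    Measure.restrict_restrict (measurableSet_Icc.prod measurableSet_Ici), prod_inter_prod,
    Measure.volume_eq_prod, ← Measure.prod_restrict, lintegral_prod_symm _ (by fun_prop)]
  simp only [lintegral_const]
  rw [lintegral_mul_const _ (by fun_prop)]
  refine ENNReal.mul_lt_top ?_ (by simp)
  have h3 : IntegrableOn (fun y : ℝ ↦ (y ^ 2)⁻¹) (Ioi (1 / 4)) := by
    have := integrableOn_Ioi_rpow_of_lt (a := -2) (by norm_num) (c := 1 / 4) (by norm_num)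
    refine this.congr_fun (fun y hy ↦ ?_) measurableSet_Ioi
    have : (0 : ℝ) < y := lt_trans (by norm_num) (mem_Ioi.1 hy)
    change y ^ (-2 : ℝ) = _
    rw [Real.rpow_neg this.le]
    norm_num
  have h4 := (h3.mono_set (s := Ici (1 / 2) ∩ Ioi 0) (by
    intro y hy
    exact lt_of_lt_of_le (by norm_num : (1 / 4 : ℝ) < 1 / 2) hy.1)).2
  refine lt_of_le_of_lt (lintegral_mono fun y ↦ ?_) h4
  exact Real.ofReal_le_enorm _

theorem volume_fd_diff_fdo : volume (fd \ fdo) = 0 := by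
  rw [volume_eq_lintegral]
  refine setLIntegral_measure_zero _ _ ?_
  have h1 : ((↑) '' (fd \ fdo) : Set ℂ) ⊆
      Metric.sphere 0 1 ∪ (Complex.measurableEquivRealProd ⁻¹' ({1 / 2} ×ˢ univ) ∪
        Complex.measurableEquivRealProd ⁻¹' ({-1 / 2} ×ˢ univ)) := by
    rintro _ ⟨z, ⟨⟨h1, h2⟩, h3⟩, rfl⟩
    by_cases h4 : Complex.normSq (z : ℂ) = 1
    · left
      rw [Complex.normSq_eq_norm_sq] at h4
      simp only [mem_sphere_iff_norm, sub_zero]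
      nlinarith [norm_nonneg (z : ℂ)]
    · right
      have h5 : |z.re| = 1 / 2 := by
        by_contra h6
        exact h3 ⟨lt_of_le_of_ne h1 (Ne.symm h4), lt_of_le_of_ne h2 h6⟩
      rcases (abs_eq (by norm_num)).1 h5 with h | h
      · left
        exact ⟨h, mem_univ _⟩
      · right
        exact ⟨by change z.re = _; rw [h]; norm_num, mem_univ _⟩
  refine measure_mono_null h1 (measure_union_null ?_ (measure_union_null ?_ ?_))
  · exact Measure.addHaar_sphere _ _ _
  all_goals
    rw [Complex.volume_preserving_equiv_real_prod.measure_preimage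
      ((measurableSet_singleton _).prod MeasurableSet.univ).nullMeasurableSet,
      Measure.volume_eq_prod, Measure.prod_prod]
    simp

theorem measurePreserving_gl_smul (g : GL (Fin 2) ℝ) :
    MeasurePreserving (fun z : ℍ ↦ g • z) volume volume := measurePreserving_smul g volume

theorem measurePreserving_sl_smul (γ : SL(2, ℤ)) :
    MeasurePreserving (fun z : ℍ ↦ γ • z) volume volume :=
  measurePreserving_gl_smul (γ : GL (Fin 2) ℝ)

theorem measurableEmbedding_gl_smul (g : GL (Fin 2) ℝ) :
    MeasurableEmbedding (fun z : ℍ ↦ g • z) :=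
  measurableEmbedding_const_smul g

instance : Countable SL(2, ℤ) := by
  have : Countable (Matrix (Fin 2) (Fin 2) ℤ) := inferInstanceAs (Countable (Fin 2 → Fin 2 → ℤ))
  exact Subtype.countable

/-- Almost every `SL(2, ℤ)`-orbit meets the fundamental domain in exactly one point, which is
then hit by exactly two matrices, `γ` and `-γ`. -/
theorem ae_exists_smul_mem_fd_iff :
    ∀ᵐ z : ℍ, ∃ γ₀ : SL(2, ℤ), ∀ γ : SL(2, ℤ), γ • z ∈ fd ↔ γ = γ₀ ∨ γ = -γ₀ := by
  have h1 : ∀ᵐ z : ℍ, ∀ γ : SL(2, ℤ), γ • z ∉ fd \ fdo := by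
    rw [ae_all_iff]
    intro γ
    have := (measurePreserving_sl_smul γ).quasiMeasurePreserving.preimage_null volume_fd_diff_fdo
    exact measure_eq_zero_iff_ae_notMem.1 this
  filter_upwards [h1] with z hz
  obtain ⟨γ₀, h0⟩ := exists_smul_mem_fd z
  have h0' : γ₀ • z ∈ fdo := by
    by_contra h
    exact hz γ₀ ⟨h0, h⟩
  refine ⟨γ₀, fun γ ↦ ⟨fun h ↦ ?_, ?_⟩⟩
  · have h2 : (γ * γ₀⁻¹) • (γ₀ • z) ∈ fd := by
      rwa [smul_smul, inv_mul_cancel_right]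
    rcases eq_one_or_neg_one_of_mem_fdo_mem_fd h0' h2 with h3 | h3
    · left
      exact mul_inv_eq_one.1 h3
    · right
      rw [mul_inv_eq_iff_eq_mul] at h3
      rw [h3, neg_one_mul]
  · rintro (rfl | rfl)
    · exact h0
    · rwa [SL_neg_smul]

theorem sl_ne_neg (γ : SL(2, ℤ)) : γ ≠ -γ := by
  intro h
  have h1 : ∀ i j, γ i j = 0 := by
    intro i j
    have := congrArg (fun A : SL(2, ℤ) ↦ A i j) h
    simp at this
    lia
  have h2 := γ.det_coe
  rw [Matrix.det_fin_two] at h2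
  simp [h1] at h2

theorem hasSum_indicator_of_iff {E : Type*} [NormedAddCommGroup E] {z : ℍ} {γ₀ : SL(2, ℤ)}
    (h : ∀ γ : SL(2, ℤ), γ • z ∈ fd ↔ γ = γ₀ ∨ γ = -γ₀) (c : E) :
    HasSum (fun γ : SL(2, ℤ) ↦ fd.indicator (fun _ ↦ c) (γ • z)) (c + c) := by
  classical
  have h1 : ∀ γ : SL(2, ℤ), γ ∉ ({γ₀, -γ₀} : Finset SL(2, ℤ)) →
      fd.indicator (fun _ ↦ c) (γ • z) = 0 := by
    intro γ hγ
    apply indicator_of_notMem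
    rw [h]
    simpa using hγ
  have h2 : HasSum (fun γ : SL(2, ℤ) ↦ fd.indicator (fun _ ↦ c) (γ • z)) _ :=
    hasSum_sum_of_ne_finset_zero h1
  rwa [Finset.sum_pair (sl_ne_neg γ₀), indicator_of_mem ((h _).2 (Or.inl rfl)),
    indicator_of_mem ((h _).2 (Or.inr rfl))] at h2

theorem tsum_indicator_of_iff {z : ℍ} {γ₀ : SL(2, ℤ)}
    (h : ∀ γ : SL(2, ℤ), γ • z ∈ fd ↔ γ = γ₀ ∨ γ = -γ₀) (c : ℝ≥0∞) :
    ∑' γ : SL(2, ℤ), fd.indicator (fun _ ↦ c) (γ • z) = 2 * c := by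
  classical
  have h1 : ∀ γ : SL(2, ℤ), γ ∉ ({γ₀, -γ₀} : Finset SL(2, ℤ)) →
      fd.indicator (fun _ ↦ c) (γ • z) = 0 := by
    intro γ hγ
    apply indicator_of_notMem
    rw [h]
    simpa using hγ
  rw [tsum_eq_sum h1, Finset.sum_pair (sl_ne_neg γ₀), indicator_of_mem ((h _).2 (Or.inl rfl)),
    indicator_of_mem ((h _).2 (Or.inr rfl)), two_mul]

theorem measurableSet_smul_mem_fd (γ : SL(2, ℤ)) (g : GL (Fin 2) ℝ) :
    MeasurableSet {z : ℍ | γ • (g • z) ∈ fd} :=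
  ((measurePreserving_sl_smul γ).measurable.comp (measurePreserving_gl_smul g).measurable)
    measurableSet_fd

/-- The translates of the fundamental domain by `SL(2, ℤ)`, pulled back by `g`, cover `ℍ` twice
(the matrices `γ` and `-γ` act in the same way). -/
theorem tsum_lintegral_indicator_fd (g : GL (Fin 2) ℝ) {G : ℍ → ℝ≥0∞} (hG : Measurable G) :
    ∑' γ : SL(2, ℤ), ∫⁻ z, fd.indicator (fun _ ↦ G z) (γ • (g • z)) = 2 * ∫⁻ z, G z := by
  rw [← lintegral_tsum, ← lintegral_const_mul _ hG]
  · refine lintegral_congr_ae ?_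
    filter_upwards [(measurePreserving_gl_smul g).quasiMeasurePreserving.ae
      ae_exists_smul_mem_fd_iff] with z ⟨γ₀, hz⟩
    exact tsum_indicator_of_iff hz _
  · intro γ
    exact (hG.indicator (measurableSet_smul_mem_fd γ g)).aemeasurable

theorem integrable_indicator_fd (g : GL (Fin 2) ℝ) {G : ℍ → ℂ} (hG : Integrable G)
    (γ : SL(2, ℤ)) : Integrable fun z ↦ fd.indicator (fun _ ↦ G z) (γ • (g • z)) :=
  hG.indicator (measurableSet_smul_mem_fd γ g)

theorem summable_integral_norm_indicator_fd (g : GL (Fin 2) ℝ) {G : ℍ → ℂ} (hG : Integrable G)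
    (hGm : Measurable G) :
    Summable fun γ : SL(2, ℤ) ↦ ∫ z, ‖fd.indicator (fun _ ↦ G z) (γ • (g • z))‖ := by
  have h1 : ∀ γ : SL(2, ℤ), ∫ z, ‖fd.indicator (fun _ ↦ G z) (γ • (g • z))‖ =
      (∫⁻ z, fd.indicator (fun _ ↦ ‖G z‖ₑ) (γ • (g • z))).toReal := by
    intro γ
    rw [integral_norm_eq_lintegral_enorm (integrable_indicator_fd g hG γ).1]
    congr 1
    refine lintegral_congr fun z ↦ ?_
    rw [enorm_indicator_eq_indicator_enorm]
  simp_rw [h1]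
  apply ENNReal.summable_toReal
  rw [tsum_lintegral_indicator_fd g hGm.enorm]
  exact ENNReal.mul_ne_top (by simp) hG.2.ne

theorem hasSum_integral_indicator_fd (g : GL (Fin 2) ℝ) {G : ℍ → ℂ} (hG : Integrable G)
    (hGm : Measurable G) :
    HasSum (fun γ : SL(2, ℤ) ↦ ∫ z, fd.indicator (fun _ ↦ G z) (γ • (g • z)))
      (2 * ∫ z, G z) := by
  have h1 := hasSum_integral_of_summable_integral_norm (integrable_indicator_fd g hG)
    (summable_integral_norm_indicator_fd g hG hGm)
  suffices h2 : 2 * ∫ z, G z = ∫ z, ∑' γ : SL(2, ℤ), fd.indicator (fun _ ↦ G z) (γ • (g • z)) by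
    rwa [h2]
  rw [← integral_const_mul]
  refine integral_congr_ae ?_
  filter_upwards [(measurePreserving_gl_smul g).quasiMeasurePreserving.ae
    ae_exists_smul_mem_fd_iff] with z ⟨γ₀, hz⟩
  rw [(hasSum_indicator_of_iff hz (G z)).tsum_eq, two_mul]

/-- Translating a function instead of the fundamental domain. -/
theorem setIntegral_fd_smul {E : Type*} [NormedAddCommGroup E] [NormedSpace ℝ E] (γ : SL(2, ℤ))
    (G : ℍ → E) :
    ∫ z in fd, G (γ • z) = ∫ z, fd.indicator (fun _ ↦ G z) (γ⁻¹ • z) := by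
  have h1 := (measurePreserving_sl_smul γ).integral_comp (measurableEmbedding_gl_smul _)
    fun z ↦ fd.indicator (fun _ ↦ G z) (γ⁻¹ • z)
  rw [← integral_indicator measurableSet_fd, ← h1]
  refine integral_congr_ae (.of_forall fun z ↦ ?_)
  simp only
  rw [inv_smul_smul]
  rfl

/-- Unfolding: the integral over the fundamental domain of a sum over `SL(2, ℤ)` is twice the
integral over `ℍ`. -/
theorem setIntegral_fd_tsum {G : ℍ → ℂ} (hG : Integrable G) (hGm : Measurable G) :
    ∫ z in fd, ∑' γ : SL(2, ℤ), G (γ • z) = 2 * ∫ z, G z := by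
  have h1 : ∀ γ : SL(2, ℤ), Integrable (fun z ↦ G (γ • z)) (volume.restrict fd) := fun γ ↦
    (((measurePreserving_sl_smul γ).integrable_comp_emb (measurableEmbedding_gl_smul _)).2
      hG).integrableOn
  have h2 : Summable fun γ : SL(2, ℤ) ↦ ∫ z in fd, ‖G (γ • z)‖ := by
    have := (Equiv.inv SL(2, ℤ)).summable_iff.2 (summable_integral_norm_indicator_fd 1 hG hGm)
    refine this.congr fun γ ↦ ?_
    rw [setIntegral_fd_smul γ fun z ↦ ‖G z‖]
    refine integral_congr_ae (.of_forall fun z ↦ ?_)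
    simp only [one_smul, Equiv.inv_apply, norm_indicator_eq_indicator_norm]
  have h3 := hasSum_integral_of_summable_integral_norm h1 h2
  have h4 := (Equiv.inv SL(2, ℤ)).hasSum_iff.2 (hasSum_integral_indicator_fd 1 hG hGm)
  refine h3.unique ?_
  refine h4.congr_fun fun γ ↦ ?_
  simp only [one_smul, Function.comp, Equiv.inv_apply]
  exact setIntegral_fd_smul γ G

end HeckeMoment

namespace HeckeMoment

open ModularGroup FixedDetMatrices
open scoped ModularForm

/-! ### Integral matrices of determinant `n` and the Hecke operator -/

/-- The integral `2 × 2` matrices of determinant `n`. -/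
abbrev DetMatrix (n : ℕ) := FixedDetMatrix (Fin 2) ℤ (n : ℤ)

namespace DetMatrix

variable {n : ℕ} [NeZero n]

/-- A matrix of determinant `n ≠ 0` as an element of `GL(2, ℝ)`. -/
noncomputable def toGL (A : DetMatrix n) : GL (Fin 2) ℝ :=
  Matrix.GeneralLinearGroup.mkOfDetNeZero (A.1.map (Int.castRingHom ℝ)) (by
    have h : (A.1.map (Int.castRingHom ℝ)).det = n := by
      rw [← RingHom.mapMatrix_apply, ← RingHom.map_det, A.2]
      simp
    rw [h]
    exact Nat.cast_ne_zero.2 (NeZero.ne n))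

@[simp]
theorem toGL_apply (A : DetMatrix n) (i j : Fin 2) : (toGL A) i j = (A.1 i j : ℝ) := rfl

theorem val_toGL (A : DetMatrix n) : (toGL A).val = A.1.map (Int.castRingHom ℝ) := rfl

theorem det_toGL (A : DetMatrix n) : (toGL A).det.val = n := by
  change (toGL A).val.det = n
  rw [val_toGL, ← RingHom.mapMatrix_apply, ← RingHom.map_det, A.2]
  simp

theorem toGL_smul (γ : SL(2, ℤ)) (A : DetMatrix n) :
    toGL (γ • A) = (γ : GL (Fin 2) ℝ) * toGL A := by
  apply Units.ext
  change (γ.1 * A.1).map (Int.castRingHom ℝ) = γ.1.map (Int.castRingHom ℝ) * _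
  rw [Matrix.map_mul]
  rfl

/-- Right multiplication by an element of `SL(2, ℤ)`. -/
def mulRight (A : DetMatrix n) (γ : SL(2, ℤ)) : DetMatrix n :=
  ⟨A.1 * γ.1, by rw [Matrix.det_mul, A.2, γ.2, mul_one]⟩

theorem toGL_mulRight (A : DetMatrix n) (γ : SL(2, ℤ)) :
    toGL (A.mulRight γ) = toGL A * (γ : GL (Fin 2) ℝ) := by
  apply Units.ext
  change (A.1 * γ.1).map (Int.castRingHom ℝ) = _ * γ.1.map (Int.castRingHom ℝ)
  rw [Matrix.map_mul]
  rfl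

theorem smul_mulRight {n : ℕ} (δ : SL(2, ℤ)) (A : DetMatrix n) (γ : SL(2, ℤ)) :
    (δ • A).mulRight γ = δ • A.mulRight γ := by
  apply FixedDetMatrices.ext'
  change δ.1 * A.1 * γ.1 = δ.1 * (A.1 * γ.1)
  rw [Matrix.mul_assoc]

theorem mulRight_injective {n : ℕ} (γ : SL(2, ℤ)) :
    Function.Injective fun A : DetMatrix n ↦ A.mulRight γ := by
  intro A B h
  have h1 : A.1 * γ.1 = B.1 * γ.1 := congrArg Subtype.val h
  apply FixedDetMatrices.ext'
  have h2 := congrArg (· * γ⁻¹.1) h1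
  simp only [Matrix.mul_assoc] at h2
  rw [← Matrix.SpecialLinearGroup.coe_mul, mul_inv_cancel] at h2
  simpa using h2

/-- The main involution `A ↦ n A⁻¹`. -/
def adj (A : DetMatrix n) : DetMatrix n :=
  ⟨A.1.adjugate, by rw [Matrix.det_adjugate, A.2]; simp⟩

theorem adj_adj {n : ℕ} (A : DetMatrix n) : A.adj.adj = A := by
  apply FixedDetMatrices.ext'
  exact Matrix.adjugate_adjugate' A.1 |>.trans (by simp)

/-- The main involution as an equivalence. -/
def adjEquiv : DetMatrix n ≃ DetMatrix n := ⟨adj, adj, adj_adj, adj_adj⟩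

theorem toGL_mul_toGL_adj (A : DetMatrix n) :
    toGL A * toGL A.adj =
      Matrix.GeneralLinearGroup.scalar (Fin 2)
        (Units.mk0 (n : ℝ) (Nat.cast_ne_zero.2 (NeZero.ne n))) := by
  apply Units.ext
  change A.1.map (Int.castRingHom ℝ) * (A.1.adjugate).map (Int.castRingHom ℝ) = _
  rw [← Matrix.map_mul, Matrix.mul_adjugate, A.2]
  ext i j
  fin_cases i <;> fin_cases j <;>
    simp [Matrix.GeneralLinearGroup.scalar, Matrix.natCast_apply]

theorem det_toGL_pos (A : DetMatrix n) : 0 < (toGL A).det.val := by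
  rw [det_toGL]
  exact Nat.cast_pos.2 (NeZero.pos n)

theorem toGL_smul_toGL_adj_smul (A : DetMatrix n) (z : ℍ) : toGL A • (toGL A.adj • z) = z := by
  rw [smul_smul, toGL_mul_toGL_adj, glScalar_smul]

theorem exists_smul_rep (A : DetMatrix n) :
    ∃ (γ : SL(2, ℤ)) (α : reps (n : ℤ)), A = γ • α.1 := by
  refine FixedDetMatrices.induction_on
    (C := fun A : DetMatrix n ↦ ∃ (γ : SL(2, ℤ)) (α : reps (n : ℤ)), A = γ • α.1) (A := A)
    (Nat.cast_ne_zero.2 (NeZero.ne n)) ?_ ?_ ?_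
  · exact fun A h1 h2 h3 h4 ↦ ⟨1, ⟨A, h1, h2, h3, h4⟩, (one_smul _ _).symm⟩
  · rintro _ ⟨γ, α, rfl⟩
    exact ⟨S * γ, α, (mul_smul _ _ _).symm⟩
  · rintro _ ⟨γ, α, rfl⟩
    exact ⟨T * γ, α, (mul_smul _ _ _).symm⟩

theorem rep_mul {n : ℕ} (α : reps (n : ℤ)) : α.1.1 0 0 * α.1.1 1 1 = n := by
  have := α.1.2
  rw [Matrix.det_fin_two, α.2.1] at this
  simpa using this

theorem rep_pos (α : reps (n : ℤ)) : 0 < α.1.1 1 1 := by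
  have h1 := rep_mul α
  have h2 := α.2.2.1
  have h3 : (0 : ℤ) < n := by exact_mod_cast NeZero.pos n
  rw [← h1] at h3
  exact pos_of_mul_pos_right h3 h2.le

theorem smul_rep_injective {γ : SL(2, ℤ)} {α β : reps (n : ℤ)} (h : γ • α.1 = β.1) :
    γ = 1 ∧ α = β := by
  have h1 : γ.1 * α.1.1 = β.1.1 := congrArg Subtype.val h
  have hc := congrFun (congrFun h1 1) 0
  have ha := congrFun (congrFun h1 0) 0
  have hb := congrFun (congrFun h1 0) 1
  have hd := congrFun (congrFun h1 1) 1
  simp only [Matrix.mul_apply, Fin.sum_univ_two] at ha hb hc hd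
  have hdet := γ.det_coe
  rw [Matrix.det_fin_two] at hdet
  obtain ⟨a1, a2, a3, a4⟩ := α.2
  obtain ⟨b1, b2, b3, b4⟩ := β.2
  have a5 := rep_pos α
  have b5 := rep_pos β
  rw [abs_of_nonneg a3, abs_of_pos a5] at a4
  rw [abs_of_nonneg b3, abs_of_pos b5] at b4
  rw [a1] at ha hc
  rw [b1] at hc
  have hγc : γ 1 0 = 0 := by
    have : γ 1 0 * α.1.1 0 0 = 0 := by linarith
    exact (mul_eq_zero.1 this).resolve_right a2.ne'
  rw [hγc] at hdet hd
  have hdet' : γ 0 0 * γ 1 1 = 1 := by linarith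
  have hγa : γ 0 0 = 1 ∧ γ 1 1 = 1 := by
    rcases Int.eq_one_or_neg_one_of_mul_eq_one' hdet' with h2 | h2
    · exact h2
    · exfalso
      rw [h2.1] at ha
      linarith
  rw [hγa.1] at ha hb
  rw [hγa.2] at hd
  have hγb : γ 0 1 = 0 := by
    have hd' : α.1.1 1 1 = β.1.1 1 1 := by linarith
    rw [← hd'] at b4
    have h2 : -1 < γ 0 1 := by nlinarith
    have h3 : γ 0 1 < 1 := by nlinarith
    lia
  have hγ : γ = 1 := by
    ext i j
    fin_cases i <;> fin_cases j <;> simp [hγa, hγb, hγc]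
  refine ⟨hγ, ?_⟩
  rw [hγ, one_smul] at h
  exact Subtype.ext h

/-- Every matrix of determinant `n` is uniquely the product of an element of `SL(2, ℤ)` and an
upper triangular representative. -/
noncomputable def repsEquiv (n : ℕ) [NeZero n] : reps (n : ℤ) × SL(2, ℤ) ≃ DetMatrix n :=
  Equiv.ofBijective (fun p ↦ p.2 • p.1.1) (by
    constructor
    · rintro ⟨α, γ⟩ ⟨β, δ⟩ h
      have h1 : (δ⁻¹ * γ) • α.1 = β.1 := by
        rw [mul_smul]
        exact inv_smul_eq_iff.2 h
      obtain ⟨h2, h3⟩ := smul_rep_injective h1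
      rw [inv_mul_eq_one] at h2
      simp [h2, h3]
    · intro A
      obtain ⟨γ, α, h⟩ := exists_smul_rep A
      exact ⟨(α, γ), h.symm⟩)

/-- Right multiplication by `γ` permutes the classes of matrices of determinant `n` modulo left
multiplication by `SL(2, ℤ)`. -/
noncomputable def repsPerm (γ : SL(2, ℤ)) (α : reps (n : ℤ)) : reps (n : ℤ) :=
  ((repsEquiv n).symm (mulRight α.1 γ)).1

theorem exists_mulRight_eq (γ : SL(2, ℤ)) (α : reps (n : ℤ)) :
    ∃ δ : SL(2, ℤ), mulRight α.1 γ = δ • (repsPerm γ α).1 :=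
  ⟨((repsEquiv n).symm (mulRight α.1 γ)).2, ((repsEquiv n).apply_symm_apply _).symm⟩

theorem repsPerm_bijective (γ : SL(2, ℤ)) :
    Function.Bijective (repsPerm γ : reps (n : ℤ) → reps (n : ℤ)) := by
  rw [Fintype.bijective_iff_injective_and_card]
  refine ⟨fun α β h ↦ ?_, rfl⟩
  obtain ⟨δ, h1⟩ := exists_mulRight_eq γ α
  obtain ⟨ε, h2⟩ := exists_mulRight_eq γ β
  have h3 : mulRight β.1 γ = (ε * δ⁻¹) • mulRight α.1 γ := by
    rw [h1, h2, h, mul_smul, inv_smul_smul]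
  rw [← smul_mulRight] at h3
  exact (smul_rep_injective (mulRight_injective γ h3).symm).2

theorem rep_smul (α : reps (n : ℤ)) (z : ℍ) :
    toGL α.1 • z =
      ofComplex (((α.1.1 0 0 : ℂ) * (z : ℂ) + (α.1.1 0 1 : ℂ)) / (α.1.1 1 1 : ℂ)) := by
  rw [← ofComplex_apply (toGL α.1 • z), coe_smul_of_det_pos (det_toGL_pos _)]
  simp [num, denom, α.2.1]

theorem slash_rep (k : ℤ) (f : ℍ → ℂ) (α : reps (n : ℤ)) (z : ℍ) :
    (f ∣[k] toGL α.1) z = (n : ℂ) ^ (k - 1) * ((α.1.1 1 1 : ℂ) ^ (-k) *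
      f (ofComplex (((α.1.1 0 0 : ℂ) * (z : ℂ) + (α.1.1 0 1 : ℂ)) / (α.1.1 1 1 : ℂ)))) := by
  have h1 : denom (toGL α.1) (z : ℂ) = (α.1.1 1 1 : ℂ) := by
    simp [denom, α.2.1]
  have h2 : (f ∣[k] toGL α.1) z = σ (toGL α.1) (f (toGL α.1 • z)) *
    (|(toGL α.1).det.val| : ℝ) ^ (k - 1) * denom (toGL α.1) (z : ℂ) ^ (-k) := rfl
  rw [h2, rep_smul, σ, if_pos (det_toGL_pos _), det_toGL, h1]
  simp
  ring

/-- The Hecke operator `T_n` is the sum of the slash operators of the upper triangular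
representatives. -/
theorem heckeOperator_eq_sum_slash (k : ℤ) (f : ℍ → ℂ) :
    heckeOperator k n f = ∑ α : reps (n : ℤ), f ∣[k] toGL α.1 := by
  ext z
  rw [heckeOperator, Finset.sum_apply]
  simp_rw [slash_rep, Finset.mul_sum]
  rw [Finset.sum_sigma']
  have hmem : ∀ p : (_ : ℕ × ℕ) × ℕ,
      p ∈ n.divisorsAntidiagonal.sigma (fun q ↦ Finset.range q.2) →
      p.1.1 * p.1.2 = n ∧ p.2 < p.1.2 := by
    intro p hp
    rw [Finset.mem_sigma, Nat.mem_divisorsAntidiagonal, Finset.mem_range] at hp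
    exact ⟨hp.1.1, hp.2⟩
  refine Finset.sum_bij (fun p hp ↦ ⟨⟨!![(p.1.1 : ℤ), (p.2 : ℤ); 0, (p.1.2 : ℤ)], ?_⟩, ?_⟩)
    ?_ ?_ ?_ ?_
  · rw [Matrix.det_fin_two_of, mul_zero, sub_zero]
    exact_mod_cast (hmem p hp).1
  · obtain ⟨h1, h2⟩ := hmem p hp
    have h3 : 0 < p.1.1 := Nat.pos_of_ne_zero fun h ↦ NeZero.ne n (by rw [← h1, h, zero_mul])
    refine ⟨rfl, by simpa using h3, by simp, ?_⟩
    simpa using h2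
  · simp
  · rintro ⟨⟨a, d⟩, b⟩ _ ⟨⟨a', d'⟩, b'⟩ _ h
    have h1 := congrArg (fun α : reps (n : ℤ) ↦ α.1.1) h
    have h00 := congrFun (congrFun h1 0) 0
    have h01 := congrFun (congrFun h1 0) 1
    have h11 := congrFun (congrFun h1 1) 1
    simp at h00 h01 h11
    simp [h00, h01, h11]
  · rintro α -
    obtain ⟨h1, h2, h3, h4⟩ := α.2
    have h5 := rep_pos α
    have h6 := rep_mul α
    rw [abs_of_nonneg h3, abs_of_pos h5] at h4
    refine ⟨⟨⟨(α.1.1 0 0).toNat, (α.1.1 1 1).toNat⟩, (α.1.1 0 1).toNat⟩, ?_, ?_⟩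
    · rw [Finset.mem_sigma, Nat.mem_divisorsAntidiagonal, Finset.mem_range]
      refine ⟨⟨?_, NeZero.ne n⟩, by lia⟩
      zify
      simp only [Int.toNat_of_nonneg h2.le, Int.toNat_of_nonneg h5.le, h6]
    · apply Subtype.ext
      apply FixedDetMatrices.ext'
      ext i j
      fin_cases i <;> fin_cases j <;> simp [h1, h2.le, h3, h5.le]
  · rintro p hp
    simp

end DetMatrix

end HeckeMoment

namespace HeckeMoment

open ModularGroup FixedDetMatrices MeasureTheory Filter
open scoped ModularForm Manifold

/-! ### Hecke operators on cusp forms -/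

/-- A cusp form for `SL(2, ℤ)` from a holomorphic function on `ℍ` that is invariant under
`SL(2, ℤ)` and vanishes at `i∞`. -/
def mkCuspForm {k : ℤ} (f : ℍ → ℂ) (h1 : ∀ γ : SL(2, ℤ), f ∣[k] γ = f) (h2 : MDiff f)
    (h3 : IsZeroAtImInfty f) : CuspForm 𝒮ℒ k where
  toFun := f
  slash_action_eq' := fun _ ⟨γ, hγ⟩ ↦ hγ ▸ h1 γ
  holo' := h2
  zero_at_cusps' hc := by
    rw [Subgroup.IsArithmetic.isCusp_iff_isCusp_SL2Z] at hc
    rw [OnePoint.isZeroAt_iff_forall_SL2Z hc]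
    intro γ _
    rw [h1 γ]
    exact h3

variable {k : ℤ}

theorem cuspForm_slash (f : CuspForm 𝒮ℒ k) (γ : SL(2, ℤ)) :
    (f : ℍ → ℂ) ∣[k] (γ : GL (Fin 2) ℝ) = f :=
  f.slash_action_eq' _ ⟨γ, rfl⟩

theorem continuous_cuspForm (f : CuspForm 𝒮ℒ k) : Continuous f := f.holo'.continuous

theorem isZeroAtImInfty_cuspForm (f : CuspForm 𝒮ℒ k) : IsZeroAtImInfty f :=
  CuspFormClass.zero_at_infty f

/-- The Hecke operator `T_n` on cusp forms. -/
noncomputable def heckeCusp (n : ℕ) [NeZero n] (f : CuspForm 𝒮ℒ k) : CuspForm 𝒮ℒ k :=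
  mkCuspForm (heckeOperator k n f)
    (by
      intro γ
      rw [DetMatrix.heckeOperator_eq_sum_slash]
      change (∑ α : reps (n : ℤ), (f : ℍ → ℂ) ∣[k] DetMatrix.toGL α.1) ∣[k] (γ : GL (Fin 2) ℝ) = _
      rw [SlashAction.sum_slash]
      rw [← (DetMatrix.repsPerm_bijective γ).sum_comp fun α ↦ (f : ℍ → ℂ) ∣[k] DetMatrix.toGL α.1]
      refine Finset.sum_congr rfl fun α _ ↦ ?_
      obtain ⟨δ, hδ⟩ := DetMatrix.exists_mulRight_eq γ α
      rw [← SlashAction.slash_mul, ← DetMatrix.toGL_mulRight, hδ, DetMatrix.toGL_smul,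
        SlashAction.slash_mul, cuspForm_slash])
    (by
      rw [DetMatrix.heckeOperator_eq_sum_slash]
      exact MDifferentiable.sum fun α _ ↦ f.holo'.slash _ _)
    (by
      rw [DetMatrix.heckeOperator_eq_sum_slash]
      have h : ∀ α : reps (n : ℤ), IsZeroAtImInfty ((f : ℍ → ℂ) ∣[k] DetMatrix.toGL α.1) := by
        intro α
        refine IsZeroAtImInfty.slash _ ?_ (isZeroAtImInfty_cuspForm f)
        rw [DetMatrix.toGL_apply, α.2.1, Int.cast_zero]
      have := tendsto_finsetSum Finset.univ fun α _ ↦ h α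
      rw [Finset.sum_const_zero] at this
      refine this.congr fun z ↦ ?_
      rw [Finset.sum_apply])

theorem heckeOperator_add (n : ℕ) (f g : ℍ → ℂ) :
    heckeOperator k n (f + g) = heckeOperator k n f + heckeOperator k n g := by
  ext z
  simp only [heckeOperator, Pi.add_apply, Finset.sum_add_distrib, mul_add]

theorem heckeOperator_smul (n : ℕ) (c : ℂ) (f : ℍ → ℂ) :
    heckeOperator k n (c • f) = c • heckeOperator k n f := by
  ext z
  simp only [heckeOperator, Pi.smul_apply, smul_eq_mul, Finset.mul_sum]
  refine Finset.sum_congr rfl fun p _ ↦ Finset.sum_congr rfl fun b _ ↦ ?_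
  ring

/-- The Hecke operator `T_n` as a linear map on cusp forms. -/
noncomputable def heckeLin (n : ℕ) [NeZero n] : CuspForm 𝒮ℒ k →ₗ[ℂ] CuspForm 𝒮ℒ k where
  toFun := heckeCusp n
  map_add' f g := DFunLike.coe_injective (heckeOperator_add n (f : ℍ → ℂ) g)
  map_smul' c f := DFunLike.coe_injective (heckeOperator_smul n c (f : ℍ → ℂ))

@[simp]
theorem coe_heckeLin (n : ℕ) [NeZero n] (f : CuspForm 𝒮ℒ k) :
    (heckeLin n f : ℍ → ℂ) = heckeOperator k n f := rfl

/-! ### The Petersson inner product and the symmetry of the Hecke operators -/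

theorem norm_petersson_sq (f g : ℍ → ℂ) (z : ℍ) :
    ‖petersson k f g z‖ ^ 2 = ‖petersson k f f z‖ * ‖petersson k g g z‖ := by
  simp only [petersson, norm_mul, Complex.norm_conj]
  ring

theorem exists_norm_petersson_slash_le {n : ℕ} [NeZero n] (f g : CuspForm 𝒮ℒ k)
    (A : DetMatrix n) :
    ∃ C, ∀ z, ‖petersson k ((f : ℍ → ℂ) ∣[k] DetMatrix.toGL A) g z‖ ≤ C := by
  obtain ⟨C, hC⟩ := CuspFormClass.petersson_bounded_left k 𝒮ℒ f f
  obtain ⟨D, hD⟩ := CuspFormClass.petersson_bounded_left k 𝒮ℒ g g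
  refine ⟨√(((n : ℝ) ^ (k - 2) * C) * D), fun z ↦ Real.le_sqrt_of_sq_le ?_⟩
  rw [norm_petersson_sq]
  refine mul_le_mul ?_ (hD z) (norm_nonneg _) ?_
  · rw [petersson_slash, DetMatrix.det_toGL, norm_mul, norm_σ]
    refine le_of_eq_of_le ?_ (mul_le_mul_of_nonneg_left (hC (DetMatrix.toGL A • z)) ?_)
    · simp
    · positivity
  · have := (norm_nonneg _).trans (hC z)
    positivity

theorem integrableOn_petersson_slash {n : ℕ} [NeZero n] (f g : CuspForm 𝒮ℒ k) (A : DetMatrix n) :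
    IntegrableOn (petersson k ((f : ℍ → ℂ) ∣[k] DetMatrix.toGL A) g) fd := by
  obtain ⟨C, hC⟩ := exists_norm_petersson_slash_le f g A
  refine Measure.integrableOn_of_bounded volume_fd_lt_top.ne ?_ (.of_forall hC)
  exact (petersson_continuous k (f.holo'.slash _ _).continuous
    (continuous_cuspForm g)).aestronglyMeasurable

theorem integrableOn_petersson (f g : CuspForm 𝒮ℒ k) : IntegrableOn (petersson k f g) fd := by
  obtain ⟨C, hC⟩ := CuspFormClass.petersson_bounded_left k 𝒮ℒ f g
  exact Measure.integrableOn_of_bounded volume_fd_lt_top.ne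
    (petersson_continuous k (continuous_cuspForm f) (continuous_cuspForm g)).aestronglyMeasurable
    (.of_forall hC)

/-- The integral of `⟨f | A, g⟩` over the part of the fundamental domain that `A` maps into the
fundamental domain. -/
noncomputable def pairing {n : ℕ} [NeZero n] (f g : CuspForm 𝒮ℒ k) (A : DetMatrix n) : ℂ :=
  ∫ z in fd, fd.indicator (fun _ ↦ petersson k ((f : ℍ → ℂ) ∣[k] DetMatrix.toGL A) g z)
    (DetMatrix.toGL A • z)

theorem slash_toGL_adj {n : ℕ} [NeZero n] (f : ℍ → ℂ) (A : DetMatrix n) :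
    (f ∣[k] DetMatrix.toGL A) ∣[k] DetMatrix.toGL A.adj = (n : ℂ) ^ (k - 2) • f := by
  have hn : (n : ℂ) ≠ 0 := Nat.cast_ne_zero.2 (NeZero.ne n)
  rw [← SlashAction.slash_mul, DetMatrix.toGL_mul_toGL_adj]
  ext z
  rw [ModularForm.slash_apply, glScalar_smul, denom_scalar]
  have h1 : (0 : ℝ) < (Matrix.GeneralLinearGroup.scalar (Fin 2)
      (Units.mk0 (n : ℝ) (Nat.cast_ne_zero.2 (NeZero.ne n)))).det.val := by
    rw [← DetMatrix.toGL_mul_toGL_adj A, map_mul, Units.val_mul]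
    exact mul_pos (DetMatrix.det_toGL_pos A) (DetMatrix.det_toGL_pos _)
  have h2 : (Matrix.GeneralLinearGroup.scalar (Fin 2)
      (Units.mk0 (n : ℝ) (Nat.cast_ne_zero.2 (NeZero.ne n)))).det.val = (n : ℝ) * n := by
    rw [← DetMatrix.toGL_mul_toGL_adj A, map_mul, Units.val_mul, DetMatrix.det_toGL,
      DetMatrix.det_toGL]
  rw [σ, if_pos h1, h2, abs_of_nonneg (by positivity)]
  simp only [Pi.smul_apply, smul_eq_mul, Units.val_mk0, Complex.ofReal_mul,
    Complex.ofReal_natCast]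
  rw [mul_zpow, ← zpow_add₀ hn, mul_assoc, mul_comm, ← zpow_add₀ hn]
  congr 2
  ring

theorem petersson_slash_toGL_adj {n : ℕ} [NeZero n] (f g : ℍ → ℂ) (A : DetMatrix n) (z : ℍ) :
    petersson k (f ∣[k] DetMatrix.toGL A) g (DetMatrix.toGL A.adj • z) =
      petersson k f (g ∣[k] DetMatrix.toGL A.adj) z := by
  have hn : (n : ℂ) ≠ 0 := Nat.cast_ne_zero.2 (NeZero.ne n)
  have h := petersson_slash k (f ∣[k] DetMatrix.toGL A) g (DetMatrix.toGL A.adj) z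
  rw [slash_toGL_adj, DetMatrix.det_toGL, σ, if_pos (DetMatrix.det_toGL_pos _)] at h
  have h1 : petersson k ((n : ℂ) ^ (k - 2) • f) (g ∣[k] DetMatrix.toGL A.adj) z =
      (n : ℂ) ^ (k - 2) * petersson k f (g ∣[k] DetMatrix.toGL A.adj) z := by
    simp only [petersson, Pi.smul_apply, smul_eq_mul, map_mul, map_zpow₀, Complex.conj_natCast]
    ring
  rw [h1] at h
  simp only [Nat.abs_cast, Complex.ofReal_natCast] at h
  exact (mul_left_cancel₀ (zpow_ne_zero _ hn) h).symm

/-- Substituting `z ↦ A⁻¹ z` exchanges the two arguments of the pairing. -/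
theorem pairing_adj {n : ℕ} [NeZero n] (f g : CuspForm 𝒮ℒ k) (A : DetMatrix n) :
    pairing f g A = starRingEnd ℂ (pairing g f A.adj) := by
  rw [pairing, pairing, ← integral_conj, ← integral_indicator measurableSet_fd,
    ← integral_indicator measurableSet_fd]
  have h1 := (measurePreserving_gl_smul (DetMatrix.toGL A.adj)).integral_comp
    (measurableEmbedding_gl_smul _) (fd.indicator fun z ↦
      fd.indicator (fun _ ↦ petersson k ((f : ℍ → ℂ) ∣[k] DetMatrix.toGL A) g z)
        (DetMatrix.toGL A • z))
  rw [← h1]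
  refine integral_congr_ae (.of_forall fun z ↦ ?_)
  change fd.indicator _ _ = fd.indicator _ _
  by_cases hz : z ∈ fd
  · by_cases hz' : DetMatrix.toGL A.adj • z ∈ fd
    · rw [Set.indicator_of_mem hz', Set.indicator_of_mem hz, DetMatrix.toGL_smul_toGL_adj_smul,
        Set.indicator_of_mem hz, Set.indicator_of_mem hz', petersson_slash_toGL_adj,
        petersson_symm]
    · rw [Set.indicator_of_notMem hz', Set.indicator_of_mem hz, Set.indicator_of_notMem hz',
        map_zero]
  · rw [Set.indicator_of_notMem hz]
    by_cases hz' : DetMatrix.toGL A.adj • z ∈ fd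
    · rw [Set.indicator_of_mem hz', DetMatrix.toGL_smul_toGL_adj_smul, Set.indicator_of_notMem hz]
    · rw [Set.indicator_of_notMem hz']

theorem pairing_smul {n : ℕ} [NeZero n] (f g : CuspForm 𝒮ℒ k) (A : DetMatrix n) (γ : SL(2, ℤ)) :
    pairing f g (γ • A) = ∫ z, fd.indicator (fun _ ↦ fd.indicator
      (petersson k ((f : ℍ → ℂ) ∣[k] DetMatrix.toGL A) g) z) (γ • (DetMatrix.toGL A • z)) := by
  rw [pairing, DetMatrix.toGL_smul, SlashAction.slash_mul, cuspForm_slash,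
    ← integral_indicator measurableSet_fd]
  refine integral_congr_ae (.of_forall fun z ↦ ?_)
  simp only [mul_smul]
  by_cases hz : z ∈ fd
  · simp only [Set.indicator_of_mem hz]
    rfl
  · simp only [Set.indicator_of_notMem hz]
    exact (congrFun (Set.indicator_zero ℂ fd) _).symm

/-- The sum of the pairing over all matrices of determinant `n`: in each coset `SL(2, ℤ) α` the
fundamental domain is translated over `ℍ`, which covers `ℍ` twice and leaves twice the inner product
of `f | α` and `g`. -/
theorem hasSum_pairing {n : ℕ} [NeZero n] (f g : CuspForm 𝒮ℒ k) :
    HasSum (pairing (n := n) f g) (2 * ∫ z in fd, petersson k (heckeLin n f) g z) := by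
  have hm : ∀ α : reps (n : ℤ), Measurable
      (fd.indicator (petersson k ((f : ℍ → ℂ) ∣[k] DetMatrix.toGL α.1) g)) := fun α ↦
    (petersson_continuous k (f.holo'.slash _ _).continuous
      (continuous_cuspForm g)).measurable.indicator measurableSet_fd
  have hi : ∀ α : reps (n : ℤ), Integrable
      (fd.indicator (petersson k ((f : ℍ → ℂ) ∣[k] DetMatrix.toGL α.1) g)) := fun α ↦
    (integrable_indicator_iff measurableSet_fd).2 (integrableOn_petersson_slash f g α.1)
  rw [← (DetMatrix.repsEquiv n).hasSum_iff]
  have h1 : ∀ α : reps (n : ℤ), HasSum (fun γ : SL(2, ℤ) ↦ pairing f g (γ • α.1))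
      (2 * ∫ z in fd, petersson k ((f : ℍ → ℂ) ∣[k] DetMatrix.toGL α.1) g z) := by
    intro α
    have := hasSum_integral_indicator_fd (DetMatrix.toGL α.1) (hi α) (hm α)
    rw [integral_indicator measurableSet_fd] at this
    exact this.congr_fun fun γ ↦ pairing_smul f g α.1 γ
  have h2 : ∀ α : reps (n : ℤ), Summable fun γ : SL(2, ℤ) ↦ ‖pairing f g (γ • α.1)‖ := by
    intro α
    refine (summable_integral_norm_indicator_fd (DetMatrix.toGL α.1) (hi α)
      (hm α)).of_nonneg_of_le (fun _ ↦ norm_nonneg _) fun γ ↦ ?_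
    rw [pairing_smul]
    exact norm_integral_le_integral_norm _
  have h3 : Summable (pairing (n := n) f g ∘ DetMatrix.repsEquiv n) := by
    refine Summable.of_norm ((summable_prod_of_nonneg fun _ ↦ norm_nonneg _).2 ⟨h2, ?_⟩)
    exact (hasSum_fintype _).summable
  have h4 := (h3.hasSum.prod_fiberwise h1).unique (hasSum_fintype _)
  have h5 : 2 * ∫ z in fd, petersson k (heckeLin n f) g z = ∑ α : reps (n : ℤ),
      2 * ∫ z in fd, petersson k ((f : ℍ → ℂ) ∣[k] DetMatrix.toGL α.1) g z := by
    have h6 := integral_finsetSum (μ := volume.restrict fd) Finset.univ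
      fun (α : reps (n : ℤ)) _ ↦ integrableOn_petersson_slash f g α.1
    rw [← Finset.mul_sum, ← h6]
    congr 1
    refine integral_congr_ae (.of_forall fun z ↦ ?_)
    simp only [petersson, coe_heckeLin, DetMatrix.heckeOperator_eq_sum_slash, Finset.sum_apply,
      map_sum, Finset.sum_mul]
  rw [h5, ← h4]
  exact h3.hasSum

/-- The Hecke operators are symmetric for the Petersson inner product. -/
theorem setIntegral_petersson_heckeLin {n : ℕ} [NeZero n] (f g : CuspForm 𝒮ℒ k) :
    ∫ z in fd, petersson k (heckeLin n f) g z = ∫ z in fd, petersson k f (heckeLin n g) z := by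
  have h1 := hasSum_pairing (n := n) f g
  have h2 := (hasSum_pairing (n := n) g f).map (starRingEnd ℂ) Complex.continuous_conj
  have h3 := DetMatrix.adjEquiv.hasSum_iff.2 h2
  have h4 : (pairing (n := n) f g) =
      ((starRingEnd ℂ) ∘ pairing g f) ∘ DetMatrix.adjEquiv := by
    ext A
    exact pairing_adj f g A
  rw [← h4] at h3
  have h5 := h1.unique h3
  rw [map_mul, Complex.conj_ofNat] at h5
  have h6 := mul_left_cancel₀ two_ne_zero h5
  rw [← integral_conj] at h6
  rw [h6]
  refine integral_congr_ae (.of_forall fun z ↦ ?_)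
  exact (petersson_symm k _ _ z).symm

end HeckeMoment

namespace HeckeMoment

open ModularGroup FixedDetMatrices MeasureTheory Filter
open scoped ModularForm Manifold

variable {k : ℤ}

/-! ### Hecke operators on Fourier coefficients -/

theorem one_mem_strictPeriods : (1 : ℝ) ∈ (𝒮ℒ : Subgroup (GL (Fin 2) ℝ)).strictPeriods :=
  one_mem_strictPeriods_SL

/-- The `m`-th Fourier coefficient as a linear functional on cusp forms. -/
noncomputable def fourierCoeff (m : ℕ) : CuspForm 𝒮ℒ k →ₗ[ℂ] ℂ where
  toFun f := (qExpansion 1 f).coeff m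
  map_add' f g := by
    have := ModularForm.qExpansion_add one_pos one_mem_strictPeriods f g
    rw [FunLike.coe_add, this, map_add]
  map_smul' c f := by
    have := ModularForm.qExpansion_smul one_pos one_mem_strictPeriods c f
    rw [FunLike.coe_smul, this]
    simp

theorem fourierCoeff_apply (m : ℕ) (f : CuspForm 𝒮ℒ k) :
    fourierCoeff m f = (qExpansion 1 f).coeff m := rfl

theorem fourierCoeff_zero (f : CuspForm 𝒮ℒ k) : fourierCoeff 0 f = 0 :=
  CuspFormClass.qExpansion_coeff_zero f one_pos one_mem_strictPeriods

theorem hasSum_fourierCoeff (f : CuspForm 𝒮ℒ k) (z : ℍ) :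
    HasSum (fun m : ℕ ↦ fourierCoeff m f * Complex.exp (2 * Real.pi * Complex.I * z) ^ m)
      (f z) := by
  have h := ModularForm.hasSum_qExpansion f one_pos one_mem_strictPeriods z
  simpa [Function.Periodic.qParam, fourierCoeff_apply] using h

theorem fourierCoeff_unique {f : CuspForm 𝒮ℒ k} {c : ℕ → ℂ}
    (h : ∀ z : ℍ, HasSum (fun m : ℕ ↦ c m * Complex.exp (2 * Real.pi * Complex.I * z) ^ m) (f z))
    (m : ℕ) : fourierCoeff m f = c m := by
  refine (ModularFormClass.qExpansion_coeff_unique (f := f) one_pos one_mem_strictPeriods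
    (fun z ↦ ?_) m).symm
  simpa [Function.Periodic.qParam] using h z

theorem eq_of_fourierCoeff_eq {f g : CuspForm 𝒮ℒ k}
    (h : ∀ m, fourierCoeff m f = fourierCoeff m g) : f = g := by
  ext z
  refine (hasSum_fourierCoeff f z).unique ?_
  simp_rw [h]
  exact hasSum_fourierCoeff g z

/-- The action of `T_n` on sequences of Fourier coefficients:
`(T_n c)_m = ∑_{d ∣ (m, n)} d ^ (k - 1) c_{m n / d ^ 2}`. -/
noncomputable def heckeCoeff (k : ℤ) (n : ℕ) (c : ℕ → ℂ) (m : ℕ) : ℂ :=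
  ∑ d ∈ n.divisors with d ∣ m, (d : ℂ) ^ (k - 1) * c (n / d * (m / d))

theorem sum_exp_eq_ite {d : ℕ} (hd : 0 < d) (m : ℕ) :
    ∑ b ∈ Finset.range d, Complex.exp (2 * Real.pi * Complex.I * (b / d)) ^ m =
      if d ∣ m then (d : ℂ) else 0 := by
  have hζ := Complex.isPrimitiveRoot_exp d hd.ne'
  have h1 : ∀ b : ℕ, Complex.exp (2 * Real.pi * Complex.I * (b / d)) ^ m =
      (Complex.exp (2 * Real.pi * Complex.I / d) ^ m) ^ b := by
    intro b
    rw [← Complex.exp_nat_mul, ← Complex.exp_nat_mul, ← Complex.exp_nat_mul]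
    congr 1
    ring
  simp_rw [h1]
  split_ifs with h
  · rw [(hζ.pow_eq_one_iff_dvd m).2 h]
    simp
  · have h2 : Complex.exp (2 * Real.pi * Complex.I / d) ^ m ≠ 1 := fun h3 ↦
      h ((hζ.pow_eq_one_iff_dvd m).1 h3)
    have h3 := geom_sum_mul (Complex.exp (2 * Real.pi * Complex.I / d) ^ m) d
    rw [← pow_mul, mul_comm m d, pow_mul, hζ.pow_eq_one, one_pow, sub_self] at h3
    exact (mul_eq_zero.1 h3).resolve_right (sub_ne_zero.2 h2)

/-- The contribution of one factorisation `a d = n` to the Fourier expansion of `T_n f`: the sum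
over `b` modulo `d` keeps the coefficients whose index is divisible by `d`. -/
theorem hasSum_hecke_summand (f : CuspForm 𝒮ℒ k) {a d : ℕ} (ha : 0 < a) (hd : 0 < d) (z : ℍ) :
    HasSum (fun m : ℕ ↦ if a ∣ m then (a : ℂ) ^ (k - 1) * fourierCoeff (d * (m / a)) f *
        Complex.exp (2 * Real.pi * Complex.I * z) ^ m else 0)
      (((a * d : ℕ) : ℂ) ^ (k - 1) * ((d : ℂ) ^ (-k) * ∑ b ∈ Finset.range d,
        f (ofComplex (((a : ℂ) * (z : ℂ) + (b : ℂ)) / (d : ℂ))))) := by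
  have hd0 : (d : ℂ) ≠ 0 := Nat.cast_ne_zero.2 hd.ne'
  have him : ∀ b : ℕ, 0 < (((a : ℂ) * (z : ℂ) + (b : ℂ)) / (d : ℂ)).im := by
    intro b
    rw [Complex.div_natCast_im]
    simp only [Complex.add_im, Complex.natCast_im, add_zero, Complex.mul_im, Complex.natCast_re,
      zero_mul, coe_im]
    have := z.im_pos
    positivity
  have h1 : ∀ b ∈ Finset.range d, HasSum (fun m : ℕ ↦ fourierCoeff m f *
      (Complex.exp (2 * Real.pi * Complex.I * (a * z / d)) ^ m *
        Complex.exp (2 * Real.pi * Complex.I * (b / d)) ^ m))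
      (f (ofComplex (((a : ℂ) * (z : ℂ) + (b : ℂ)) / (d : ℂ)))) := by
    intro b _
    have h := hasSum_fourierCoeff f (ofComplex (((a : ℂ) * (z : ℂ) + (b : ℂ)) / (d : ℂ)))
    rw [ofComplex_apply_of_im_pos (him b)] at h ⊢
    refine h.congr_fun fun m ↦ ?_
    rw [← mul_pow, ← Complex.exp_add]
    congr 3
    change _ = 2 * Real.pi * Complex.I * (((a : ℂ) * (z : ℂ) + (b : ℂ)) / (d : ℂ))
    ring
  have h2 := ((hasSum_sum h1).mul_left ((d : ℂ) ^ (-k))).mul_left (((a * d : ℕ) : ℂ) ^ (k - 1))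
  have h3 : ∀ m : ℕ, ((a * d : ℕ) : ℂ) ^ (k - 1) * ((d : ℂ) ^ (-k) * ∑ b ∈ Finset.range d,
      fourierCoeff m f * (Complex.exp (2 * Real.pi * Complex.I * (a * z / d)) ^ m *
        Complex.exp (2 * Real.pi * Complex.I * (b / d)) ^ m)) =
      if d ∣ m then (a : ℂ) ^ (k - 1) * (fourierCoeff m f *
        Complex.exp (2 * Real.pi * Complex.I * (a * z / d)) ^ m) else 0 := by
    intro m
    simp_rw [← mul_assoc, ← Finset.mul_sum]
    rw [sum_exp_eq_ite hd]
    split_ifs with h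
    · have h4 : (d : ℂ) ^ (k - 1) * (d : ℂ) ^ (-k) * d = 1 := by
        rw [← zpow_add₀ hd0, ← zpow_add_one₀ hd0, show k - 1 + -k + 1 = 0 by ring, zpow_zero]
      rw [Nat.cast_mul, mul_zpow]
      linear_combination (a : ℂ) ^ (k - 1) * fourierCoeff m f *
        Complex.exp (2 * Real.pi * Complex.I * (a * z / d)) ^ m * h4
    · simp
  have h5 := h2.congr_fun (fun m ↦ (h3 m).symm)
  have hinj1 : Function.Injective fun j : ℕ ↦ d * j := fun i j h ↦ Nat.eq_of_mul_eq_mul_left hd h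
  have hinj2 : Function.Injective fun j : ℕ ↦ a * j := fun i j h ↦ Nat.eq_of_mul_eq_mul_left ha h
  rw [← hinj1.hasSum_iff] at h5
  · rw [← hinj2.hasSum_iff]
    · refine h5.congr_fun fun j ↦ ?_
      simp only [Function.comp, dvd_mul_right, if_true, Nat.mul_div_cancel_left _ ha]
      rw [mul_assoc]
      congr 2
      rw [← Complex.exp_nat_mul, ← Complex.exp_nat_mul]
      congr 1
      push_cast
      field_simp
    · intro m hm
      rw [if_neg]
      rintro ⟨j, rfl⟩
      exact hm ⟨j, rfl⟩
  · intro m hm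
    rw [if_neg]
    rintro ⟨j, rfl⟩
    exact hm ⟨j, rfl⟩

theorem hasSum_heckeOperator (f : CuspForm 𝒮ℒ k) (n : ℕ) (z : ℍ) :
    HasSum (fun m : ℕ ↦ heckeCoeff k n (fun m ↦ fourierCoeff m f) m *
      Complex.exp (2 * Real.pi * Complex.I * z) ^ m) (heckeOperator k n f z) := by
  have h1 : ∀ p ∈ n.divisorsAntidiagonal, HasSum (fun m : ℕ ↦ if p.1 ∣ m then
      (p.1 : ℂ) ^ (k - 1) * fourierCoeff (p.2 * (m / p.1)) f *
        Complex.exp (2 * Real.pi * Complex.I * z) ^ m else 0)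
      ((n : ℂ) ^ (k - 1) * ((p.2 : ℂ) ^ (-k) * ∑ b ∈ Finset.range p.2,
        f (ofComplex (((p.1 : ℂ) * (z : ℂ) + (b : ℂ)) / (p.2 : ℂ))))) := by
    rintro ⟨a, d⟩ hp
    obtain ⟨rfl, h0⟩ := Nat.mem_divisorsAntidiagonal.1 hp
    exact hasSum_hecke_summand f (Nat.pos_of_ne_zero (left_ne_zero_of_mul h0))
      (Nat.pos_of_ne_zero (right_ne_zero_of_mul h0)) z
  have h2 := hasSum_sum h1
  rw [← Finset.mul_sum] at h2
  refine h2.congr_fun fun m ↦ ?_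
  have h3 := Nat.sum_divisorsAntidiagonal (n := n) fun a d ↦ if a ∣ m then
    (a : ℂ) ^ (k - 1) * fourierCoeff (d * (m / a)) f *
        Complex.exp (2 * Real.pi * Complex.I * z) ^ m else 0
  rw [h3, heckeCoeff, Finset.sum_mul, Finset.sum_filter]

theorem fourierCoeff_heckeLin (n : ℕ) [NeZero n] (f : CuspForm 𝒮ℒ k) (m : ℕ) :
    fourierCoeff m (heckeLin n f) = heckeCoeff k n (fun m ↦ fourierCoeff m f) m :=
  fourierCoeff_unique (fun z ↦ hasSum_heckeOperator f n z) m

theorem heckeCoeff_one (k : ℤ) (n : ℕ) [NeZero n] (c : ℕ → ℂ) : heckeCoeff k n c 1 = c n := by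
  have : {d ∈ n.divisors | d ∣ 1} = {1} := by
    ext d
    simp only [Finset.mem_filter, Nat.mem_divisors, Nat.dvd_one, Finset.mem_singleton]
    constructor
    · exact fun h ↦ h.2
    · rintro rfl
      exact ⟨⟨one_dvd _, NeZero.ne n⟩, rfl⟩
  rw [heckeCoeff, this]
  simp

/-- `T_n T_p = T_{p n} + p ^ (k - 1) T_{n / p}` for `p` prime, the last term being absent if `p`
does not divide `n`. -/
theorem heckeCoeff_heckeCoeff_prime (k : ℤ) {n p : ℕ} (hn : 0 < n) (hp : p.Prime) (c : ℕ → ℂ)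
    (m : ℕ) :
    heckeCoeff k n (heckeCoeff k p c) m = heckeCoeff k (p * n) c m +
      if p ∣ n then (p : ℂ) ^ (k - 1) * heckeCoeff k (n / p) c m else 0 := by
  have h1 : ∀ l, heckeCoeff k p c l =
      c (p * l) + if p ∣ l then (p : ℂ) ^ (k - 1) * c (l / p) else 0 := by
    intro l
    rw [heckeCoeff, hp.divisors, Finset.sum_filter, Finset.sum_pair hp.one_lt.ne]
    simp [Nat.div_self hp.pos]
  have hdiv : ∀ {d : ℕ}, d ∣ n → 0 < d := fun h ↦ Nat.pos_of_dvd_of_pos h hn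
  -- the divisors of `p n` that divide `n` give the first half of `T_n T_p`
  have h2 : ∑ e ∈ (p * n).divisors with e ∣ m ∧ e ∣ n, (e : ℂ) ^ (k - 1) * c (p * n / e * (m / e)) =
      ∑ d ∈ n.divisors with d ∣ m, (d : ℂ) ^ (k - 1) * c (p * (n / d * (m / d))) := by
    refine Finset.sum_congr ?_ fun d hd ↦ ?_
    · ext d
      simp only [Finset.mem_filter, Nat.mem_divisors]
      constructor
      · rintro ⟨-, h, h'⟩
        exact ⟨⟨h', hn.ne'⟩, h⟩
      · rintro ⟨⟨h, -⟩, h'⟩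
        exact ⟨⟨h.mul_left _, mul_ne_zero hp.ne_zero hn.ne'⟩, h', h⟩
    · simp only [Finset.mem_filter, Nat.mem_divisors] at hd
      rw [Nat.mul_div_assoc _ hd.1.1, mul_assoc]
  -- the divisors `p d` of `p n` that do not divide `n`
  have h3 : ∑ e ∈ (p * n).divisors with e ∣ m ∧ ¬ e ∣ n,
      (e : ℂ) ^ (k - 1) * c (p * n / e * (m / e)) =
      ∑ d ∈ n.divisors with (d ∣ m ∧ p ∣ n / d * (m / d)) ∧ ¬ p * d ∣ n,
        (d : ℂ) ^ (k - 1) * ((p : ℂ) ^ (k - 1) * c (n / d * (m / d) / p)) := by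
    symm
    refine Finset.sum_bij (fun d _ ↦ p * d) ?_ ?_ ?_ ?_
    · intro d hd
      simp only [Finset.mem_filter, Nat.mem_divisors] at hd ⊢
      obtain ⟨⟨hd1, -⟩, ⟨hd2, hd3⟩, hd4⟩ := hd
      refine ⟨⟨Nat.mul_dvd_mul_left _ hd1, mul_ne_zero hp.ne_zero hn.ne'⟩, ?_, hd4⟩
      rcases (hp.dvd_mul).1 hd3 with h | h
      · exact absurd ((Nat.dvd_div_iff_mul_dvd hd1).1 h) (by rwa [mul_comm] at hd4)
      · have := (Nat.dvd_div_iff_mul_dvd hd2).1 h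
        rwa [mul_comm] at this
    · intro d _ d' _ h
      exact Nat.eq_of_mul_eq_mul_left hp.pos h
    · intro e he
      simp only [Finset.mem_filter, Nat.mem_divisors] at he
      obtain ⟨⟨he1, -⟩, he2, he3⟩ := he
      have hpe : p ∣ e := by
        by_contra h
        exact he3 (((Nat.Prime.coprime_iff_not_dvd hp).2 h).symm.dvd_of_dvd_mul_left he1)
      obtain ⟨d, rfl⟩ := hpe
      have hd1 : d ∣ n := Nat.dvd_of_mul_dvd_mul_left hp.pos he1
      have hd2 : d ∣ m := (Dvd.intro_left _ rfl).trans he2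
      refine ⟨d, ?_, rfl⟩
      simp only [Finset.mem_filter, Nat.mem_divisors]
      refine ⟨⟨hd1, hn.ne'⟩, ⟨hd2, ?_⟩, he3⟩
      exact ((Nat.dvd_div_iff_mul_dvd hd2).2 (by rwa [mul_comm])).mul_left _
    · intro d hd
      simp only [Finset.mem_filter, Nat.mem_divisors] at hd
      obtain ⟨⟨hd1, -⟩, ⟨hd2, hd3⟩, hd4⟩ := hd
      have hpm : p ∣ m / d := by
        rcases (hp.dvd_mul).1 hd3 with h | h
        · exact absurd ((Nat.dvd_div_iff_mul_dvd hd1).1 h) (by rwa [mul_comm] at hd4)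
        · exact h
      rw [Nat.mul_div_mul_left _ _ hp.pos, Nat.mul_div_assoc _ hpm, Nat.div_div_eq_div_mul,
        mul_comm d p, Nat.cast_mul, mul_zpow]
      ring
  -- the remaining terms form `T_{n / p}`
  have h4 : (if p ∣ n then (p : ℂ) ^ (k - 1) * heckeCoeff k (n / p) c m else 0) =
      ∑ d ∈ n.divisors with (d ∣ m ∧ p ∣ n / d * (m / d)) ∧ p * d ∣ n,
        (d : ℂ) ^ (k - 1) * ((p : ℂ) ^ (k - 1) * c (n / d * (m / d) / p)) := by
    split_ifs with hpn
    · rw [heckeCoeff, Finset.mul_sum]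
      refine Finset.sum_congr ?_ fun d hd ↦ ?_
      · ext d
        simp only [Finset.mem_filter, Nat.mem_divisors]
        constructor
        · rintro ⟨⟨hd1, -⟩, hd2⟩
          have hd3 : p * d ∣ n := (Nat.dvd_div_iff_mul_dvd hpn).1 hd1
          have hd4 : d ∣ n := (Dvd.intro_left _ rfl).trans hd3
          refine ⟨⟨hd4, hn.ne'⟩, ⟨hd2, ?_⟩, hd3⟩
          exact ((Nat.dvd_div_iff_mul_dvd hd4).2 (by rwa [mul_comm])).mul_right _
        · rintro ⟨⟨hd1, -⟩, ⟨hd2, -⟩, hd3⟩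
          refine ⟨⟨(Nat.dvd_div_iff_mul_dvd hpn).2 hd3, ?_⟩, hd2⟩
          exact (Nat.div_pos (Nat.le_of_dvd hn hpn) hp.pos).ne'
      · simp only [Finset.mem_filter, Nat.mem_divisors] at hd
        have hd3 : p * d ∣ n := hd.2.2
        have hd4 : d ∣ n := (Dvd.intro_left _ rfl).trans hd3
        have hd5 : p ∣ n / d := (Nat.dvd_div_iff_mul_dvd hd4).2 (by rwa [mul_comm])
        rw [mul_comm (n / d), Nat.mul_div_assoc _ hd5, Nat.div_div_eq_div_mul,
          Nat.div_div_eq_div_mul, mul_comm d p, mul_comm (m / d)]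
        ring
    · symm
      apply Finset.sum_eq_zero
      intro d hd
      simp only [Finset.mem_filter] at hd
      exact absurd ((Dvd.intro _ rfl).trans hd.2.2) hpn
  have h5 := Finset.sum_filter_add_sum_filter_not
    {d ∈ n.divisors | d ∣ m ∧ p ∣ n / d * (m / d)} (fun d ↦ p * d ∣ n)
    fun d ↦ (d : ℂ) ^ (k - 1) * ((p : ℂ) ^ (k - 1) * c (n / d * (m / d) / p))
  rw [Finset.filter_filter, Finset.filter_filter, ← h3, ← h4, ← Finset.filter_filter (· ∣ m)
    (fun d ↦ p ∣ n / d * (m / d)), Finset.sum_filter (fun d ↦ p ∣ n / d * (m / d))] at h5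
  have h6 := Finset.sum_filter_add_sum_filter_not {e ∈ (p * n).divisors | e ∣ m} (· ∣ n)
    fun e ↦ (e : ℂ) ^ (k - 1) * c (p * n / e * (m / e))
  rw [Finset.filter_filter, Finset.filter_filter, h2] at h6
  change _ = heckeCoeff k (p * n) c m at h6
  rw [← h6, add_assoc, add_comm _ (if p ∣ n then _ else _), h5, ← Finset.sum_add_distrib,
    heckeCoeff]
  refine Finset.sum_congr rfl fun d _ ↦ ?_
  rw [h1]
  split_ifs <;> ring

end HeckeMoment

namespace HeckeMoment

open ModularGroup FixedDetMatrices MeasureTheory Filter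
open scoped ModularForm Manifold ENNReal

variable {k : ℤ}

/-! ### The basis of Hecke eigenforms -/

instance : (volume : Measure ℍ).IsOpenPosMeasure where
  open_pos U hU hne h := by
    have hU' : IsOpen ((↑) '' U : Set ℂ) := isOpenEmbedding_coe.isOpenMap U hU
    rw [volume_eq_lintegral, setLIntegral_eq_zero_iff hU'.measurableSet (by fun_prop)] at h
    refine (hU'.measure_pos volume (hne.image _)).ne' ?_
    refine measure_eq_zero_iff_ae_notMem.2 ?_
    filter_upwards [h] with x hx hxU
    have h0 := hx hxU
    obtain ⟨z, -, rfl⟩ := hxU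
    simp [z.im_ne_zero] at h0

instance : FiniteDimensional ℂ (CuspForm 𝒮ℒ k) :=
  Module.Finite.of_injective _ CuspForm.toModularFormₗ_injective

theorem petersson_self (f : ℍ → ℂ) (z : ℍ) :
    petersson k f f z = ((‖f z‖ ^ 2 * z.im ^ k : ℝ) : ℂ) := by
  rw [petersson, Complex.conj_mul']
  push_cast
  rfl

theorem integral_petersson_self (f : ℍ → ℂ) :
    ∫ z in fd, petersson k f f z = ((∫ z in fd, ‖f z‖ ^ 2 * z.im ^ k : ℝ) : ℂ) := by
  simp_rw [petersson_self]
  exact integral_ofReal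

theorem integral_petersson_self_nonneg (f : ℍ → ℂ) : 0 ≤ ∫ z in fd, ‖f z‖ ^ 2 * z.im ^ k :=
  integral_nonneg fun z ↦ by have := z.im_pos; positivity

theorem eq_zero_of_petersson_self_eq_zero {f : CuspForm 𝒮ℒ k}
    (h : ∫ z in fd, petersson k f f z = 0) : f = 0 := by
  rw [integral_petersson_self, Complex.ofReal_eq_zero, integral_eq_zero_iff_of_nonneg] at h
  rotate_left
  · intro z
    have := z.im_pos
    simp only [Pi.zero_apply]
    positivity
  · have := (integrableOn_petersson f f).re
    simp_rw [petersson_self] at this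
    exact this
  have h1 : ⇑f =ᵐ[volume.restrict fdo] fun _ ↦ (0 : ℂ) := by
    refine ae_restrict_of_ae_restrict_of_subset fdo_subset_fd ?_
    filter_upwards [h] with z hz
    have := z.im_pos
    have h2 : ‖f z‖ ^ 2 * z.im ^ k = 0 := hz
    rcases mul_eq_zero.1 h2 with h3 | h3
    · simpa using h3
    · exact absurd h3 (zpow_ne_zero _ this.ne')
  have h2 : Set.EqOn f (fun _ ↦ 0) fdo := Measure.eqOn_open_of_ae_eq h1 isOpen_fdo
    (continuous_cuspForm f).continuousOn continuousOn_const
  have h3 : Set.EqOn f (fun _ ↦ 0) fd := by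
    rw [fd_eq_closure_fdo]
    exact h2.closure (continuous_cuspForm f) continuous_const
  ext z
  obtain ⟨γ, hγ⟩ := exists_smul_mem_fd z
  have h4 := h3 hγ
  have h5 := congrFun (cuspForm_slash f γ) z
  rw [← h5, ModularForm.slash_apply]
  have h6 : f ((γ : GL (Fin 2) ℝ) • z) = 0 := h4
  rw [h6]
  simp

/-- The Petersson inner product as the core of an inner product space. -/
@[reducible] noncomputable def peterssonCore (k : ℤ) :
    InnerProductSpace.Core ℂ (CuspForm 𝒮ℒ k) where
  inner f g := ∫ z in fd, petersson k f g z
  conj_inner_symm f g := by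
    rw [← integral_conj]
    refine integral_congr_ae (.of_forall fun z ↦ ?_)
    exact (petersson_symm k _ _ z).symm
  re_inner_nonneg f := by
    rw [integral_petersson_self]
    exact integral_petersson_self_nonneg _
  add_left f g h := by
    rw [← integral_add (integrableOn_petersson f h) (integrableOn_petersson g h)]
    refine integral_congr_ae (.of_forall fun z ↦ ?_)
    simp only [petersson, FunLike.coe_add, Pi.add_apply, map_add]
    ring
  smul_left f g c := by
    rw [← integral_const_mul]
    refine integral_congr_ae (.of_forall fun z ↦ ?_)
    simp only [petersson, FunLike.coe_smul, Pi.smul_apply, smul_eq_mul, map_mul]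
    ring
  definite f h := eq_zero_of_petersson_self_eq_zero h

theorem heckeCoeff_const_mul (n : ℕ) (c : ℂ) (a : ℕ → ℂ) (m : ℕ) :
    heckeCoeff k n (fun m ↦ c * a m) m = c * heckeCoeff k n a m := by
  rw [heckeCoeff, heckeCoeff, Finset.mul_sum]
  refine Finset.sum_congr rfl fun d _ ↦ ?_
  ring

theorem heckeCoeff_one_left (a : ℕ → ℂ) (m : ℕ) : heckeCoeff k 1 a m = a m := by
  simp [heckeCoeff, Finset.sum_filter]

/-- A sequence that is an eigenvector of `T_p` for all primes `p` is one of all `T_n`. -/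
theorem exists_heckeCoeff_eq {a : ℕ → ℂ}
    (h : ∀ p : ℕ, p.Prime → ∃ c, ∀ m, heckeCoeff k p a m = c * a m) (n : ℕ) (hn : 0 < n) :
    ∃ c, ∀ m, heckeCoeff k n a m = c * a m := by
  induction n using Nat.strong_induction_on with
  | _ n ih =>
    rcases Nat.lt_or_ge 1 n with h1 | h1
    · obtain ⟨p, hp, n', rfl⟩ : ∃ p, p.Prime ∧ p ∣ n :=
        ⟨n.minFac, Nat.minFac_prime h1.ne', n.minFac_dvd⟩
      have hn' : 0 < n' := Nat.pos_of_mul_pos_left hn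
      have hlt : n' < p * n' := (Nat.lt_mul_iff_one_lt_left hn').2 hp.one_lt
      obtain ⟨c, hc⟩ := h p hp
      obtain ⟨c', hc'⟩ := ih n' hlt hn'
      have h2 : ∀ m, heckeCoeff k n' (heckeCoeff k p a) m = c * c' * a m := by
        intro m
        rw [show heckeCoeff k p a = fun m ↦ c * a m from funext hc, heckeCoeff_const_mul, hc',
          mul_assoc]
      by_cases hpn : p ∣ n'
      · obtain ⟨c'', hc''⟩ := ih (n' / p) ((Nat.div_le_self _ _).trans_lt hlt)
          (Nat.div_pos (Nat.le_of_dvd hn' hpn) hp.pos)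
        refine ⟨c * c' - (p : ℂ) ^ (k - 1) * c'', fun m ↦ ?_⟩
        have h3 := heckeCoeff_heckeCoeff_prime k hn' hp a m
        rw [h2, if_pos hpn, hc''] at h3
        linear_combination -h3
      · refine ⟨c * c', fun m ↦ ?_⟩
        have h3 := heckeCoeff_heckeCoeff_prime k hn' hp a m
        rw [h2, if_neg hpn] at h3
        linear_combination -h3
    · obtain rfl : n = 1 := by lia
      exact ⟨1, fun m ↦ by rw [heckeCoeff_one_left, one_mul]⟩

instance (p : Nat.Primes) : NeZero (p : ℕ) := ⟨p.2.ne_zero⟩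

/-- `T_p` and `T_q` commute since both products equal `T_{p q}` on Fourier coefficients. -/
theorem commute_heckeLin_primes :
    Pairwise (Function.onFun Commute fun p : Nat.Primes ↦ heckeLin (k := k) (p : ℕ)) := by
  intro p q hpq
  have hne : (p : ℕ) ≠ q := fun h ↦ hpq (Subtype.ext h)
  have key : ∀ (p q : Nat.Primes), (p : ℕ) ≠ q → ∀ (f : CuspForm 𝒮ℒ k) (m : ℕ),
      fourierCoeff m (heckeLin (q : ℕ) (heckeLin (p : ℕ) f)) =
        heckeCoeff k (p * q) (fun m ↦ fourierCoeff m f) m := by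
    intro p q hpq f m
    rw [fourierCoeff_heckeLin]
    simp_rw [fourierCoeff_heckeLin]
    rw [heckeCoeff_heckeCoeff_prime k q.2.pos p.2, if_neg, add_zero]
    rwa [Nat.prime_dvd_prime_iff_eq p.2 q.2]
  refine LinearMap.ext fun f ↦ eq_of_fourierCoeff_eq fun m ↦ ?_
  change fourierCoeff m (heckeLin (p : ℕ) (heckeLin (q : ℕ) f)) =
    fourierCoeff m (heckeLin (q : ℕ) (heckeLin (p : ℕ) f))
  rw [key q p hne.symm, key p q hne, mul_comm]

section Eigenforms

variable {k : ℕ}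

theorem heckeLin_of_mem {f : CuspForm 𝒮ℒ (k : ℤ)} (hf : f ∈ heckeEigenforms k) (n : ℕ)
    [NeZero n] : heckeLin n f = fourierCoeff n f • f := by
  obtain ⟨c, hc⟩ := hf.2 n (NeZero.pos n)
  have h1 : heckeLin n f = c • f := DFunLike.coe_injective hc
  have h2 := congrArg (fourierCoeff 1) h1
  rw [fourierCoeff_heckeLin, heckeCoeff_one, map_smul, smul_eq_mul, fourierCoeff_apply 1 f, hf.1,
    mul_one] at h2
  rw [h1, h2]

theorem fourierCoeff_one_of_mem {f : CuspForm 𝒮ℒ (k : ℤ)} (hf : f ∈ heckeEigenforms k) :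
    fourierCoeff 1 f = 1 := hf.1

theorem ne_zero_of_mem {f : CuspForm 𝒮ℒ (k : ℤ)} (hf : f ∈ heckeEigenforms k) : f ≠ 0 := by
  rintro rfl
  have := fourierCoeff_one_of_mem hf
  simp at this

/-- The Hecke relations for the Fourier coefficients of an eigenform. -/
theorem fourierCoeff_mul_of_mem {f : CuspForm 𝒮ℒ (k : ℤ)} (hf : f ∈ heckeEigenforms k) {n : ℕ}
    (hn : 0 < n) (m : ℕ) :
    fourierCoeff n f * fourierCoeff m f = heckeCoeff k n (fun m ↦ fourierCoeff m f) m := by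
  have : NeZero n := ⟨hn.ne'⟩
  rw [← fourierCoeff_heckeLin, heckeLin_of_mem hf, map_smul, smul_eq_mul]

theorem peterssonInner_self (f : CuspForm 𝒮ℒ (k : ℤ)) :
    peterssonInner f f = ((peterssonInner f f).re : ℂ) := by
  rw [peterssonInner, integral_petersson_self, Complex.ofReal_re]

theorem peterssonInner_self_pos {f : CuspForm 𝒮ℒ (k : ℤ)} (hf : f ≠ 0) :
    0 < (peterssonInner f f).re := by
  refine lt_of_le_of_ne ?_ fun h ↦ hf (eq_zero_of_petersson_self_eq_zero ?_)
  · rw [peterssonInner, integral_petersson_self]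
    exact integral_petersson_self_nonneg _
  · have := peterssonInner_self f
    rw [← h] at this
    exact this

theorem peterssonInner_smul_left (c : ℂ) (f g : CuspForm 𝒮ℒ (k : ℤ)) :
    peterssonInner (c • f) g = starRingEnd ℂ c * peterssonInner f g :=
  (peterssonCore k).smul_left f g c

theorem peterssonInner_conj (f g : CuspForm 𝒮ℒ (k : ℤ)) :
    starRingEnd ℂ (peterssonInner g f) = peterssonInner f g :=
  (peterssonCore k).conj_inner_symm f g

theorem peterssonInner_smul_right (c : ℂ) (f g : CuspForm 𝒮ℒ (k : ℤ)) :
    peterssonInner f (c • g) = c * peterssonInner f g := by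
  rw [← peterssonInner_conj, peterssonInner_smul_left, map_mul, Complex.conj_conj,
    peterssonInner_conj]

theorem peterssonInner_add_right (f g h : CuspForm 𝒮ℒ (k : ℤ)) :
    peterssonInner f (g + h) = peterssonInner f g + peterssonInner f h := by
  rw [← peterssonInner_conj, ← peterssonInner_conj f g, ← peterssonInner_conj f h, ← map_add]
  congr 1
  exact (peterssonCore k).add_left g h f

theorem peterssonInner_heckeLin (f g : CuspForm 𝒮ℒ (k : ℤ)) (n : ℕ) [NeZero n] :
    peterssonInner (heckeLin n f) g = peterssonInner f (heckeLin n g) :=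
  setIntegral_petersson_heckeLin f g

/-- The Fourier coefficients of an eigenform are eigenvalues of symmetric operators, hence real. -/
theorem conj_fourierCoeff_of_mem {f : CuspForm 𝒮ℒ (k : ℤ)} (hf : f ∈ heckeEigenforms k) (n : ℕ) :
    starRingEnd ℂ (fourierCoeff n f) = fourierCoeff n f := by
  rcases Nat.eq_zero_or_pos n with rfl | hn
  · rw [fourierCoeff_zero, map_zero]
  have : NeZero n := ⟨hn.ne'⟩
  have h := peterssonInner_heckeLin f f n
  rw [heckeLin_of_mem hf, peterssonInner_smul_left, peterssonInner_smul_right] at h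
  refine mul_right_cancel₀ ?_ h
  rw [peterssonInner_self]
  exact_mod_cast (peterssonInner_self_pos (ne_zero_of_mem hf)).ne'

theorem peterssonInner_eq_zero_of_mem {f g : CuspForm 𝒮ℒ (k : ℤ)} (hf : f ∈ heckeEigenforms k)
    (hg : g ∈ heckeEigenforms k) (hne : f ≠ g) : peterssonInner f g = 0 := by
  by_contra h0
  apply hne
  refine eq_of_fourierCoeff_eq fun n ↦ ?_
  rcases Nat.eq_zero_or_pos n with rfl | hn
  · rw [fourierCoeff_zero, fourierCoeff_zero]
  have : NeZero n := ⟨hn.ne'⟩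
  have h := peterssonInner_heckeLin f g n
  rw [heckeLin_of_mem hf, heckeLin_of_mem hg, peterssonInner_smul_left,
    peterssonInner_smul_right, conj_fourierCoeff_of_mem hf] at h
  exact mul_right_cancel₀ h0 h

/-- A common eigenvector of the `T_p` is a multiple of a normalised eigenform. -/
theorem mem_span_heckeEigenforms {f : CuspForm 𝒮ℒ (k : ℤ)}
    (h : ∀ p : Nat.Primes, ∃ c : ℂ, heckeLin (p : ℕ) f = c • f) :
    f ∈ Submodule.span ℂ (heckeEigenforms k) := by
  have h1 : ∀ n, 0 < n → ∃ c, ∀ m,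
      heckeCoeff k n (fun m ↦ fourierCoeff m f) m = c * fourierCoeff m f := by
    refine exists_heckeCoeff_eq fun p hp ↦ ?_
    obtain ⟨c, hc⟩ := h ⟨p, hp⟩
    refine ⟨c, fun m ↦ ?_⟩
    have : NeZero p := ⟨hp.ne_zero⟩
    rw [← fourierCoeff_heckeLin, ← smul_eq_mul, ← map_smul]
    exact congrArg _ hc
  by_cases h0 : fourierCoeff 1 f = 0
  · have : f = 0 := by
      refine eq_of_fourierCoeff_eq fun n ↦ ?_
      rcases Nat.eq_zero_or_pos n with rfl | hn
      · rw [fourierCoeff_zero, fourierCoeff_zero]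
      obtain ⟨c, hc⟩ := h1 n hn
      have : NeZero n := ⟨hn.ne'⟩
      have h2 := hc 1
      rw [heckeCoeff_one, h0, mul_zero] at h2
      rw [h2, map_zero]
    rw [this]
    exact zero_mem _
  · have h2 : (fourierCoeff 1 f)⁻¹ • f ∈ heckeEigenforms k := by
      refine ⟨?_, fun n hn ↦ ?_⟩
      · rw [← fourierCoeff_apply, map_smul, smul_eq_mul, inv_mul_cancel₀ h0]
      · obtain ⟨c, hc⟩ := h1 n hn
        have : NeZero n := ⟨hn.ne'⟩
        refine ⟨c, ?_⟩
        have h3 : heckeLin n f = c • f := by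
          refine eq_of_fourierCoeff_eq fun m ↦ ?_
          rw [fourierCoeff_heckeLin, hc, map_smul, smul_eq_mul]
        have h4 : heckeLin n ((fourierCoeff 1 f)⁻¹ • f) = c • (fourierCoeff 1 f)⁻¹ • f := by
          rw [map_smul, h3, smul_comm]
        exact congrArg DFunLike.coe h4
    have h3 := Submodule.smul_mem _ (fourierCoeff 1 f) (Submodule.subset_span h2)
    rwa [smul_inv_smul₀ h0] at h3

/-- The eigenforms span, by simultaneous diagonalisation of the commuting symmetric operators
`T_p` on a finite-dimensional space. -/
theorem span_heckeEigenforms : Submodule.span ℂ (heckeEigenforms k) = ⊤ := by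
  let : NormedAddCommGroup (CuspForm 𝒮ℒ (k : ℤ)) := (peterssonCore k).toNormedAddCommGroup
  let : InnerProductSpace ℂ (CuspForm 𝒮ℒ (k : ℤ)) := .ofCore (peterssonCore k).toCore
  have h := LinearMap.IsSymmetric.iSup_iInf_eq_top_of_commute
    (T := fun p : Nat.Primes ↦ heckeLin (k := k) (p : ℕ))
    (fun p f g ↦ setIntegral_petersson_heckeLin f g) commute_heckeLin_primes
  rw [eq_top_iff, ← h, iSup_le_iff]
  intro χ f hf
  refine mem_span_heckeEigenforms fun p ↦ ⟨χ p, ?_⟩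
  exact Module.End.mem_eigenspace_iff.1 ((Submodule.mem_iInf _).1 hf p)

theorem linearIndepOn_heckeEigenforms : LinearIndepOn ℂ id (heckeEigenforms k) := by
  let : NormedAddCommGroup (CuspForm 𝒮ℒ (k : ℤ)) := (peterssonCore k).toNormedAddCommGroup
  let : InnerProductSpace ℂ (CuspForm 𝒮ℒ (k : ℤ)) := .ofCore (peterssonCore k).toCore
  refine linearIndependent_of_ne_zero_of_inner_eq_zero (fun f ↦ ne_zero_of_mem f.2) ?_
  intro f g hfg
  exact peterssonInner_eq_zero_of_mem f.2 g.2 fun h ↦ hfg (Subtype.ext h)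

theorem finite_heckeEigenforms : (heckeEigenforms k).Finite :=
  linearIndepOn_heckeEigenforms.setFinite

end Eigenforms

end HeckeMoment

namespace HeckeMoment

open ModularGroup MeasureTheory Filter EisensteinSeries
open scoped ModularForm Manifold Topology

/-! ### The Poincaré series -/

/-- Pairs of coprime integers: the bottom rows of matrices in `SL(2, ℤ)`. -/
abbrev CoprimePair : Type := {v : Fin 2 → ℤ // IsCoprime (v 0) (v 1)}

namespace CoprimePair

/-- The bottom row of a matrix in `SL(2, ℤ)`. -/
def bottomRow (γ : SL(2, ℤ)) : CoprimePair := ⟨γ.1 1, bottom_row_coprime γ⟩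

/-- Some matrix in `SL(2, ℤ)` with the given bottom row. -/
noncomputable def lift (v : CoprimePair) : SL(2, ℤ) := (bottom_row_surj v.2).choose

@[simp]
theorem bottomRow_lift (v : CoprimePair) : bottomRow v.lift = v :=
  Subtype.ext (bottom_row_surj v.2).choose_spec.2

theorem lift_apply (v : CoprimePair) (i : Fin 2) : v.lift 1 i = v.1 i :=
  congrFun (bottom_row_surj v.2).choose_spec.2 i

theorem bottomRow_eq_iff {γ δ : SL(2, ℤ)} :
    bottomRow γ = bottomRow δ ↔ ∃ n : ℤ, γ = T ^ n * δ := by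
  constructor
  · intro h
    have h0 : γ 1 0 = δ 1 0 := congrFun (congrArg Subtype.val h) 0
    have h1 : γ 1 1 = δ 1 1 := congrFun (congrArg Subtype.val h) 1
    have hd := δ.det_coe
    have hg := γ.det_coe
    rw [Matrix.det_fin_two] at hd hg
    refine ⟨γ 0 1 * δ 0 0 - γ 0 0 * δ 0 1, ?_⟩
    ext i j
    rw [Matrix.SpecialLinearGroup.coe_mul, coe_T_zpow, Matrix.mul_apply, Fin.sum_univ_two]
    rw [h0, h1] at hg
    fin_cases i <;> fin_cases j
    · simp
      linear_combination δ 0 0 * hg - γ 0 0 * hd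
    · simp
      linear_combination δ 0 1 * hg - γ 0 1 * hd
    · simp [h0]
    · simp [h1]
  · rintro ⟨n, rfl⟩
    refine Subtype.ext (funext fun i ↦ ?_)
    change (T ^ n * δ) 1 i = δ 1 i
    rw [Matrix.SpecialLinearGroup.coe_mul, coe_T_zpow, Matrix.mul_apply, Fin.sum_univ_two]
    simp

/-- Right multiplication by `γ` permutes the coprime pairs. -/
def vecMulEquiv (γ : SL(2, ℤ)) : CoprimePair ≃ CoprimePair where
  toFun v := ⟨Matrix.vecMul v.1 γ.1, v.2.vecMulSL γ⟩
  invFun v := ⟨Matrix.vecMul v.1 γ⁻¹.1, v.2.vecMulSL γ⁻¹⟩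
  left_inv v := Subtype.ext <| by
    simp only [Matrix.vecMul_vecMul]
    rw [← Matrix.SpecialLinearGroup.coe_mul, mul_inv_cancel, Matrix.SpecialLinearGroup.coe_one,
      Matrix.vecMul_one]
  right_inv v := Subtype.ext <| by
    simp only [Matrix.vecMul_vecMul]
    rw [← Matrix.SpecialLinearGroup.coe_mul, inv_mul_cancel, Matrix.SpecialLinearGroup.coe_one,
      Matrix.vecMul_one]

theorem bottomRow_lift_mul (v : CoprimePair) (γ : SL(2, ℤ)) :
    bottomRow (v.lift * γ) = vecMulEquiv γ v := by
  refine Subtype.ext ?_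
  change (v.lift * γ).1 1 = Matrix.vecMul v.1 γ.1
  rw [Matrix.SpecialLinearGroup.coe_mul, Matrix.mul_apply_eq_vecMul]
  congr 1
  exact congrArg Subtype.val v.bottomRow_lift

theorem summable_norm_rpow {s : ℝ} (hs : 2 < s) : Summable fun v : CoprimePair ↦ ‖v.1‖ ^ (-s) :=
  (summable_one_div_norm_rpow hs).comp_injective Subtype.val_injective

end CoprimePair

/-- The function `z ↦ e(z) = exp (2 π i z)` on the upper half plane. -/
noncomputable def expFun (z : ℍ) : ℂ := Complex.exp (2 * Real.pi * Complex.I * z)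

theorem norm_expFun (z : ℍ) : ‖expFun z‖ = Real.exp (-(2 * Real.pi * z.im)) := by
  rw [expFun, Complex.norm_exp]
  congr 1
  simp [Complex.mul_re]

theorem norm_expFun_le_one (z : ℍ) : ‖expFun z‖ ≤ 1 := by
  rw [norm_expFun, Real.exp_le_one_iff]
  have := z.im_pos
  have := Real.pi_pos
  simp only [Left.neg_nonpos_iff]
  positivity

theorem expFun_T_zpow_smul (n : ℤ) (z : ℍ) : expFun (T ^ n • z) = expFun z := by
  rw [expFun, expFun, coe_T_zpow_smul_eq, Complex.exp_eq_exp_iff_exists_int]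
  exact ⟨n, by ring⟩

theorem expFun_slash_T_zpow (k : ℤ) (n : ℤ) : expFun ∣[k] (T ^ n) = expFun := by
  ext z
  rw [ModularForm.SL_slash_apply, expFun_T_zpow_smul]
  have : denom (T ^ n : SL(2, ℤ)) z = 1 := by
    rw [denom_apply, coe_T_zpow]
    simp
  rw [this, one_zpow, mul_one]

theorem expFun_slash_congr (k : ℤ) {γ δ : SL(2, ℤ)}
    (h : CoprimePair.bottomRow γ = CoprimePair.bottomRow δ) : expFun ∣[k] γ = expFun ∣[k] δ := by
  obtain ⟨n, rfl⟩ := CoprimePair.bottomRow_eq_iff.1 h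
  rw [SlashAction.slash_mul, expFun_slash_T_zpow]

/-- The summand of the Poincaré series attached to a coprime pair. -/
noncomputable def poincareTerm (k : ℤ) (v : CoprimePair) : ℍ → ℂ := expFun ∣[k] v.lift

theorem poincareTerm_apply (k : ℤ) (v : CoprimePair) (z : ℍ) :
    poincareTerm k v z = expFun (v.lift • z) * (v.1 0 * z + v.1 1 : ℂ) ^ (-k) := by
  rw [poincareTerm, ModularForm.SL_slash_apply]
  congr 2
  rw [← v.lift_apply, ← v.lift_apply]
  simp [denom]

theorem poincareTerm_slash (k : ℤ) (v : CoprimePair) (γ : SL(2, ℤ)) :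
    poincareTerm k v ∣[k] γ = poincareTerm k (v.vecMulEquiv γ) := by
  rw [poincareTerm, ← SlashAction.slash_mul, poincareTerm]
  apply expFun_slash_congr
  rw [CoprimePair.bottomRow_lift_mul, CoprimePair.bottomRow_lift]

theorem norm_poincareTerm_le (k : ℤ) (v : CoprimePair) (z : ℍ) :
    ‖poincareTerm k v z‖ ≤ ‖(v.1 0 * z + v.1 1 : ℂ)‖ ^ (-k) := by
  rw [poincareTerm_apply, norm_mul, norm_zpow]
  exact mul_le_of_le_one_left (by positivity) (norm_expFun_le_one _)

theorem norm_poincareTerm_le_of_mem {k : ℤ} (hk : 0 ≤ k) (v : CoprimePair) {z : ℍ} {A B : ℝ}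
    (hB : 0 < B) (hz : z ∈ verticalStrip A B) :
    ‖poincareTerm k v z‖ ≤ r ⟨⟨A, B⟩, hB⟩ ^ (-k : ℝ) * ‖v.1‖ ^ (-k : ℝ) := by
  refine (norm_poincareTerm_le k v z).trans ?_
  have := summand_bound_of_mem_verticalStrip (k := (k : ℝ)) (by exact_mod_cast hk) v.1 hB hz
  rwa [← Int.cast_neg, Real.rpow_intCast, Int.cast_neg] at this

theorem summable_poincareTerm {k : ℤ} (hk : 2 < k) (z : ℍ) :
    Summable fun v ↦ poincareTerm k v z := by
  refine Summable.of_norm_bounded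
    ((CoprimePair.summable_norm_rpow (s := k) (by exact_mod_cast hk)).mul_left _)
    fun v ↦ norm_poincareTerm_le_of_mem (by lia) v z.im_pos (A := |z.re|) ?_
  simp [mem_verticalStrip_iff]

/-- The first Poincaré series of weight `k`. The factor `1 / 2` makes up for the pairs `v` and `-v`,
which have equal terms when `k` is even. -/
noncomputable def poincareFun (k : ℤ) (z : ℍ) : ℂ := 2⁻¹ * ∑' v, poincareTerm k v z

theorem poincareFun_slash (k : ℤ) (γ : SL(2, ℤ)) : poincareFun k ∣[k] γ = poincareFun k := by
  ext z
  rw [ModularForm.SL_slash_apply, poincareFun, poincareFun, mul_assoc, ← tsum_mul_right,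
    ← (CoprimePair.vecMulEquiv γ).tsum_eq fun v ↦ poincareTerm k v z]
  congr 2
  ext v
  rw [← poincareTerm_slash, ModularForm.SL_slash_apply]

theorem mdifferentiable_expFun : MDiff expFun := by
  rw [mdifferentiable_iff]
  have h : DifferentiableOn ℂ (fun z : ℂ ↦ Complex.exp (2 * Real.pi * Complex.I * z))
      {z | 0 < z.im} := by fun_prop
  refine h.congr fun z hz ↦ ?_
  simp [expFun, ofComplex_apply_of_im_pos hz]

theorem mdifferentiable_poincareFun {k : ℤ} (hk : 2 < k) : MDiff (poincareFun k) := by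
  rw [mdifferentiable_iff]
  intro w hw
  have hw2 : 0 < w.im / 2 := half_pos hw
  set U : Set ℂ := {z | |z.re| < |w.re| + 1} ∩ {z | w.im / 2 < z.im} with hU
  have hUo : IsOpen U :=
    (isOpen_lt (by fun_prop) continuous_const).inter (isOpen_lt continuous_const (by fun_prop))
  have hwU : w ∈ U := ⟨by simp, half_lt_self (show 0 < w.im from hw)⟩
  have hUpos : U ⊆ {z | 0 < z.im} := fun z hz ↦ hw2.trans hz.2
  have h := Complex.differentiableOn_tsum_of_summable_norm
    (F := fun (v : CoprimePair) (z : ℂ) ↦ poincareTerm k v (ofComplex z)) (U := U)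
    ((CoprimePair.summable_norm_rpow (s := k) (by exact_mod_cast hk)).mul_left
      (r ⟨⟨|w.re| + 1, w.im / 2⟩, hw2⟩ ^ (-k : ℝ))) (fun v ↦ ?_) hUo (fun v z hz ↦ ?_)
  · have h2 := (h.const_mul (2⁻¹ : ℂ)).differentiableAt (hUo.mem_nhds hwU)
    exact h2.differentiableWithinAt
  · have h1 : MDiff (poincareTerm k v) := mdifferentiable_expFun.slash k _
    exact (UpperHalfPlane.mdifferentiable_iff.1 h1).mono hUpos
  · refine norm_poincareTerm_le_of_mem (by lia) v hw2 ?_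
    have hz0 : 0 < z.im := hUpos hz
    rw [mem_verticalStrip_iff]
    rw [ofComplex_apply_of_im_pos hz0]
    exact ⟨hz.1.le, hz.2.le⟩

end HeckeMoment

namespace HeckeMoment

open ModularGroup MeasureTheory Filter EisensteinSeries
open scoped ModularForm Manifold Topology

/-- The constant `∑ ‖v‖ ^ (-4)`, over coprime pairs, that bounds the Poincaré series away from its
main term uniformly in the weight. -/
noncomputable def coprimeConst : ℝ := ∑' v : CoprimePair, ‖v.1‖ ^ (-4 : ℝ)

theorem coprimeConst_nonneg : 0 ≤ coprimeConst := tsum_nonneg fun _ ↦ by positivity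

theorem poincareTerm_of_eq_zero {k : ℤ} (hk : Even k) {v : CoprimePair} (hv : v.1 0 = 0) (z : ℍ) :
    poincareTerm k v z = expFun z := by
  rw [poincareTerm_apply]
  obtain ⟨n, hn⟩ := exists_eq_T_zpow_of_c_eq_zero (g := v.lift) (by rw [v.lift_apply, hv])
  rw [hn, expFun_T_zpow_smul, hv]
  have h := v.2
  rw [hv, isCoprime_zero_left, Int.isUnit_iff] at h
  rcases h with h | h <;> simp [h, hk.neg.neg_one_zpow]

theorem norm_poincareTerm_le_of_ne_zero {k : ℤ} (hk : 4 ≤ k) {v : CoprimePair} (hv : v.1 0 ≠ 0)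
    {z : ℍ} {B : ℝ} (hB : 0 < B) (hz : z ∈ verticalStrip 1 B) :
    ‖poincareTerm k v z‖ ≤
      r ⟨⟨1, B⟩, hB⟩ ^ (-4 : ℝ) * z.im ^ (4 - k) * ‖v.1‖ ^ (-4 : ℝ) := by
  have him := z.im_pos
  refine (norm_poincareTerm_le k v z).trans ?_
  set w : ℂ := v.1 0 * z + v.1 1 with hw
  have h1 : z.im ≤ ‖w‖ := by
    refine le_trans ?_ (Complex.abs_im_le_norm w)
    have : w.im = v.1 0 * z.im := by simp [hw]
    rw [this, abs_mul, abs_of_pos him]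
    refine le_mul_of_one_le_left him.le ?_
    exact_mod_cast Int.one_le_abs hv
  have hw0 : 0 < ‖w‖ := him.trans_le h1
  have h2 := summand_bound_of_mem_verticalStrip (k := 4) (by norm_num) v.1 hB hz
  rw [← hw] at h2
  have h3 : ‖w‖ ^ (-k) = ‖w‖ ^ (4 - k) * ‖w‖ ^ (-4 : ℝ) := by
    rw [show (-4 : ℝ) = ((-4 : ℤ) : ℝ) by norm_num, Real.rpow_intCast, ← zpow_add₀ hw0.ne']
    congr 1
    ring
  have h4 : ‖w‖ ^ (4 - k) ≤ z.im ^ (4 - k) := by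
    rw [← neg_sub k 4, zpow_neg, zpow_neg]
    gcongr
    exact zpow_le_zpow_left₀ (by lia) him.le h1
  rw [h3]
  calc ‖w‖ ^ (4 - k) * ‖w‖ ^ (-4 : ℝ) ≤ z.im ^ (4 - k) * (r ⟨⟨1, B⟩, hB⟩ ^ (-4 : ℝ) *
        ‖v.1‖ ^ (-4 : ℝ)) := by gcongr
    _ = _ := by ring

/-- The Poincaré series is its identity term up to an error that decays like a power of `Im z`,
with constants that do not depend on the weight. -/
theorem norm_poincareFun_sub_le {k : ℤ} (hk : 4 ≤ k) (hk2 : Even k)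
    {z : ℍ} {B : ℝ} (hB : 0 < B) (hz : z ∈ verticalStrip 1 B) :
    ‖poincareFun k z - expFun z‖ ≤
      coprimeConst * r ⟨⟨1, B⟩, hB⟩ ^ (-4 : ℝ) * z.im ^ (4 - k) := by
  let vp : CoprimePair := ⟨![0, 1], by simp [isCoprime_zero_left]⟩
  let vm : CoprimePair := ⟨![0, -1], by simp [isCoprime_zero_left]⟩
  have hne : vp ≠ vm := by
    intro h
    have := congrFun (congrArg Subtype.val h) 1
    simp [vp, vm] at this
  set g : CoprimePair → ℂ := fun v ↦ if v.1 0 = 0 then expFun z else 0 with hg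
  have hgs : HasSum g (∑ v ∈ {vp, vm}, g v) := by
    refine hasSum_sum_of_ne_finset_zero fun v hv ↦ ?_
    rw [hg]
    simp only [ite_eq_right_iff]
    intro h0
    exfalso
    have h1 := v.2
    rw [h0, isCoprime_zero_left, Int.isUnit_iff] at h1
    apply hv
    rcases h1 with h1 | h1
    · have : v = vp := Subtype.ext (by ext i; fin_cases i <;> simp [vp, h0, h1])
      simp [this]
    · have : v = vm := Subtype.ext (by ext i; fin_cases i <;> simp [vm, h0, h1])
      simp [this]
  rw [Finset.sum_pair hne] at hgs
  have hg2 : g vp + g vm = 2 * expFun z := by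
    simp [hg, vp, vm, two_mul]
  rw [hg2] at hgs
  have h := ((summable_poincareTerm (k := k) (by lia) z).hasSum.sub hgs).mul_left (2⁻¹ : ℂ)
  have h1 : poincareFun k z - expFun z = ∑' v, 2⁻¹ * (poincareTerm k v z - g v) := by
    rw [h.tsum_eq, poincareFun]
    ring
  have h2 : ∀ v, ‖2⁻¹ * (poincareTerm k v z - g v)‖ ≤
      r ⟨⟨1, B⟩, hB⟩ ^ (-4 : ℝ) * z.im ^ (4 - k) * ‖v.1‖ ^ (-4 : ℝ) := by
    intro v
    have him := z.im_pos
    have hr := r_pos ⟨⟨1, B⟩, hB⟩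
    by_cases hv : v.1 0 = 0
    · simp only [hg, hv, if_true, poincareTerm_of_eq_zero hk2 hv, sub_self, mul_zero, norm_zero]
      positivity
    · simp only [hg, hv, if_false, sub_zero]
      rw [norm_mul]
      refine le_trans ?_ (norm_poincareTerm_le_of_ne_zero hk hv hB hz)
      refine mul_le_of_le_one_left (norm_nonneg _) (by norm_num)
  rw [h1]
  refine (tsum_of_norm_bounded (((CoprimePair.summable_norm_rpow (s := 4)
    (by norm_num)).hasSum).mul_left _) h2).trans_eq ?_
  rw [coprimeConst]
  ring

theorem T_zpow_smul_poincareFun (k : ℤ) (n : ℤ) (z : ℍ) :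
    poincareFun k (T ^ n • z) = poincareFun k z := by
  have h := congrFun (poincareFun_slash k (T ^ n)) z
  rw [ModularForm.SL_slash_apply] at h
  have : denom (T ^ n : SL(2, ℤ)) z = 1 := by
    rw [denom_apply, coe_T_zpow]
    simp
  rwa [this, one_zpow, mul_one] at h

theorem isZeroAtImInfty_poincareFun {k : ℤ} (hk : 5 ≤ k) (hk2 : Even k) :
    IsZeroAtImInfty (poincareFun k) := by
  set C := coprimeConst * r ⟨⟨1, 1⟩, one_pos⟩ ^ (-4 : ℝ) with hC
  have hr := r_pos ⟨⟨1, 1⟩, one_pos⟩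
  have hC0 : 0 ≤ C := mul_nonneg coprimeConst_nonneg (by positivity)
  have h1 : Tendsto (fun y : ℝ ↦ Real.exp (-(2 * Real.pi * y)) + C * y⁻¹) atTop (𝓝 0) := by
    have e1 : Tendsto (fun y : ℝ ↦ Real.exp (-(2 * Real.pi * y))) atTop (𝓝 0) :=
      Real.tendsto_exp_neg_atTop_nhds_zero.comp
        (tendsto_id.const_mul_atTop (by have := Real.pi_pos; positivity))
    have e2 : Tendsto (fun y : ℝ ↦ C * y⁻¹) atTop (𝓝 (C * 0)) :=
      tendsto_inv_atTop_zero.const_mul C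
    simpa using e1.add e2
  have h2 : Tendsto (fun z : ℍ ↦ Real.exp (-(2 * Real.pi * z.im)) + C * z.im⁻¹) atImInfty (𝓝 0) :=
    h1.comp tendsto_comap
  refine squeeze_zero_norm' ?_ h2
  have h3 : ∀ᶠ z : ℍ in atImInfty, 1 ≤ z.im := tendsto_comap.eventually (eventually_ge_atTop 1)
  filter_upwards [h3] with z hz
  have key : ∀ w : ℍ, |w.re| ≤ 1 → 1 ≤ w.im →
      ‖poincareFun k w‖ ≤ Real.exp (-(2 * Real.pi * w.im)) + C * w.im⁻¹ := by
    intro w hw1 hw2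
    have h4 := norm_poincareFun_sub_le (by lia) hk2 one_pos (z := w) ⟨hw1, hw2⟩
    rw [← norm_expFun]
    calc ‖poincareFun k w‖ = ‖expFun w + (poincareFun k w - expFun w)‖ := by congr 1; ring
      _ ≤ ‖expFun w‖ + ‖poincareFun k w - expFun w‖ := norm_add_le _ _
      _ ≤ ‖expFun w‖ + C * w.im ^ (4 - k) := by gcongr
      _ ≤ ‖expFun w‖ + C * w.im⁻¹ := by
        gcongr
        rw [← zpow_neg_one]
        exact zpow_le_zpow_right₀ hw2 (by lia)
  have h5 := key (T ^ (-⌊z.re⌋) • z) ?_ ?_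
  · rwa [T_zpow_smul_poincareFun, im_T_zpow_smul] at h5
  · rw [re_T_zpow_smul, abs_le]
    have := Int.floor_le z.re
    have := Int.lt_floor_add_one z.re
    push_cast
    constructor <;> linarith
  · rwa [im_T_zpow_smul]

/-- The first Poincaré series as a cusp form. -/
noncomputable def poincare {k : ℤ} (hk : 5 ≤ k) (hk2 : Even k) : CuspForm 𝒮ℒ k :=
  mkCuspForm (poincareFun k) (poincareFun_slash k) (mdifferentiable_poincareFun (by lia))
    (isZeroAtImInfty_poincareFun hk hk2)

/-! ### Unfolding the Poincaré series -/

variable {k : ℤ}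

theorem petersson_poincareTerm (f : CuspForm 𝒮ℒ k) (v : CoprimePair) (z : ℍ) :
    petersson k (poincareTerm k v) f z = petersson k expFun f (v.lift • z) := by
  rw [← petersson_slash_SL]
  have h : (f : ℍ → ℂ) ∣[k] v.lift = f := cuspForm_slash f v.lift
  rw [h, poincareTerm]

theorem petersson_poincareFun (f : CuspForm 𝒮ℒ k) (z : ℍ) :
    petersson k (poincareFun k) f z = 2⁻¹ * ∑' v : CoprimePair, petersson k expFun f (v.lift • z) := by
  simp_rw [← petersson_poincareTerm, petersson, tsum_mul_right, ← Complex.conj_tsum, poincareFun,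
    map_mul, map_inv₀, map_ofNat]
  ring

/-- The integrand of the unfolded integral: `conj (e(z)) f(z) y ^ k` on the strip `0 ≤ x < 1`. -/
noncomputable def stripIntegrand (f : CuspForm 𝒮ℒ k) : ℍ → ℂ :=
  {z : ℍ | z.re ∈ Set.Ico (0 : ℝ) 1}.indicator (petersson k expFun f)

/-- Each coset of the translations in `SL(2, ℤ)` has exactly one element that maps `z` into the
strip `0 ≤ x < 1`. -/
theorem tsum_stripIntegrand (f : CuspForm 𝒮ℒ k) (z : ℍ) :
    ∑' γ : SL(2, ℤ), stripIntegrand f (γ • z) =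
      ∑' v : CoprimePair, petersson k expFun f (v.lift • z) := by
  let i : CoprimePair → SL(2, ℤ) := fun v ↦ T ^ (-⌊(v.lift • z).re⌋) * v.lift
  have hre : ∀ v, (i v • z).re = Int.fract (v.lift • z).re := by
    intro v
    rw [mul_smul, re_T_zpow_smul, Int.fract]
    push_cast
    ring
  have hrow : ∀ v, CoprimePair.bottomRow (i v) = v := by
    intro v
    rw [CoprimePair.bottomRow_eq_iff.2 ⟨_, rfl⟩, CoprimePair.bottomRow_lift]
  have hi : Function.Injective i := fun v w h ↦ by rw [← hrow v, h, hrow]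
  have hinv : ∀ (γ : SL(2, ℤ)), petersson k expFun f (γ • z) = petersson k (expFun ∣[k] γ) f z := by
    intro γ
    rw [← petersson_slash_SL]
    have h : (f : ℍ → ℂ) ∣[k] γ = f := cuspForm_slash f γ
    rw [h]
  rw [← hi.tsum_eq]
  · refine tsum_congr fun v ↦ ?_
    rw [stripIntegrand, Set.indicator_of_mem, hinv, hinv]
    · rw [expFun_slash_congr k (δ := v.lift) (by rw [hrow, CoprimePair.bottomRow_lift])]
    · change (i v • z).re ∈ Set.Ico (0 : ℝ) 1
      rw [hre]
      exact ⟨Int.fract_nonneg _, Int.fract_lt_one _⟩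
  · intro γ hγ
    have hs : (γ • z).re ∈ Set.Ico (0 : ℝ) 1 := by
      by_contra h
      exact hγ (Set.indicator_of_notMem (s := {z : ℍ | z.re ∈ Set.Ico (0 : ℝ) 1}) h _)
    refine ⟨CoprimePair.bottomRow γ, ?_⟩
    set v := CoprimePair.bottomRow γ with hv
    obtain ⟨n, hn⟩ := CoprimePair.bottomRow_eq_iff.1
      (show CoprimePair.bottomRow γ = CoprimePair.bottomRow v.lift by
        rw [CoprimePair.bottomRow_lift])
    have h1 : (γ • z).re = (v.lift • z).re + n := by
      conv_lhs => rw [hn]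
      rw [mul_smul, re_T_zpow_smul]
    have h2 : -⌊(v.lift • z).re⌋ = n := by
      rw [h1] at hs
      have : ⌊(v.lift • z).re⌋ = -n := by
        rw [Int.floor_eq_iff]
        push_cast
        constructor <;> linarith [hs.1, hs.2]
      lia
    change T ^ (-⌊(v.lift • z).re⌋) * v.lift = γ
    rw [h2]
    exact hn.symm

theorem continuous_expFun : Continuous expFun := by
  unfold expFun
  fun_prop

theorem measurable_stripIntegrand (f : CuspForm 𝒮ℒ k) : Measurable (stripIntegrand f) :=
  (petersson_continuous k continuous_expFun (continuous_cuspForm f)).measurable.indicator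
    (measurableSet_Ico.preimage (continuous_re.measurable))

end HeckeMoment

namespace HeckeMoment

open ModularGroup MeasureTheory Filter Set
open scoped ModularForm Manifold Topology ENNReal

variable {k : ℤ}

theorem integrable_stripIntegrand (hk : 3 ≤ k) (f : CuspForm 𝒮ℒ k) :
    Integrable (stripIntegrand f) := by
  refine ⟨(measurable_stripIntegrand f).aestronglyMeasurable, ?_⟩
  obtain ⟨C, hC⟩ := CuspFormClass.exists_bound f
  have hC0 : 0 ≤ C := by
    have := (norm_nonneg _).trans (hC UpperHalfPlane.I)
    simpa using this
  set φ : ℝ → ℝ := fun y ↦ C * (y ^ ((k : ℝ) / 2 - 2) * Real.exp (-(2 * Real.pi) * y ^ (1 : ℝ))) with hφ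
  have hφ0 : ∀ y ∈ Ioi (0 : ℝ), 0 ≤ φ y := fun y hy ↦ by
    have : (0 : ℝ) < y := hy
    positivity
  have hk' : (3 : ℝ) ≤ k := by exact_mod_cast hk
  have hφi : IntegrableOn φ (Ioi 0) :=
    (integrableOn_rpow_mul_exp_neg_mul_rpow (by linarith) one_pos (by positivity)).const_mul C
  set G : ℝ → ℝ → ℝ≥0∞ := fun x y ↦
    (Ico (0 : ℝ) 1).indicator 1 x * ENNReal.ofReal (y ^ 2 * φ y) with hG
  have hGm : Measurable (Function.uncurry G) := by
    refine Measurable.mul (f := fun p : ℝ × ℝ ↦ (Ico (0 : ℝ) 1).indicator (1 : ℝ → ℝ≥0∞) p.1) ?_ ?_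
    · exact (measurable_one.indicator measurableSet_Ico).comp measurable_fst
    · simp only [hφ]
      fun_prop
  have hle : ∀ z : ℍ, ‖stripIntegrand f z‖ₑ ≤ G z.re z.im := by
    intro z
    by_cases hz : z.re ∈ Ico (0 : ℝ) 1
    · have him := z.im_pos
      rw [stripIntegrand, indicator_of_mem (s := {z : ℍ | z.re ∈ Ico (0 : ℝ) 1}) hz, hG]
      simp only [indicator_of_mem hz, Pi.one_apply, one_mul]
      rw [← ofReal_norm]
      refine ENNReal.ofReal_le_ofReal ?_
      rw [petersson, norm_mul, norm_mul, Complex.norm_conj, norm_expFun, norm_zpow,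
        Complex.norm_real, Real.norm_of_nonneg him.le]
      have e1 : z.im ^ k = z.im ^ 2 * z.im ^ ((k : ℝ) / 2 - 2) * z.im ^ ((k : ℝ) / 2) := by
        rw [← Real.rpow_natCast, ← Real.rpow_intCast, ← Real.rpow_add him, ← Real.rpow_add him]
        congr 1
        push_cast
        ring
      have e2 := hC z
      rw [le_div_iff₀ (by positivity)] at e2
      have e3 : φ z.im = C * (z.im ^ ((k : ℝ) / 2 - 2) * Real.exp (-(2 * Real.pi * z.im))) := by
        simp only [hφ, Real.rpow_one, neg_mul]
      rw [e1, e3]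
      calc _ = (‖f z‖ * z.im ^ ((k : ℝ) / 2)) *
            (z.im ^ 2 * z.im ^ ((k : ℝ) / 2 - 2) * Real.exp (-(2 * Real.pi * z.im))) := by ring
        _ ≤ C * (z.im ^ 2 * z.im ^ ((k : ℝ) / 2 - 2) * Real.exp (-(2 * Real.pi * z.im))) := by
          gcongr
        _ = _ := by ring
    · rw [stripIntegrand, indicator_of_notMem (s := {z : ℍ | z.re ∈ Ico (0 : ℝ) 1}) hz]
      simp
  refine (lintegral_mono hle).trans_lt ?_
  rw [lintegral_eq G hGm]
  have h1 : ∀ y ∈ Ioi (0 : ℝ), ∫⁻ x : ℝ, ENNReal.ofReal ((y ^ 2)⁻¹) * G x y =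
      ENNReal.ofReal (φ y) := by
    intro y hy
    have hy0 : (0 : ℝ) < y := hy
    simp only [hG]
    rw [lintegral_const_mul _ (by
      exact (measurable_one.indicator measurableSet_Ico).mul_const _),
      lintegral_mul_const _ (measurable_one.indicator measurableSet_Ico),
      lintegral_indicator_one measurableSet_Ico, Real.volume_Ico, sub_zero, ENNReal.ofReal_one,
      one_mul, ← ENNReal.ofReal_mul (by positivity), inv_mul_cancel_left₀ (by positivity)]
  rw [setLIntegral_congr_fun measurableSet_Ioi h1]
  exact hφi.lintegral_lt_top

theorem conj_expFun (z : ℍ) :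
    starRingEnd ℂ (expFun z) = Real.exp (-(4 * Real.pi * z.im)) * (expFun z)⁻¹ := by
  rw [expFun, ← Complex.exp_conj, ← Complex.exp_neg, Complex.ofReal_exp, ← Complex.exp_add]
  congr 1
  have h1 : (z : ℂ) = z.re + z.im * Complex.I := (Complex.re_add_im _).symm
  rw [h1]
  simp only [map_mul, map_add, Complex.conj_I, Complex.conj_ofReal, map_ofNat]
  push_cast
  linear_combination (4 * Real.pi * z.im : ℂ) * Complex.I_sq

theorem setIntegral_petersson_expFun (f : CuspForm 𝒮ℒ k) {y : ℝ} (hy : 0 < y) :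
    ∫ x in Ico (0 : ℝ) 1, petersson k expFun f (ofComplex (x + y * Complex.I)) =
      (y ^ k * Real.exp (-(4 * Real.pi * y)) : ℝ) * fourierCoeff 1 f := by
  have hz : ∀ x : ℝ, 0 < ((x : ℂ) + y * Complex.I).im := fun x ↦ by simpa using hy
  rw [fourierCoeff_apply, ModularFormClass.qExpansion_coeff_eq_intervalIntegral f one_pos
    one_mem_strictPeriods 1 hy, intervalIntegral.integral_of_le zero_le_one,
    ← integral_Ico_eq_integral_Ioc, Complex.ofReal_one, div_one, one_mul, ← integral_const_mul]
  refine integral_congr_ae (.of_forall fun x ↦ ?_)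
  beta_reduce
  have hc : ofComplex ((x : ℂ) + y * Complex.I) = ⟨_, hz x⟩ := ofComplex_apply_of_im_pos (hz x)
  rw [hc, petersson, conj_expFun]
  have him : (⟨(x : ℂ) + y * Complex.I, hz x⟩ : ℍ).im = y := by
    change ((x : ℂ) + y * Complex.I).im = y
    simp
  have he : expFun ⟨(x : ℂ) + y * Complex.I, hz x⟩ =
      Function.Periodic.qParam 1 ((x : ℂ) + y * Complex.I) := by
    simp [expFun, Function.Periodic.qParam]
  rw [him, he]
  push_cast
  ring

theorem integral_stripIntegrand (hk : 3 ≤ k) (f : CuspForm 𝒮ℒ k) :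
    ∫ z, stripIntegrand f z =
      (Real.Gamma ((k : ℝ) - 1) / (4 * Real.pi) ^ ((k : ℝ) - 1) : ℝ) * fourierCoeff 1 f := by
  set H : ℝ → ℝ → ℂ := fun x y ↦ (Ico (0 : ℝ) 1).indicator
    (fun x ↦ petersson k expFun f (ofComplex (x + y * Complex.I))) x with hH
  have h1 : ∀ z : ℍ, stripIntegrand f z = H z.re z.im := by
    intro z
    by_cases hz : z.re ∈ Ico (0 : ℝ) 1
    · rw [stripIntegrand, indicator_of_mem (s := {z : ℍ | z.re ∈ Ico (0 : ℝ) 1}) hz, hH]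
      simp only [indicator_of_mem hz]
      rw [← coe_re, ← coe_im, Complex.re_add_im, ofComplex_apply]
    · rw [stripIntegrand, indicator_of_notMem (s := {z : ℍ | z.re ∈ Ico (0 : ℝ) 1}) hz, hH]
      simp only [indicator_of_notMem hz]
  have h2 := integrable_stripIntegrand hk f
  simp_rw [funext h1] at h2 ⊢
  rw [integral_eq h2]
  have h3 : ∀ y ∈ Ioi (0 : ℝ), ∫ x : ℝ, ((y ^ 2)⁻¹ : ℝ) * H x y =
      (y ^ ((k : ℝ) - 1 - 1) * Real.exp (-(4 * Real.pi * y)) : ℝ) * fourierCoeff 1 f := by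
    intro y hy
    have hy0 : (0 : ℝ) < y := hy
    simp only [hH]
    rw [integral_const_mul, integral_indicator measurableSet_Ico, setIntegral_petersson_expFun f hy0,
      ← mul_assoc, ← Complex.ofReal_mul, ← mul_assoc]
    congr 4
    rw [← Real.rpow_intCast, ← Real.rpow_natCast, ← Real.rpow_neg hy0.le, ← Real.rpow_add hy0]
    congr 1
    push_cast
    ring
  have hk' : (3 : ℝ) ≤ k := by exact_mod_cast hk
  rw [setIntegral_congr_fun measurableSet_Ioi h3, integral_mul_const, integral_complex_ofReal,
    Real.integral_rpow_mul_exp_neg_mul_Ioi (by linarith) (by positivity)]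
  congr 2
  rw [one_div, Real.inv_rpow (by positivity)]
  ring

/-- By unfolding, the inner product with the Poincaré series picks out the first Fourier
coefficient. -/
theorem setIntegral_petersson_poincareFun (hk : 3 ≤ k) (f : CuspForm 𝒮ℒ k) :
    ∫ z in fd, petersson k (poincareFun k) f z =
      (Real.Gamma ((k : ℝ) - 1) / (4 * Real.pi) ^ ((k : ℝ) - 1) : ℝ) * fourierCoeff 1 f := by
  simp_rw [petersson_poincareFun, ← tsum_stripIntegrand]
  rw [integral_const_mul, setIntegral_fd_tsum (integrable_stripIntegrand hk f)
    (measurable_stripIntegrand f), integral_stripIntegrand hk]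
  ring

section Weight

variable {k : ℕ}

theorem harmonicWeight_pos {f : CuspForm 𝒮ℒ (k : ℤ)} (hk : 2 ≤ k) (hf : f ≠ 0) :
    0 < harmonicWeight f := by
  have hk' : (2 : ℝ) ≤ k := by exact_mod_cast hk
  have := peterssonInner_self_pos hf
  have := Real.Gamma_pos_of_pos (show (0 : ℝ) < (k : ℝ) - 1 by linarith)
  rw [harmonicWeight]
  positivity

/-- The spectral expansion of the Poincaré series. -/
theorem poincare_eq_sum (hk : 5 ≤ (k : ℤ)) (hk2 : Even (k : ℤ)) :
    poincare hk hk2 = ∑ f ∈ (finite_heckeEigenforms (k := k)).toFinset,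
      ((harmonicWeight f)⁻¹ : ℂ) • f := by
  set S := (finite_heckeEigenforms (k := k)).toFinset with hS
  have hmem : ∀ f, f ∈ S ↔ f ∈ heckeEigenforms k := fun f ↦ by simp [hS]
  have hsp : poincare hk hk2 ∈ Submodule.span ℂ (S : Set (CuspForm 𝒮ℒ (k : ℤ))) := by
    rw [hS, Set.Finite.coe_toFinset, span_heckeEigenforms]
    trivial
  obtain ⟨c, -, hc⟩ := Submodule.mem_span_finset.1 hsp
  rw [← hc]
  refine Finset.sum_congr rfl fun f hf ↦ ?_
  congr 1
  have hfe := (hmem f).1 hf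
  have h1 : peterssonInner f (poincare hk hk2) = c f * peterssonInner f f := by
    rw [← hc]
    have h2 : peterssonInner f (∑ g ∈ S, c g • g) = ∑ g ∈ S, c g * peterssonInner f g := by
      let L : CuspForm 𝒮ℒ (k : ℤ) →ₗ[ℂ] ℂ :=
        { toFun := fun g ↦ peterssonInner f g
          map_add' := fun g h ↦ peterssonInner_add_right f g h
          map_smul' := fun c g ↦ peterssonInner_smul_right c f g }
      have := map_sum L (fun g ↦ c g • g) S
      simp only [map_smul] at this
      exact this
    rw [h2, Finset.sum_eq_single f]
    · intro g hg hne
      rw [peterssonInner_eq_zero_of_mem hfe ((hmem g).1 hg) hne.symm, mul_zero]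
    · exact fun h ↦ absurd hf h
  have h3 : peterssonInner (poincare hk hk2) f =
      (Real.Gamma ((k : ℝ) - 1) / (4 * Real.pi) ^ ((k : ℝ) - 1) : ℝ) := by
    have := setIntegral_petersson_poincareFun (by lia) f
    rw [fourierCoeff_one_of_mem hfe, mul_one] at this
    exact this
  rw [← peterssonInner_conj, h3, Complex.conj_ofReal, peterssonInner_self] at h1
  have hp := peterssonInner_self_pos (ne_zero_of_mem hfe)
  have hk' : (5 : ℝ) ≤ k := by exact_mod_cast hk
  have hG := Real.Gamma_pos_of_pos (show (0 : ℝ) < (k : ℝ) - 1 by linarith)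
  have hp' : ((peterssonInner f f).re : ℂ) ≠ 0 := by exact_mod_cast hp.ne'
  rw [eq_comm, ← eq_div_iff hp'] at h1
  rw [h1, harmonicWeight]
  push_cast
  rw [mul_inv, inv_div]
  rfl

end Weight

end HeckeMoment

namespace HeckeMoment

open ModularGroup MeasureTheory Filter Set
open scoped ModularForm Manifold Topology

/-! ### The central value as an integral along the imaginary axis -/

/-- The integral `∫_1^∞ F(it) t ^ (k / 2 - 1) dt`. -/
noncomputable def axisIntegral (k : ℕ) (F : ℍ → ℂ) : ℂ :=
  ∫ t in Ioi (1 : ℝ), ((t ^ ((k : ℝ) / 2 - 1) : ℝ) : ℂ) * F (ofComplex (Complex.I * t))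

/-- The factor `2 (2 π) ^ (k / 2) / Γ(k / 2)` relating the central value of the `L`-function to
`axisIntegral`. -/
noncomputable def centralFactor (k : ℕ) : ℝ :=
  2 * (2 * Real.pi) ^ ((k : ℝ) / 2) / Real.Gamma ((k : ℝ) / 2)

theorem centralFactor_pos {k : ℕ} (hk : 0 < k) : 0 < centralFactor k := by
  have : (0 : ℝ) < (k : ℝ) / 2 := by positivity
  have := Real.Gamma_pos_of_pos this
  rw [centralFactor]
  positivity

variable {k : ℕ}

theorem cpow_half_sub_one {t : ℝ} (ht : 0 ≤ t) :
    (t : ℂ) ^ ((k : ℂ) / 2 - 1) = ((t ^ ((k : ℝ) / 2 - 1) : ℝ) : ℂ) := by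
  rw [Complex.ofReal_cpow ht]
  push_cast
  rfl

theorem integrableOn_axis (hk : 0 < k) (f : CuspForm 𝒮ℒ (k : ℤ)) :
    IntegrableOn (fun t : ℝ ↦ ((t ^ ((k : ℝ) / 2 - 1) : ℝ) : ℂ) * f (ofComplex (Complex.I * t)))
      (Ioi 0) := by
  have h := ((CuspForm.isStrongFEPair (Int.natCast_pos.mpr hk) f).hasMellin ((k : ℂ) / 2)).1
  refine IntegrableOn.congr_fun h (fun t ht ↦ ?_) measurableSet_Ioi
  have ht0 : (0 : ℝ) < t := ht
  rw [cpow_half_sub_one ht0.le]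
  rfl

theorem apply_axis_inv (hk : 0 < k) (hk4 : 4 ∣ k) (f : CuspForm 𝒮ℒ (k : ℤ)) {t : ℝ} (ht : 0 < t) :
    f (ofComplex (Complex.I * (t⁻¹ : ℝ))) = ((t ^ k : ℝ) : ℂ) * f (ofComplex (Complex.I * t)) := by
  have h := (ModularForm.weakFEPair (Int.natCast_pos.mpr hk) f).h_feq t ht
  simp only [ModularForm.weakFEPair, ModularForm.coe_translate] at h
  have hS : (f : ℍ → ℂ) ∣[(k : ℤ)] (S : GL (Fin 2) ℝ) = f := cuspForm_slash f S
  rw [hS] at h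
  have hI : Complex.I ^ (k : ℤ) = 1 := by
    obtain ⟨m, rfl⟩ := hk4
    rw [zpow_natCast, pow_mul, Complex.I_pow_four, one_pow]
  rw [hI, one_mul, one_div, smul_eq_mul] at h
  rw [h]
  norm_cast

/-- The functional equation folds the Mellin transform at the centre onto `(1, ∞)`. -/
theorem integral_axis_eq (hk : 0 < k) (hk4 : 4 ∣ k) (f : CuspForm 𝒮ℒ (k : ℤ)) :
    ∫ t in Ioi (0 : ℝ), ((t ^ ((k : ℝ) / 2 - 1) : ℝ) : ℂ) * f (ofComplex (Complex.I * t)) =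
      2 * axisIntegral k f := by
  set φ : ℝ → ℂ := fun t ↦ ((t ^ ((k : ℝ) / 2 - 1) : ℝ) : ℂ) * f (ofComplex (Complex.I * t))
    with hφ
  have hi : IntegrableOn φ (Ioi 0) := integrableOn_axis hk f
  have h1 : ∫ t in Ioi (0 : ℝ), φ t = (∫ t in Ioc (0 : ℝ) 1, φ t) + ∫ t in Ioi (1 : ℝ), φ t := by
    rw [← setIntegral_union (Ioc_disjoint_Ioi le_rfl) measurableSet_Ioi
      (hi.mono_set Ioc_subset_Ioi_self) (hi.mono_set (Ioi_subset_Ioi zero_le_one)),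
      Ioc_union_Ioi_eq_Ioi zero_le_one]
  have h2 : ∫ t in Ioc (0 : ℝ) 1, φ t = ∫ t in Ioi (1 : ℝ), φ t := by
    have e1 : ∫ t in Ioc (0 : ℝ) 1, φ t = ∫ t in Ioi (0 : ℝ), (Ioc (0 : ℝ) 1).indicator φ t := by
      rw [setIntegral_indicator measurableSet_Ioc,
        inter_eq_self_of_subset_right Ioc_subset_Ioi_self]
    have e2 : ∫ t in Ioi (1 : ℝ), φ t = ∫ t in Ioi (0 : ℝ), (Ici (1 : ℝ)).indicator φ t := by
      rw [setIntegral_indicator measurableSet_Ici, inter_eq_self_of_subset_right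
        (Ici_subset_Ioi.2 (zero_lt_one' ℝ)), integral_Ici_eq_integral_Ioi]
    rw [e1, e2, ← integral_comp_rpow_Ioi _ (p := -1) (by norm_num)]
    refine setIntegral_congr_fun measurableSet_Ioi fun t ht ↦ ?_
    have ht0 : (0 : ℝ) < t := ht
    rw [Real.rpow_neg_one]
    by_cases h : 1 ≤ t
    · have h' : t⁻¹ ∈ Ioc (0 : ℝ) 1 := ⟨by positivity, inv_le_one_of_one_le₀ h⟩
      rw [indicator_of_mem h', indicator_of_mem (s := Ici 1) h, hφ]
      beta_reduce
      rw [apply_axis_inv hk hk4 f ht0, Complex.real_smul, ← mul_assoc, ← mul_assoc,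
        ← Complex.ofReal_mul, ← Complex.ofReal_mul]
      congr 2
      rw [abs_neg, abs_one, one_mul, Real.inv_rpow ht0.le, ← Real.rpow_neg ht0.le,
        ← Real.rpow_natCast, ← Real.rpow_add ht0, ← Real.rpow_add ht0]
      congr 1
      ring
    · have h' : t⁻¹ ∉ Ioc (0 : ℝ) 1 := by
        rintro ⟨-, h2⟩
        exact h ((inv_le_one₀ ht0).1 h2)
      rw [indicator_of_notMem h', indicator_of_notMem (s := Ici 1) h, smul_zero]
  rw [h1, h2, axisIntegral]
  ring

theorem LFunction_half (hk : 0 < k) (hk4 : 4 ∣ k) (f : CuspForm 𝒮ℒ (k : ℤ)) :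
    LFunction hk f (1 / 2) = centralFactor k * axisIntegral k f := by
  have hs : (1 / 2 : ℂ) + ((k : ℂ) - 1) / 2 = (k : ℂ) / 2 := by ring
  have hm : ModularForm.Λ (Int.natCast_pos.mpr hk) f ((k : ℂ) / 2) = 2 * axisIntegral k f := by
    rw [CuspForm.Λ_eq_mellin, ← integral_axis_eq hk hk4, mellin]
    refine setIntegral_congr_fun measurableSet_Ioi fun t ht ↦ ?_
    have ht0 : (0 : ℝ) < t := ht
    rw [cpow_half_sub_one ht0.le]
    rfl
  rw [LFunction, ModularForm.L, hs, hm, Complex.Gammaℂ_def, centralFactor]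
  have hG : Complex.Gamma ((k : ℂ) / 2) = (Real.Gamma ((k : ℝ) / 2) : ℂ) := by
    rw [← Complex.Gamma_ofReal]
    push_cast
    rfl
  have hp : (2 * (Real.pi : ℂ)) ^ (-((k : ℂ) / 2)) = (((2 * Real.pi) ^ ((k : ℝ) / 2) : ℝ) : ℂ)⁻¹ := by
    rw [Complex.cpow_neg, Complex.ofReal_cpow (by positivity)]
    push_cast
    rfl
  rw [hG, hp]
  have h1 : ((2 * Real.pi) ^ ((k : ℝ) / 2) : ℝ) ≠ 0 := by positivity
  have h1' : (((2 * Real.pi) ^ ((k : ℝ) / 2) : ℝ) : ℂ) ≠ 0 := by exact_mod_cast h1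
  push_cast at h1' ⊢
  field_simp

/-- An eigenform is real on the imaginary axis. -/
theorem conj_apply_axis {f : CuspForm 𝒮ℒ (k : ℤ)} (hf : f ∈ heckeEigenforms k) {t : ℝ}
    (ht : 0 < t) :
    starRingEnd ℂ (f (ofComplex (Complex.I * t))) = f (ofComplex (Complex.I * t)) := by
  have h := hasSum_fourierCoeff f (ofComplex (Complex.I * t))
  have h2 := h.map (starRingEnd ℂ) Complex.continuous_conj
  refine h2.unique ?_
  convert! h using 2 with m
  simp only [Function.comp_apply, map_mul, map_pow, conj_fourierCoeff_of_mem hf]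
  congr 2
  rw [ofComplex_apply_of_im_pos (by simpa using ht), ← Complex.exp_conj]
  congr 1
  simp only [map_mul, Complex.conj_I, Complex.conj_ofReal, map_ofNat]
  ring

theorem conj_axisIntegral {f : CuspForm 𝒮ℒ (k : ℤ)} (hf : f ∈ heckeEigenforms k) :
    starRingEnd ℂ (axisIntegral k f) = axisIntegral k f := by
  rw [axisIntegral, ← integral_conj]
  refine setIntegral_congr_fun measurableSet_Ioi fun t ht ↦ ?_
  have ht0 : (0 : ℝ) < t := zero_lt_one.trans ht
  rw [map_mul, Complex.conj_ofReal, conj_apply_axis hf ht0]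

/-- The (real) central value of the `L`-function of an eigenform. -/
noncomputable def centralValue (f : CuspForm 𝒮ℒ (k : ℤ)) : ℝ :=
  centralFactor k * (axisIntegral k f).re

theorem ofReal_centralValue {f : CuspForm 𝒮ℒ (k : ℤ)} (hf : f ∈ heckeEigenforms k) :
    (centralValue f : ℂ) = centralFactor k * axisIntegral k f := by
  rw [centralValue, Complex.ofReal_mul, Complex.conj_eq_iff_re.1 (conj_axisIntegral hf)]

/-- The harmonic moment as a finite sum of real numbers. -/
theorem harmonicMoment_eq (hk : 0 < k) (hk4 : 4 ∣ k) (r : ℕ) :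
    harmonicMoment hk r = ((∑ f ∈ (finite_heckeEigenforms (k := k)).toFinset,
      (harmonicWeight f)⁻¹ * centralValue f ^ r : ℝ) : ℂ) := by
  rw [harmonicMoment, finsum_mem_eq_finite_toFinset_sum _ finite_heckeEigenforms]
  push_cast
  refine Finset.sum_congr rfl fun f hf ↦ ?_
  rw [LFunction_half hk hk4, ofReal_centralValue (by simpa using hf), one_div]

end HeckeMoment

namespace HeckeMoment

open ModularGroup MeasureTheory Filter Set EisensteinSeries
open scoped ModularForm Manifold Topology

/-! ### Fourier coefficients and central values of the Poincaré series -/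

variable {k : ℕ}

theorem intervalIntegral_expFun {n : ℕ} {y : ℝ} (hy : 0 < y) :
    ∫ u in (0 : ℝ)..1, 1 / Function.Periodic.qParam 1 (u + y * Complex.I) ^ n *
      expFun ⟨u + y * Complex.I, by simpa using hy⟩ = if n = 1 then 1 else 0 := by
  have h1 : ∀ u : ℝ, 1 / Function.Periodic.qParam 1 (u + y * Complex.I) ^ n *
      expFun ⟨u + y * Complex.I, by simpa using hy⟩ =
      Complex.exp (2 * Real.pi * Complex.I * (1 - n) * (y * Complex.I)) *
      Complex.exp ((2 * Real.pi * Complex.I * (1 - n)) * u) := by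
    intro u
    simp only [expFun, Function.Periodic.qParam]
    rw [← Complex.exp_nat_mul, one_div, ← Complex.exp_neg, ← Complex.exp_add, ← Complex.exp_add]
    congr 1
    push_cast
    ring
  simp_rw [h1]
  split_ifs with hn
  · simp [hn]
  · have hn' : (1 - n : ℂ) ≠ 0 := by
      rw [sub_ne_zero]
      exact_mod_cast Ne.symm hn
    have hc : 2 * Real.pi * Complex.I * (1 - n) ≠ 0 :=
      mul_ne_zero Complex.two_pi_I_ne_zero hn'
    rw [intervalIntegral.integral_const_mul, integral_exp_mul_complex hc]
    have : Complex.exp (2 * Real.pi * Complex.I * (1 - n) * (1 : ℝ)) = 1 := by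
      rw [Complex.exp_eq_one_iff]
      exact ⟨1 - n, by push_cast; ring⟩
    rw [this]
    simp

/-- The constant `r` in Mathlib's bound for Eisenstein summands is at least `B / 2` on the strip
`|x| ≤ 1`, `y ≥ B`. -/
theorem r_strip_ge {B : ℝ} (hB : 0 < B) (hB1 : B ≤ 1) : B / 2 ≤ r ⟨⟨1, B⟩, hB⟩ := by
  refine le_min ?_ ?_
  · change B / 2 ≤ B
    linarith
  · refine Real.le_sqrt_of_sq_le ?_
    rw [r1]
    change (B / 2) ^ 2 ≤ B ^ 2 / ((1 : ℝ) ^ 2 + B ^ 2)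
    rw [le_div_iff₀ (by positivity)]
    nlinarith [sq_nonneg B, mul_le_mul hB1 hB1 hB.le zero_le_one]

theorem norm_poincareFun_sub_le' {k : ℤ} (hk : 4 ≤ k) (hk2 : Even k) {z : ℍ} {B : ℝ} (hB : 0 < B)
    (hB1 : B ≤ 1) (hz1 : |z.re| ≤ 1) (hz2 : B ≤ z.im) :
    ‖poincareFun k z - expFun z‖ ≤ 16 * coprimeConst * B ^ (-4 : ℤ) * z.im ^ (4 - k) := by
  refine (norm_poincareFun_sub_le hk hk2 hB ⟨hz1, hz2⟩).trans ?_
  have hr := r_strip_ge hB hB1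
  have h0 := coprimeConst_nonneg
  have him := z.im_pos
  have h1 : r ⟨⟨1, B⟩, hB⟩ ^ (-4 : ℝ) ≤ 16 * B ^ (-4 : ℤ) := by
    calc r ⟨⟨1, B⟩, hB⟩ ^ (-4 : ℝ) ≤ (B / 2) ^ (-4 : ℝ) :=
          Real.rpow_le_rpow_of_nonpos (by positivity) hr (by norm_num)
      _ = (B / 2) ^ (-4 : ℤ) := by
          rw [← Real.rpow_intCast]
          norm_num
      _ = 16 * B ^ (-4 : ℤ) := by
          rw [div_zpow]
          norm_num
          ring
  calc _ ≤ coprimeConst * (16 * B ^ (-4 : ℤ)) * z.im ^ (4 - k) := by gcongr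
    _ = _ := by ring

theorem continuous_line {y : ℝ} (hy : 0 < y) :
    Continuous fun u : ℝ ↦ (⟨u + y * Complex.I, by simpa using hy⟩ : ℍ) :=
  Continuous.upperHalfPlaneMk (by fun_prop) _

/-- The Fourier coefficients of the Poincaré series are close to those of `e(z)`. -/
theorem norm_fourierCoeff_poincare_sub_le (hk : 5 ≤ (k : ℤ)) (hk2 : Even (k : ℤ)) (n : ℕ) :
    ‖fourierCoeff n (poincare hk hk2) - if n = 1 then 1 else 0‖ ≤
      256 * coprimeConst * (2 : ℝ)⁻¹ ^ k * Real.exp (4 * Real.pi * n) := by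
  -- The coefficients are computed on the line `Im z = 2`, where the error `y ^ (4 - k)` is small.
  have hy : (0 : ℝ) < 2 := two_pos
  rw [fourierCoeff_apply, ModularFormClass.qExpansion_coeff_eq_intervalIntegral _ one_pos
    one_mem_strictPeriods n hy, Complex.ofReal_one, div_one, one_mul, ← intervalIntegral_expFun hy]
  have hq : ∀ u : ℝ, ‖(1 : ℂ) / Function.Periodic.qParam 1 (u + (2 : ℝ) * Complex.I) ^ n‖ =
      Real.exp (4 * Real.pi * n) := by
    intro u
    rw [norm_div, norm_one, norm_pow, Function.Periodic.norm_qParam, ← Real.exp_nat_mul, one_div,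
      ← Real.exp_neg]
    congr 1
    simp
    ring
  have hqc : Continuous fun u : ℝ ↦
      (1 : ℂ) / Function.Periodic.qParam 1 (u + (2 : ℝ) * Complex.I) ^ n := by
    refine continuous_const.div ?_ fun u ↦ ?_
    · simp only [Function.Periodic.qParam]
      fun_prop
    · simp only [Function.Periodic.qParam]
      exact pow_ne_zero _ (Complex.exp_ne_zero _)
  have hline := continuous_line hy
  have hc1 := hqc.mul ((continuous_cuspForm (poincare hk hk2)).comp hline)
  have hc2 := hqc.mul (continuous_expFun.comp hline)
  refine (congrArg norm (intervalIntegral.integral_sub (hc1.intervalIntegrable (μ := volume) 0 1)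
    (hc2.intervalIntegrable 0 1))).symm.trans_le ?_
  refine (intervalIntegral.norm_integral_le_of_norm_le_const
    (C := 256 * coprimeConst * (2 : ℝ)⁻¹ ^ k * Real.exp (4 * Real.pi * n)) ?_).trans_eq ?_
  · intro u hu
    rw [uIoc_of_le zero_le_one] at hu
    simp only [Pi.mul_apply, Function.comp_apply]
    rw [← mul_sub, norm_mul, hq, mul_comm]
    gcongr
    have h := norm_poincareFun_sub_le' (k := k) (by lia) hk2 (B := 1) one_pos le_rfl
      (z := ⟨u + (2 : ℝ) * Complex.I, by simp⟩) ?_ ?_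
    · refine h.trans_eq ?_
      have him : (⟨u + (2 : ℝ) * Complex.I, by simp⟩ : ℍ).im = 2 := by
        change ((u : ℂ) + (2 : ℝ) * Complex.I).im = 2
        simp
      rw [him, one_zpow, zpow_sub₀ two_ne_zero, zpow_natCast, inv_pow, div_eq_mul_inv]
      norm_num
      ring
    · change |((u : ℂ) + (2 : ℝ) * Complex.I).re| ≤ 1
      simp only [Complex.add_re, Complex.ofReal_re, Complex.mul_re, Complex.I_re, mul_zero,
        Complex.ofReal_im, Complex.I_im, mul_one, sub_self, add_zero]
      rw [abs_of_nonneg hu.1.le]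
      exact hu.2
    · change 1 ≤ ((u : ℂ) + (2 : ℝ) * Complex.I).im
      simp
  · simp

theorem heckeOperator_expFun (k : ℤ) {n : ℕ} (hn : 0 < n) (z : ℍ) :
    heckeOperator k n expFun z = (n : ℂ) ^ (k - 1) * expFun z ^ n := by
  rw [heckeOperator]
  congr 1
  rw [Finset.sum_eq_single (n, 1)]
  · have him : 0 < ((n : ℂ) * z).im := by
      have := z.im_pos
      simp only [Complex.mul_im, Complex.natCast_re, coe_im, Complex.natCast_im, zero_mul, add_zero]
      positivity
    simp only [Nat.cast_one, one_zpow, one_mul, Finset.sum_range_one, Nat.cast_zero, add_zero,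
      div_one]
    rw [expFun, expFun, ofComplex_apply_of_im_pos him, ← Complex.exp_nat_mul]
    congr 1
    change 2 * Real.pi * Complex.I * (n * z) = _
    ring
  · rintro ⟨a, d⟩ hp hne
    obtain ⟨had, -⟩ := Nat.mem_divisorsAntidiagonal.1 hp
    have hd : 0 < d := Nat.pos_of_ne_zero (by rintro rfl; lia)
    have ha : 0 < a := Nat.pos_of_ne_zero (by rintro rfl; lia)
    have hd1 : ¬ d ∣ 1 := by
      intro h
      have hd1 := Nat.dvd_one.1 h
      have had' : a * d = n := had
      apply hne
      rw [hd1, mul_one] at had'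
      rw [had', hd1]
    have hdC : (d : ℂ) ≠ 0 := by exact_mod_cast hd.ne'
    have h1 : ∀ b ∈ Finset.range d, expFun (ofComplex (((a : ℂ) * z + b) / d)) =
        Complex.exp (2 * Real.pi * Complex.I * (a * z / d)) *
        Complex.exp (2 * Real.pi * Complex.I * (b / d)) ^ 1 := by
      intro b _
      have him : 0 < (((a : ℂ) * z + b) / d).im := by
        have := z.im_pos
        rw [Complex.div_natCast_im]
        simp only [Complex.add_im, Complex.mul_im, Complex.natCast_re, coe_im, Complex.natCast_im,
          zero_mul, add_zero]
        positivity
      rw [expFun, ofComplex_apply_of_im_pos him, pow_one, ← Complex.exp_add]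
      congr 1
      change 2 * Real.pi * Complex.I * (((a : ℂ) * z + b) / d) = _
      ring
    simp only
    rw [Finset.sum_congr rfl h1, ← Finset.mul_sum, sum_exp_eq_ite hd, if_neg hd1, mul_zero, mul_zero]
  · intro h
    exact absurd (Nat.mem_divisorsAntidiagonal.2 ⟨mul_one n, hn.ne'⟩) h

/-- On the imaginary axis, `T_n P` is `T_n e` up to an error that is uniform in the weight. -/
theorem norm_heckeOperator_sub_le (hk : 5 ≤ (k : ℤ)) (hk2 : Even (k : ℤ)) {n : ℕ} (hn : 0 < n)
    {t : ℝ} (ht : 1 ≤ t) :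
    ‖heckeOperator k n (poincareFun k) (ofComplex (Complex.I * t)) -
      heckeOperator k n expFun (ofComplex (Complex.I * t))‖ ≤
      16 * coprimeConst * n ^ (2 * k) * t ^ (4 - k : ℤ) := by
  have ht0 : 0 < t := zero_lt_one.trans_le ht
  have hn1 : (1 : ℝ) ≤ n := by exact_mod_cast hn
  have hn0 : (0 : ℝ) < n := by exact_mod_cast hn
  have hz : ((ofComplex (Complex.I * t) : ℍ) : ℂ) = Complex.I * t := by
    rw [ofComplex_apply_of_im_pos (by simpa using ht0)]
  have hC := coprimeConst_nonneg
  rw [heckeOperator, heckeOperator, ← mul_sub, ← Finset.sum_sub_distrib, norm_mul, norm_zpow,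
    Complex.norm_natCast, hz]
  have hterm : ∀ p ∈ n.divisorsAntidiagonal,
      ‖((p.2 : ℂ) ^ (-(k : ℤ)) * ∑ b ∈ Finset.range p.2,
        poincareFun k (ofComplex (((p.1 : ℂ) * (Complex.I * t) + b) / p.2)) -
      (p.2 : ℂ) ^ (-(k : ℤ)) * ∑ b ∈ Finset.range p.2,
        expFun (ofComplex (((p.1 : ℂ) * (Complex.I * t) + b) / p.2)))‖ ≤
      16 * coprimeConst * n ^ k * t ^ (4 - k : ℤ) := by
    rintro ⟨a, d⟩ hp
    obtain ⟨had, -⟩ := Nat.mem_divisorsAntidiagonal.1 hp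
    have had : a * d = n := had
    have hd : 0 < d := Nat.pos_of_ne_zero (by rintro rfl; lia)
    have ha : 0 < a := Nat.pos_of_ne_zero (by rintro rfl; lia)
    have hd1 : (1 : ℝ) ≤ d := by exact_mod_cast hd
    have ha1 : (1 : ℝ) ≤ a := by exact_mod_cast ha
    have hd0 : (0 : ℝ) < d := by exact_mod_cast hd
    have hadn : (d : ℝ) ≤ n := by exact_mod_cast had ▸ Nat.le_mul_of_pos_left d ha
    simp only
    rw [← mul_sub, ← Finset.sum_sub_distrib, norm_mul, norm_zpow, Complex.norm_natCast]
    have hb : ∀ b ∈ Finset.range d,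
        ‖poincareFun k (ofComplex (((a : ℂ) * (Complex.I * t) + b) / d)) -
          expFun (ofComplex (((a : ℂ) * (Complex.I * t) + b) / d))‖ ≤
        16 * coprimeConst * n ^ k * t ^ (4 - k : ℤ) := by
      intro b hb
      have hbd : (b : ℝ) ≤ d := by exact_mod_cast (Finset.mem_range.1 hb).le
      have him : (((a : ℂ) * (Complex.I * t) + b) / d).im = a * t / d := by
        rw [Complex.div_natCast_im]
        simp
      have hre : (((a : ℂ) * (Complex.I * t) + b) / d).re = b / d := by
        rw [Complex.div_natCast_re]
        simp
      have him0 : 0 < (((a : ℂ) * (Complex.I * t) + b) / d).im := by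
        rw [him]
        positivity
      rw [ofComplex_apply_of_im_pos him0]
      set w : ℍ := ⟨((a : ℂ) * (Complex.I * t) + b) / d, him0⟩ with hw
      have hwim : w.im = a * t / d := him
      have hwre : w.re = b / d := hre
      have hwge : t / n ≤ w.im := by
        rw [hwim]
        have : 1 * t ≤ a * t := by gcongr
        rw [one_mul] at this
        gcongr
      have hwge' : 1 / (n : ℝ) ≤ w.im := le_trans (by gcongr) hwge
      refine (norm_poincareFun_sub_le' (by lia) hk2 (B := 1 / n) (by positivity)
        ((div_le_one hn0).2 hn1) ?_ hwge').trans ?_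
      · rw [hwre, abs_of_nonneg (by positivity)]
        exact (div_le_one hd0).2 hbd
      · have e1 : w.im ^ (4 - k : ℤ) ≤ (t / n) ^ (4 - k : ℤ) := by
          rw [← neg_sub (k : ℤ) 4, zpow_neg, zpow_neg]
          gcongr
          exact zpow_le_zpow_left₀ (by lia) (by positivity) hwge
        calc _ ≤ 16 * coprimeConst * (1 / (n : ℝ)) ^ (-4 : ℤ) * (t / n) ^ (4 - k : ℤ) := by gcongr
          _ = 16 * coprimeConst * n ^ k * t ^ (4 - k : ℤ) := by
            have : (1 / (n : ℝ)) ^ (-4 : ℤ) * (t / n) ^ (4 - k : ℤ) =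
                n ^ k * t ^ (4 - k : ℤ) := by
              rw [div_zpow, div_zpow, one_zpow, zpow_sub₀ hn0.ne', zpow_natCast]
              field_simp
            rw [mul_assoc, this]
            ring
    have hs := norm_sum_le_of_le _ hb
    rw [Finset.sum_const, Finset.card_range, nsmul_eq_mul] at hs
    calc (d : ℝ) ^ (-(k : ℤ)) * _ ≤ (d : ℝ) ^ (-(k : ℤ)) *
          (d * (16 * coprimeConst * n ^ k * t ^ (4 - k : ℤ))) := by gcongr
      _ = ((d : ℝ) ^ (-(k : ℤ)) * d) * (16 * coprimeConst * n ^ k * t ^ (4 - k : ℤ)) := by ring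
      _ ≤ 1 * (16 * coprimeConst * n ^ k * t ^ (4 - k : ℤ)) := by
        gcongr
        rw [← zpow_add_one₀ hd0.ne']
        exact zpow_le_one_of_nonpos₀ hd1 (by lia)
      _ = _ := one_mul _
  have hcard : ((n.divisorsAntidiagonal).card : ℝ) ≤ n := by
    have : (n.divisorsAntidiagonal).card ≤ n := by
      rw [← Nat.map_div_right_divisors, Finset.card_map]
      exact Nat.card_divisors_le_self n
    exact_mod_cast this
  have hs := norm_sum_le_of_le _ hterm
  rw [Finset.sum_const, nsmul_eq_mul] at hs
  calc (n : ℝ) ^ ((k : ℤ) - 1) * _ ≤ (n : ℝ) ^ ((k : ℤ) - 1) *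
        (n * (16 * coprimeConst * n ^ k * t ^ (4 - k : ℤ))) := by
        gcongr
        exact hs.trans (by gcongr)
    _ = 16 * coprimeConst * (((n : ℝ) ^ ((k : ℤ) - 1) * n) * n ^ k) * t ^ (4 - k : ℤ) := by ring
    _ = _ := by
      rw [← zpow_add_one₀ hn0.ne', sub_add_cancel, zpow_natCast, ← pow_add, two_mul]

end HeckeMoment

namespace HeckeMoment

open ModularGroup MeasureTheory Filter Set
open scoped ModularForm Manifold Topology

variable {k : ℕ}

theorem expFun_axis {t : ℝ} (ht : 0 < t) (n : ℕ) :
    expFun (ofComplex (Complex.I * t)) ^ n = ((Real.exp (-(2 * Real.pi * n * t)) : ℝ) : ℂ) := by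
  rw [expFun, ofComplex_apply_of_im_pos (by simpa using ht), ← Complex.exp_nat_mul,
    Complex.ofReal_exp]
  congr 1
  push_cast
  linear_combination (2 * Real.pi * n * t : ℂ) * Complex.I_sq

/-- The central value of `T_n` applied to the Poincaré series, up to the normalising factor: the
main term is the integral of `n ^ (k - 1) e(n z)` along the whole imaginary axis. -/
theorem norm_axisIntegral_sub_le (hk : 12 ≤ k) (hk2 : Even (k : ℤ)) {n : ℕ} (hn : 0 < n) :
    ‖axisIntegral k (heckeOperator k n (poincareFun k)) -
      ((n : ℝ) ^ ((k : ℤ) - 1) * ((1 / (2 * Real.pi * n)) ^ ((k : ℝ) / 2) *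
        Real.Gamma ((k : ℝ) / 2)) : ℝ)‖ ≤ (8 * coprimeConst + 1) * (n : ℝ) ^ (2 * k) := by
  have : NeZero n := ⟨hn.ne'⟩
  have hk' : (12 : ℝ) ≤ k := by exact_mod_cast hk
  have hn1 : (1 : ℝ) ≤ n := by exact_mod_cast hn
  have hn0 : (0 : ℝ) < n := by exact_mod_cast hn
  have hC := coprimeConst_nonneg
  have hpi := Real.pi_pos
  set E : ℝ → ℝ := fun t ↦ t ^ ((k : ℝ) / 2 - 1) * Real.exp (-(2 * Real.pi * n * t)) with hE
  have hEi : IntegrableOn E (Ioi 0) := by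
    have := integrableOn_rpow_mul_exp_neg_mul_rpow (p := 1) (s := (k : ℝ) / 2 - 1)
      (b := 2 * Real.pi * n) (by linarith) one_pos (by positivity)
    refine this.congr_fun (fun t _ ↦ ?_) measurableSet_Ioi
    simp only [hE, Real.rpow_one, neg_mul]
  set P : ℝ → ℂ := fun t ↦ ((t ^ ((k : ℝ) / 2 - 1) : ℝ) : ℂ) *
    heckeOperator k n (poincareFun k) (ofComplex (Complex.I * t)) with hP
  have hPi : IntegrableOn P (Ioi 1) := by
    have := integrableOn_axis (k := k) (by lia) (heckeLin n (poincare (k := k) (by lia) hk2))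
    rw [coe_heckeLin] at this
    exact this.mono_set (Ioi_subset_Ioi zero_le_one)
  have hEeq : ∀ t ∈ Ioi (1 : ℝ), ((t ^ ((k : ℝ) / 2 - 1) : ℝ) : ℂ) *
      heckeOperator k n expFun (ofComplex (Complex.I * t)) =
      (((n : ℝ) ^ ((k : ℤ) - 1) * E t : ℝ) : ℂ) := by
    intro t ht
    rw [heckeOperator_expFun _ hn, expFun_axis (zero_lt_one.trans ht), hE]
    push_cast
    ring
  have hsub : axisIntegral k (heckeOperator k n (poincareFun k)) -
      ((∫ t in Ioi (1 : ℝ), (n : ℝ) ^ ((k : ℤ) - 1) * E t : ℝ) : ℂ) =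
      ∫ t in Ioi (1 : ℝ), (P t - (((n : ℝ) ^ ((k : ℤ) - 1) * E t : ℝ) : ℂ)) := by
    have hi2 : IntegrableOn (fun t ↦ (((n : ℝ) ^ ((k : ℤ) - 1) * E t : ℝ) : ℂ)) (Ioi 1) :=
      ((hEi.mono_set (Ioi_subset_Ioi zero_le_one)).const_mul _).ofReal
    rw [integral_sub hPi hi2, integral_complex_ofReal]
    rfl
  have h1 : ‖∫ t in Ioi (1 : ℝ), (P t - (((n : ℝ) ^ ((k : ℤ) - 1) * E t : ℝ) : ℂ))‖ ≤
      8 * coprimeConst * (n : ℝ) ^ (2 * k) := by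
    have hb : IntegrableOn (fun t : ℝ ↦ 16 * coprimeConst * (n : ℝ) ^ (2 * k) *
        t ^ (3 - (k : ℝ) / 2)) (Ioi 1) :=
      (integrableOn_Ioi_rpow_of_lt (by linarith) one_pos).const_mul _
    refine (norm_integral_le_of_norm_le hb ?_).trans ?_
    · refine (ae_restrict_iff' measurableSet_Ioi).2 (.of_forall fun t ht ↦ ?_)
      have ht0 : 0 < t := zero_lt_one.trans ht
      rw [← hEeq t ht, hP]
      beta_reduce
      rw [← mul_sub, norm_mul, Complex.norm_real, Real.norm_of_nonneg (by positivity)]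
      have h := norm_heckeOperator_sub_le (k := k) (by lia) hk2 hn (le_of_lt ht)
      calc _ ≤ t ^ ((k : ℝ) / 2 - 1) *
            (16 * coprimeConst * n ^ (2 * k) * t ^ (4 - k : ℤ)) := by gcongr
        _ = 16 * coprimeConst * n ^ (2 * k) * (t ^ ((k : ℝ) / 2 - 1) * t ^ (4 - k : ℤ)) := by ring
        _ = _ := by
          rw [← Real.rpow_intCast, ← Real.rpow_add ht0]
          congr 2
          push_cast
          ring
    · rw [integral_const_mul, integral_Ioi_rpow_of_lt (by linarith) one_pos, Real.one_rpow]
      have : -1 / (3 - (k : ℝ) / 2 + 1) ≤ 1 / 2 := by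
        rw [neg_div, ← div_neg, div_le_div_iff₀ (by linarith) two_pos]
        linarith
      calc _ ≤ 16 * coprimeConst * (n : ℝ) ^ (2 * k) * (1 / 2) := by gcongr
        _ = _ := by ring
  have h2 : (∫ t in Ioi (1 : ℝ), (n : ℝ) ^ ((k : ℤ) - 1) * E t) -
      (n : ℝ) ^ ((k : ℤ) - 1) * ((1 / (2 * Real.pi * n)) ^ ((k : ℝ) / 2) *
        Real.Gamma ((k : ℝ) / 2)) = -((n : ℝ) ^ ((k : ℤ) - 1) * ∫ t in Ioc (0 : ℝ) 1, E t) := by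
    rw [integral_const_mul, ← Real.integral_rpow_mul_exp_neg_mul_Ioi (by linarith) (by positivity)]
    have : ∫ t in Ioi (0 : ℝ), E t = (∫ t in Ioc (0 : ℝ) 1, E t) + ∫ t in Ioi (1 : ℝ), E t := by
      rw [← setIntegral_union (Ioc_disjoint_Ioi le_rfl) measurableSet_Ioi
        (hEi.mono_set Ioc_subset_Ioi_self) (hEi.mono_set (Ioi_subset_Ioi zero_le_one)),
        Ioc_union_Ioi_eq_Ioi zero_le_one]
    change _ - _ * ∫ t in Ioi (0 : ℝ), E t = _
    rw [this]
    ring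
  have h3 : ‖∫ t in Ioc (0 : ℝ) 1, E t‖ ≤ 1 := by
    have := norm_setIntegral_le_of_norm_le_const (μ := volume) (f := E) (s := Ioc (0 : ℝ) 1)
      (C := 1) (by simp) (fun t ht ↦ ?_)
    · simpa using this
    · have ht0 := ht.1
      rw [hE]
      beta_reduce
      rw [Real.norm_of_nonneg (by positivity)]
      refine mul_le_one₀ (Real.rpow_le_one ht0.le ht.2 (by linarith)) (by positivity) ?_
      rw [Real.exp_le_one_iff]
      have : 0 ≤ 2 * Real.pi * n * t := by positivity
      linarith
  have h4 : ‖-((n : ℝ) ^ ((k : ℤ) - 1) * ∫ t in Ioc (0 : ℝ) 1, E t)‖ ≤ (n : ℝ) ^ (2 * k) := by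
    rw [norm_neg, norm_mul, Real.norm_of_nonneg (by positivity)]
    calc _ ≤ (n : ℝ) ^ ((k : ℤ) - 1) * 1 := by gcongr
      _ ≤ (n : ℝ) ^ ((2 * k : ℕ) : ℤ) := by
        rw [mul_one]
        exact zpow_le_zpow_right₀ hn1 (by push_cast; lia)
      _ = _ := zpow_natCast _ _
  calc _ = ‖(axisIntegral k (heckeOperator k n (poincareFun k)) -
        ((∫ t in Ioi (1 : ℝ), (n : ℝ) ^ ((k : ℤ) - 1) * E t : ℝ) : ℂ)) +
        (((∫ t in Ioi (1 : ℝ), (n : ℝ) ^ ((k : ℤ) - 1) * E t) -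
        (n : ℝ) ^ ((k : ℤ) - 1) * ((1 / (2 * Real.pi * n)) ^ ((k : ℝ) / 2) *
        Real.Gamma ((k : ℝ) / 2)) : ℝ) : ℂ)‖ := by
        congr 1
        push_cast
        ring
    _ ≤ 8 * coprimeConst * (n : ℝ) ^ (2 * k) + (n : ℝ) ^ (2 * k) := by
        rw [hsub, h2]
        refine (norm_add_le _ _).trans (add_le_add h1 ?_)
        rw [Complex.norm_real]
        exact h4
    _ = _ := by ring

/-! ### Harmonic averages over eigenforms -/

/-- The normalised Hecke eigenvalue `λ_f(n)` as a real number. -/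
noncomputable def eigenvalue (f : CuspForm 𝒮ℒ (k : ℤ)) (n : ℕ) : ℝ :=
  (fourierCoeff n f).re / (n : ℝ) ^ (((k : ℝ) - 1) / 2)

theorem ofReal_eigenvalue {f : CuspForm 𝒮ℒ (k : ℤ)} (hf : f ∈ heckeEigenforms k) (n : ℕ) :
    (eigenvalue f n : ℂ) = fourierCoeff n f / ((n : ℝ) ^ (((k : ℝ) - 1) / 2) : ℝ) := by
  rw [eigenvalue, Complex.ofReal_div, Complex.conj_eq_iff_re.1 (conj_fourierCoeff_of_mem hf n)]

/-- The harmonic average `∑_{f ∈ H_k} φ(f) / ω_f`. -/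
noncomputable def harmonicAverage (k : ℕ) (φ : CuspForm 𝒮ℒ (k : ℤ) → ℝ) : ℝ :=
  ∑ f ∈ (finite_heckeEigenforms (k := k)).toFinset, (harmonicWeight f)⁻¹ * φ f

theorem heckeLin_poincare (hk : 5 ≤ (k : ℤ)) (hk2 : Even (k : ℤ)) (n : ℕ) [NeZero n] :
    heckeLin n (poincare hk hk2) = ∑ f ∈ (finite_heckeEigenforms (k := k)).toFinset,
      ((harmonicWeight f)⁻¹ * fourierCoeff n f : ℂ) • f := by
  rw [poincare_eq_sum, map_sum]
  refine Finset.sum_congr rfl fun f hf ↦ ?_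
  rw [map_smul, heckeLin_of_mem (by simpa using hf), smul_smul, Complex.ofReal_inv]

/-- The Petersson formula, in the form of an approximate orthogonality relation. -/
theorem abs_harmonicAverage_eigenvalue_sub_le (hk : 5 ≤ (k : ℤ)) (hk2 : Even (k : ℤ)) {n : ℕ}
    (hn : 0 < n) :
    |harmonicAverage k (fun f ↦ eigenvalue f n) - if n = 1 then 1 else 0| ≤
      256 * coprimeConst * (2 : ℝ)⁻¹ ^ k * Real.exp (4 * Real.pi * n) := by
  have hn1 : (1 : ℝ) ≤ n := by exact_mod_cast hn
  have hk' : (5 : ℝ) ≤ k := by exact_mod_cast hk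
  set N : ℝ := (n : ℝ) ^ (((k : ℝ) - 1) / 2) with hN
  have hN1 : 1 ≤ N := Real.one_le_rpow hn1 (by linarith)
  have hN0 : (N : ℂ) ≠ 0 := by
    have : N ≠ 0 := by positivity
    exact_mod_cast this
  have h := norm_fourierCoeff_poincare_sub_le hk hk2 n
  have h1 : fourierCoeff n (poincare hk hk2) =
      N * (harmonicAverage k (fun f ↦ eigenvalue f n) : ℂ) := by
    rw [poincare_eq_sum, map_sum, harmonicAverage]
    push_cast
    rw [Finset.mul_sum]
    refine Finset.sum_congr rfl fun f hf ↦ ?_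
    rw [map_smul, ofReal_eigenvalue (by simpa using hf), smul_eq_mul, ← hN]
    field_simp
  have h2 : fourierCoeff n (poincare hk hk2) - (if n = 1 then 1 else 0) =
      ((N * (harmonicAverage k (fun f ↦ eigenvalue f n) - if n = 1 then 1 else 0) : ℝ) : ℂ) := by
    rw [h1]
    split_ifs with hn'
    · simp [hN, hn']
    · simp
  rw [h2, Complex.norm_real, norm_mul, Real.norm_of_nonneg (by positivity), Real.norm_eq_abs] at h
  exact (le_mul_of_one_le_left (abs_nonneg _) hN1).trans h

theorem axisIntegral_sum (hk : 0 < k) {ι : Type*} (s : Finset ι) (c : ι → ℂ)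
    (f : ι → CuspForm 𝒮ℒ (k : ℤ)) :
    axisIntegral k (∑ i ∈ s, c i • f i : CuspForm 𝒮ℒ (k : ℤ)) =
      ∑ i ∈ s, c i * axisIntegral k (f i) := by
  let L : CuspForm 𝒮ℒ (k : ℤ) →ₗ[ℂ] ℂ :=
    { toFun := fun g ↦ axisIntegral k g
      map_add' := fun g h ↦ by
        have e1 := (integrableOn_axis hk g).mono_set (Ioi_subset_Ioi (zero_le_one' ℝ))
        have e2 := (integrableOn_axis hk h).mono_set (Ioi_subset_Ioi (zero_le_one' ℝ))
        simp only [axisIntegral]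
        rw [← integral_add e1 e2]
        simp only [← mul_add]
        rfl
      map_smul' := fun c g ↦ by
        simp only [axisIntegral, RingHom.id_apply, smul_eq_mul]
        rw [← integral_const_mul]
        congr 1
        ext t
        change _ * (c * g _) = c * (_ * g _)
        ring }
  have := map_sum L (fun i ↦ c i • f i) s
  simp only [map_smul] at this
  exact this

/-- The harmonic average of `λ_f(n) L(1/2, f)` is close to `2 / √n`. -/
theorem abs_harmonicAverage_eigenvalue_mul_centralValue_sub_le (hk : 12 ≤ k) (hk2 : Even (k : ℤ))
    {n : ℕ} (hn : 0 < n) :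
    |harmonicAverage k (fun f ↦ eigenvalue f n * centralValue f) - 2 / √n| ≤
      (8 * coprimeConst + 1) * centralFactor k * (n : ℝ) ^ (2 * k) := by
  have : NeZero n := ⟨hn.ne'⟩
  have hn1 : (1 : ℝ) ≤ n := by exact_mod_cast hn
  have hn0 : (0 : ℝ) < n := by exact_mod_cast hn
  have hk' : (12 : ℝ) ≤ k := by exact_mod_cast hk
  have hpi := Real.pi_pos
  have hA := centralFactor_pos (k := k) (by lia)
  have hG := Real.Gamma_pos_of_pos (show 0 < (k : ℝ) / 2 by linarith)
  set N : ℝ := (n : ℝ) ^ (((k : ℝ) - 1) / 2) with hN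
  have hN1 : 1 ≤ N := Real.one_le_rpow hn1 (by linarith)
  have hN0 : (N : ℂ) ≠ 0 := by
    have : N ≠ 0 := by positivity
    exact_mod_cast this
  have h := norm_axisIntegral_sub_le hk hk2 hn
  set M : ℝ := (n : ℝ) ^ ((k : ℤ) - 1) * ((1 / (2 * Real.pi * n)) ^ ((k : ℝ) / 2) *
        Real.Gamma ((k : ℝ) / 2)) with hM
  have hMA : centralFactor k * M = N * (2 / √n) := by
    rw [hM, centralFactor, hN, one_div, Real.inv_rpow (by positivity),
      Real.mul_rpow (by positivity) hn0.le, Real.sqrt_eq_rpow]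
    have e1 : (n : ℝ) ^ ((k : ℤ) - 1) =
        (n : ℝ) ^ (((k : ℝ) - 1) / 2) * (n : ℝ) ^ (((k : ℝ) - 1) / 2) := by
      rw [← Real.rpow_intCast, ← Real.rpow_add hn0]
      congr 1
      push_cast
      ring
    have e2 : (n : ℝ) ^ ((k : ℝ) / 2) = (n : ℝ) ^ (((k : ℝ) - 1) / 2) * (n : ℝ) ^ (1 / 2 : ℝ) := by
      rw [← Real.rpow_add hn0]
      congr 1
      ring
    rw [e1, e2]
    field_simp
  have hT : axisIntegral k (heckeOperator k n (poincareFun k)) * centralFactor k =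
      N * (harmonicAverage k (fun f ↦ eigenvalue f n * centralValue f) : ℂ) := by
    have h5 : 5 ≤ (k : ℤ) := by lia
    have e := heckeLin_poincare h5 hk2 n
    have e2 : (heckeOperator k n (poincareFun k)) = ⇑(heckeLin n (poincare h5 hk2)) := rfl
    rw [e2, e, axisIntegral_sum (by lia), harmonicAverage]
    push_cast
    rw [Finset.mul_sum, Finset.sum_mul]
    refine Finset.sum_congr rfl fun f hf ↦ ?_
    have hf' : f ∈ heckeEigenforms k := by simpa using hf
    rw [ofReal_eigenvalue hf', ofReal_centralValue hf', ← hN]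
    field_simp
  have h2 : (axisIntegral k (heckeOperator k n (poincareFun k)) - M) * centralFactor k =
      ((N * (harmonicAverage k (fun f ↦ eigenvalue f n * centralValue f) - 2 / √n) : ℝ) : ℂ) := by
    rw [sub_mul, hT, mul_sub N, ← hMA]
    push_cast
    ring
  have h3 := congrArg norm h2
  rw [Complex.norm_real, norm_mul, norm_mul, Complex.norm_real, Real.norm_of_nonneg hA.le,
    Real.norm_of_nonneg (zero_le_one.trans hN1), Real.norm_eq_abs] at h3
  refine (le_mul_of_one_le_left (abs_nonneg _) hN1).trans ?_
  rw [← h3]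
  calc _ ≤ (8 * coprimeConst + 1) * (n : ℝ) ^ (2 * k) * centralFactor k := by gcongr
    _ = _ := by ring

/-- Hecke's multiplication rule `λ(m) λ(n) = ∑_{d ∣ (m, n)} λ(m n / d²)`. -/
theorem eigenvalue_mul {f : CuspForm 𝒮ℒ (k : ℤ)} (hf : f ∈ heckeEigenforms k) {m n : ℕ}
    (hm : 0 < m) (hn : 0 < n) :
    eigenvalue f m * eigenvalue f n =
      ∑ d ∈ (m.gcd n).divisors, eigenvalue f (m / d * (n / d)) := by
  have hm0 : (0 : ℝ) < m := by exact_mod_cast hm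
  have hn0 : (0 : ℝ) < n := by exact_mod_cast hn
  rw [← Complex.ofReal_inj]
  push_cast
  rw [ofReal_eigenvalue hf, ofReal_eigenvalue hf, div_mul_div_comm, fourierCoeff_mul_of_mem hf hm,
    heckeCoeff, Finset.sum_div]
  refine Finset.sum_congr ?_ fun d hd ↦ ?_
  · ext d
    simp only [Finset.mem_filter, Nat.mem_divisors, Nat.dvd_gcd_iff]
    have := Nat.gcd_pos_of_pos_left n hm
    grind
  · obtain ⟨h1, -⟩ := Nat.mem_divisors.1 hd
    obtain ⟨⟨a, rfl⟩, ⟨b, rfl⟩⟩ := Nat.dvd_gcd_iff.1 h1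
    have hd0 : 0 < d := Nat.pos_of_ne_zero (by rintro rfl; simp at hm)
    have hd0' : (0 : ℝ) < d := by exact_mod_cast hd0
    have ha0 : 0 < a := Nat.pos_of_ne_zero (by rintro rfl; simp at hm)
    have ha0' : (0 : ℝ) < a := by exact_mod_cast ha0
    have hb0 : 0 < b := Nat.pos_of_ne_zero (by rintro rfl; simp at hn)
    have hb0' : (0 : ℝ) < b := by exact_mod_cast hb0
    rw [Nat.mul_div_cancel_left _ hd0, Nat.mul_div_cancel_left _ hd0, ofReal_eigenvalue hf]
    have e1 : ((d * a : ℕ) : ℝ) ^ (((k : ℝ) - 1) / 2) * ((d * b : ℕ) : ℝ) ^ (((k : ℝ) - 1) / 2) =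
        (d : ℝ) ^ ((k : ℤ) - 1) * ((a * b : ℕ) : ℝ) ^ (((k : ℝ) - 1) / 2) := by
      push_cast
      rw [Real.mul_rpow hd0'.le ha0'.le, Real.mul_rpow hd0'.le hb0'.le,
        Real.mul_rpow ha0'.le hb0'.le]
      have : (d : ℝ) ^ ((k : ℤ) - 1) =
          (d : ℝ) ^ (((k : ℝ) - 1) / 2) * (d : ℝ) ^ (((k : ℝ) - 1) / 2) := by
        rw [← Real.rpow_intCast, ← Real.rpow_add hd0']
        congr 1
        push_cast
        ring
      rw [this]
      ring
    rw [← Complex.ofReal_mul, e1]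
    have hdC : ((d : ℂ) ^ ((k : ℤ) - 1)) ≠ 0 := zpow_ne_zero _ (by exact_mod_cast hd0.ne')
    push_cast
    rw [mul_div_mul_left _ _ hdC]

end HeckeMoment

namespace HeckeMoment

open Finset

/-! ### Sums over squarefree integers -/

theorem sum_le_sum_of_injOn_of_le {ι κ : Type*} {s : Finset ι} {t : Finset κ} {f : ι → ℝ}
    {F : κ → ℝ} (e : ι → κ) (hmap : ∀ i ∈ s, e i ∈ t) (hinj : Set.InjOn e s)
    (hF : ∀ j ∈ t, 0 ≤ F j) (hle : ∀ i ∈ s, f i ≤ F (e i)) : ∑ i ∈ s, f i ≤ ∑ j ∈ t, F j := by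
  classical
  calc ∑ i ∈ s, f i ≤ ∑ i ∈ s, F (e i) := sum_le_sum hle
    _ = ∑ j ∈ s.image e, F j := (sum_image hinj).symm
    _ ≤ ∑ j ∈ t, F j := sum_le_sum_of_subset_of_nonneg
        (fun j hj ↦ by obtain ⟨i, hi, rfl⟩ := mem_image.1 hj; exact hmap i hi)
        fun j hj _ ↦ hF j hj

/-- The function `a ^ ω(n)`, where `ω(n)` is the number of prime factors of `n`. -/
def powOmega (a n : ℕ) : ℝ := (a : ℝ) ^ n.primeFactors.card

theorem powOmega_nonneg (a n : ℕ) : 0 ≤ powOmega a n := by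
  unfold powOmega
  positivity

@[simp]
theorem powOmega_one_left (n : ℕ) : powOmega 1 n = 1 := by simp [powOmega]

@[simp]
theorem powOmega_one_right (a : ℕ) : powOmega a 1 = 1 := by simp [powOmega]

theorem powOmega_zero_of_one_lt {n : ℕ} (hn : 1 < n) : powOmega 0 n = 0 := by
  have : n.primeFactors.card ≠ 0 := by
    rw [Finset.card_ne_zero]
    exact Nat.nonempty_primeFactors.2 hn
  simp [powOmega, this]

theorem powOmega_mul (a : ℕ) {m n : ℕ} (h : m.Coprime n) :
    powOmega a (m * n) = powOmega a m * powOmega a n := by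
  rw [powOmega, h.primeFactors_mul, card_union_of_disjoint h.disjoint_primeFactors, pow_add,
    powOmega, powOmega]

/-- On squarefree integers the convolution of `a ^ ω` and `b ^ ω` is `(a + b) ^ ω`. -/
theorem sum_powOmega (a b : ℕ) {n : ℕ} (hn : Squarefree n) :
    ∑ p ∈ n.divisorsAntidiagonal, powOmega a p.1 * powOmega b p.2 = powOmega (a + b) n := by
  have h := ArithmeticFunction.IsMultiplicative.prodPrimeFactors_add_of_squarefree
    (ArithmeticFunction.IsMultiplicative.prodPrimeFactors fun _ ↦ (a : ℝ))
    (ArithmeticFunction.IsMultiplicative.prodPrimeFactors fun _ ↦ (b : ℝ)) hn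
  rw [ArithmeticFunction.mul_apply, ArithmeticFunction.prodPrimeFactors_apply hn.ne_zero] at h
  have h1 : ∀ c m : ℕ, m ≠ 0 →
      ArithmeticFunction.prodPrimeFactors (fun _ ↦ (c : ℝ)) m = powOmega c m := by
    intro c m hm
    rw [ArithmeticFunction.prodPrimeFactors_apply hm, prod_const, powOmega]
  have h2 : ∏ p ∈ n.primeFactors, (ArithmeticFunction.prodPrimeFactors (fun _ ↦ (a : ℝ)) +
      ArithmeticFunction.prodPrimeFactors (fun _ ↦ (b : ℝ))) p = powOmega (a + b) n := by
    rw [powOmega, ← prod_const]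
    refine prod_congr rfl fun p hp ↦ ?_
    have hpp := Nat.prime_of_mem_primeFactors hp
    rw [ArithmeticFunction.add_apply, h1 _ _ hpp.ne_zero, h1 _ _ hpp.ne_zero, powOmega, powOmega,
      hpp.primeFactors]
    simp
  rw [← h2, h]
  refine sum_congr rfl fun p hp ↦ ?_
  obtain ⟨hp1, hp2⟩ := Nat.mem_divisorsAntidiagonal.1 hp
  rw [h1 _ _ (by rintro h0; simp [h0] at hp1; exact hp2 hp1.symm),
    h1 _ _ (by rintro h0; simp [h0] at hp1; exact hp2 hp1.symm)]

/-- The squarefree integers in `[1, X]`. -/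
def squarefreeUpTo (X : ℕ) : Finset ℕ := {m ∈ Icc 1 X | Squarefree m}

theorem mem_squarefreeUpTo {X m : ℕ} : m ∈ squarefreeUpTo X ↔ (1 ≤ m ∧ m ≤ X) ∧ Squarefree m := by
  simp [squarefreeUpTo]

/-- The sum `∑ R ^ ω(m) / m` over squarefree `m ≤ X`. -/
noncomputable def squarefreeSum (R X : ℕ) : ℝ := ∑ m ∈ squarefreeUpTo X, powOmega R m / m

theorem squarefreeSum_nonneg (R X : ℕ) : 0 ≤ squarefreeSum R X :=
  sum_nonneg fun _ _ ↦ div_nonneg (powOmega_nonneg _ _) (Nat.cast_nonneg _)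

theorem squarefreeSum_mono (R : ℕ) {X Y : ℕ} (h : X ≤ Y) : squarefreeSum R X ≤ squarefreeSum R Y :=
  sum_le_sum_of_subset_of_nonneg
    (fun m hm ↦ by
      rw [mem_squarefreeUpTo] at hm ⊢
      exact ⟨⟨hm.1.1, hm.1.2.trans h⟩, hm.2⟩)
    fun _ _ _ ↦ div_nonneg (powOmega_nonneg _ _) (Nat.cast_nonneg _)

theorem one_le_squarefreeSum (R : ℕ) {X : ℕ} (hX : 1 ≤ X) : 1 ≤ squarefreeSum R X := by
  have h1 : squarefreeSum R 1 = 1 := by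
    have : squarefreeUpTo 1 = {1} := by
      ext m
      rw [mem_squarefreeUpTo, mem_singleton]
      constructor
      · rintro ⟨⟨h1, h2⟩, -⟩
        lia
      · rintro rfl
        simp
    rw [squarefreeSum, this]
    simp
  exact h1 ▸ squarefreeSum_mono R hX

theorem sum_inv_sq_le_two (X : ℕ) : ∑ s ∈ Icc 1 X, ((s : ℝ) ^ 2)⁻¹ ≤ 2 := by
  have h := sum_Ioo_inv_sq_le (α := ℝ) 0 (X + 1)
  have h2 : Ioo 0 (X + 1) = Icc 1 X := by
    ext
    simp only [mem_Ioo, mem_Icc]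
    lia
  rw [h2] at h
  simpa using h

/-- Each step of the induction splits off a convolution factor, that is a factor `∑ s⁻² ≤ 2`. -/
theorem sum_powOmega_div_sq_le (R X : ℕ) :
    ∑ g ∈ squarefreeUpTo X, powOmega R g / (g : ℝ) ^ 2 ≤ 2 ^ (R + 1) := by
  induction R with
  | zero =>
    calc _ ≤ ∑ g ∈ Icc 1 X, ((g : ℝ) ^ 2)⁻¹ := by
          refine sum_le_sum_of_injOn_of_le id (fun g hg ↦ ?_) (Set.injOn_id _)
            (fun _ _ ↦ by positivity) fun g _ ↦ ?_
          · rw [mem_squarefreeUpTo] at hg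
            exact mem_Icc.2 hg.1
          · rw [div_eq_mul_inv]
            refine mul_le_of_le_one_left (by positivity) ?_
            rw [powOmega]
            exact pow_le_one₀ (by simp) (by simp)
      _ ≤ 2 := sum_inv_sq_le_two X
      _ = 2 ^ (0 + 1) := by norm_num
  | succ R ih =>
    calc ∑ g ∈ squarefreeUpTo X, powOmega (R + 1) g / (g : ℝ) ^ 2
        = ∑ g ∈ squarefreeUpTo X, ∑ p ∈ g.divisorsAntidiagonal,
            powOmega R p.1 / (g : ℝ) ^ 2 := by
          refine sum_congr rfl fun g hg ↦ ?_
          rw [← sum_powOmega R 1 (mem_squarefreeUpTo.1 hg).2, sum_div]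
          simp
      _ = ∑ q ∈ (squarefreeUpTo X).sigma fun g ↦ g.divisorsAntidiagonal,
            powOmega R q.2.1 / (q.1 : ℝ) ^ 2 := by rw [sum_sigma]
      _ ≤ ∑ q ∈ squarefreeUpTo X ×ˢ Icc 1 X,
            powOmega R q.1 / (q.1 : ℝ) ^ 2 * ((q.2 : ℝ) ^ 2)⁻¹ := by
          refine sum_le_sum_of_injOn_of_le (fun q ↦ q.2) ?_ ?_ ?_ ?_
          · rintro ⟨g, a, b⟩ hq
            simp only [mem_sigma, Nat.mem_divisorsAntidiagonal, mem_squarefreeUpTo] at hq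
            obtain ⟨⟨⟨h1, h2⟩, h3⟩, rfl, h4⟩ := hq
            have ha : 0 < a := Nat.pos_of_ne_zero (by rintro rfl; simp at h4)
            have hb : 0 < b := Nat.pos_of_ne_zero (by rintro rfl; simp at h4)
            rw [mem_product, mem_squarefreeUpTo, mem_Icc]
            exact ⟨⟨⟨ha, (Nat.le_mul_of_pos_right a hb).trans h2⟩, h3.of_mul_left⟩, hb,
              (Nat.le_mul_of_pos_left b ha).trans h2⟩
          · rintro ⟨g, a, b⟩ hq ⟨g', a', b'⟩ hq' h
            simp only [coe_sigma, Set.mem_sigma_iff, mem_coe, Nat.mem_divisorsAntidiagonal] at hq hq'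
            obtain ⟨-, rfl, -⟩ := hq
            obtain ⟨-, rfl, -⟩ := hq'
            obtain ⟨rfl, rfl⟩ := Prod.mk.inj h
            rfl
          · intro q _
            have := powOmega_nonneg R q.1
            positivity
          · rintro ⟨g, a, b⟩ hq
            simp only [mem_sigma, Nat.mem_divisorsAntidiagonal] at hq
            obtain ⟨-, rfl, -⟩ := hq
            simp only
            push_cast
            rw [mul_pow, div_mul_eq_mul_div, mul_div_assoc, div_eq_mul_inv, mul_inv]
            rw [div_eq_mul_inv, mul_comm ((b : ℝ) ^ 2)⁻¹]
      _ = (∑ g ∈ squarefreeUpTo X, powOmega R g / (g : ℝ) ^ 2) *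
            ∑ s ∈ Icc 1 X, ((s : ℝ) ^ 2)⁻¹ := by rw [sum_mul_sum, sum_product]
      _ ≤ 2 ^ (R + 1) * 2 := by
          refine mul_le_mul ih (sum_inv_sq_le_two X) ?_ (by positivity)
          exact sum_nonneg fun _ _ ↦ by positivity
      _ = 2 ^ (R + 1 + 1) := by ring

/-- Write `M = g a` and `m = g b` with `g = gcd(M, m)`: the pairs `(a, b)` are coprime, and the sum
over `g` converges. -/
theorem squarefreeSum_mul_le (R X Y : ℕ) :
    squarefreeSum R X * squarefreeSum 1 Y ≤ 2 ^ (R + 1) * squarefreeSum (R + 1) (X * Y) := by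
  calc squarefreeSum R X * squarefreeSum 1 Y
      = ∑ q ∈ squarefreeUpTo X ×ˢ squarefreeUpTo Y,
          powOmega R q.1 / q.1 * (powOmega 1 q.2 / q.2) := by
        rw [squarefreeSum, squarefreeSum, sum_mul_sum, sum_product]
    _ ≤ ∑ q ∈ squarefreeUpTo X ×ˢ ((squarefreeUpTo (X * Y)).sigma fun N ↦ N.divisorsAntidiagonal),
          powOmega R q.1 / (q.1 : ℝ) ^ 2 * (powOmega R q.2.2.1 * powOmega 1 q.2.2.2 / q.2.1) := by
        refine sum_le_sum_of_injOn_of_le (fun q ↦ (q.1.gcd q.2, ⟨q.1 / q.1.gcd q.2 *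
          (q.2 / q.1.gcd q.2), (q.1 / q.1.gcd q.2, q.2 / q.1.gcd q.2)⟩)) ?_ ?_ ?_ ?_
        · rintro ⟨M, m⟩ hq
          simp only [mem_product, mem_squarefreeUpTo] at hq
          obtain ⟨⟨⟨hM1, hM2⟩, hM3⟩, ⟨hm1, hm2⟩, hm3⟩ := hq
          have hg : 0 < M.gcd m := Nat.gcd_pos_of_pos_left m hM1
          have hgM := Nat.gcd_dvd_left M m
          have hgm := Nat.gcd_dvd_right M m
          have ha : 0 < M / M.gcd m := Nat.div_pos (Nat.le_of_dvd hM1 hgM) hg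
          have hb : 0 < m / M.gcd m := Nat.div_pos (Nat.le_of_dvd hm1 hgm) hg
          simp only [mem_product, mem_squarefreeUpTo, mem_sigma, Nat.mem_divisorsAntidiagonal,
            true_and]
          refine ⟨⟨⟨hg, (Nat.le_of_dvd hM1 hgM).trans hM2⟩, hM3.squarefree_of_dvd hgM⟩,
            ⟨⟨Nat.mul_pos ha hb, Nat.mul_le_mul ((Nat.div_le_self _ _).trans hM2)
              ((Nat.div_le_self _ _).trans hm2)⟩, ?_⟩, (Nat.mul_pos ha hb).ne'⟩
          rw [Nat.squarefree_mul (Nat.coprime_div_gcd_div_gcd hg)]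
          exact ⟨hM3.squarefree_of_dvd (Nat.div_dvd_of_dvd hgM),
            hm3.squarefree_of_dvd (Nat.div_dvd_of_dvd hgm)⟩
        · rintro ⟨M, m⟩ hq ⟨M', m'⟩ hq' h
          simp only [Prod.mk.injEq, Sigma.mk.injEq] at h
          obtain ⟨h1, -, h2⟩ := h
          obtain ⟨h2, h3⟩ := Prod.mk.inj (eq_of_heq h2)
          have e1 := Nat.div_mul_cancel (Nat.gcd_dvd_left M m)
          have e2 := Nat.div_mul_cancel (Nat.gcd_dvd_right M m)
          rw [h2, h1, Nat.div_mul_cancel (Nat.gcd_dvd_left M' m')] at e1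
          rw [h3, h1, Nat.div_mul_cancel (Nat.gcd_dvd_right M' m')] at e2
          rw [e1, e2]
        · intro q _
          have := powOmega_nonneg R q.1
          have := powOmega_nonneg R q.2.2.1
          have := powOmega_nonneg 1 q.2.2.2
          positivity
        · rintro ⟨M, m⟩ hq
          simp only [mem_product, mem_squarefreeUpTo] at hq
          obtain ⟨⟨⟨hM1, hM2⟩, hM3⟩, ⟨hm1, hm2⟩, hm3⟩ := hq
          have hg : 0 < M.gcd m := Nat.gcd_pos_of_pos_left m hM1
          obtain ⟨a, ha⟩ := Nat.gcd_dvd_left M m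
          obtain ⟨b, hb⟩ := Nat.gcd_dvd_right M m
          have hga : (M.gcd m).Coprime a := Nat.coprime_of_squarefree_mul (ha ▸ hM3)
          simp only [powOmega_one_left, mul_one]
          set g := M.gcd m with hgdef
          have hda : M / g = a := by rw [ha, Nat.mul_div_cancel_left _ hg]
          have hdb : m / g = b := by rw [hb, Nat.mul_div_cancel_left _ hg]
          rw [hda, hdb, ha, hb, powOmega_mul R hga]
          push_cast
          refine le_of_eq ?_
          field_simp
    _ = (∑ g ∈ squarefreeUpTo X, powOmega R g / (g : ℝ) ^ 2) * squarefreeSum (R + 1) (X * Y) := by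
        rw [sum_product, sum_mul]
        refine sum_congr rfl fun g _ ↦ ?_
        dsimp only
        rw [← mul_sum, sum_sigma, squarefreeSum]
        congr 1
        refine sum_congr rfl fun N hN ↦ ?_
        rw [← sum_powOmega R 1 (mem_squarefreeUpTo.1 hN).2, sum_div]
    _ ≤ _ := by
        gcongr
        · exact squarefreeSum_nonneg _ _
        · exact sum_powOmega_div_sq_le R X

/-- Writing `n = m s²` with `m` squarefree bounds the harmonic sum by `∑ m⁻¹` times `∑ s⁻²`. -/
theorem log_le_squarefreeSum_one (X : ℕ) : Real.log X ≤ 2 * squarefreeSum 1 X := by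
  rcases Nat.eq_zero_or_pos X with rfl | hX
  · simpa using squarefreeSum_nonneg 1 0
  have h0 : Real.log X ≤ Real.log ((X + 1 : ℕ) : ℝ) :=
    Real.log_le_log (by exact_mod_cast hX) (by simp)
  refine h0.trans ((log_add_one_le_harmonic X).trans ?_)
  rw [harmonic_eq_sum_Icc]
  push_cast
  have hex : ∀ n : ℕ, ∃ p : ℕ × ℕ, 0 < n →
      0 < p.1 ∧ 0 < p.2 ∧ p.2 ^ 2 * p.1 = n ∧ Squarefree p.1 := by
    intro n
    rcases Nat.eq_zero_or_pos n with rfl | hn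
    · exact ⟨0, by simp⟩
    · obtain ⟨a, b, h⟩ := Nat.sq_mul_squarefree_of_pos hn
      exact ⟨(a, b), fun _ ↦ h⟩
  choose e he using hex
  calc ∑ n ∈ Icc 1 X, (n : ℝ)⁻¹
      ≤ ∑ q ∈ squarefreeUpTo X ×ˢ Icc 1 X, powOmega 1 q.1 / (q.1 : ℝ) * ((q.2 : ℝ) ^ 2)⁻¹ := by
        refine sum_le_sum_of_injOn_of_le e ?_ ?_ ?_ ?_
        · intro n hn
          obtain ⟨hn1, hn2⟩ := mem_Icc.1 hn
          obtain ⟨h1, h2, h3, h4⟩ := he n hn1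
          rw [mem_product, mem_squarefreeUpTo, mem_Icc]
          refine ⟨⟨⟨h1, ?_⟩, h4⟩, h2, ?_⟩
          · exact (Nat.le_of_dvd hn1 (Dvd.intro_left _ h3)).trans hn2
          · refine le_trans ?_ hn2
            conv_rhs => rw [← h3]
            exact (Nat.le_self_pow two_ne_zero _).trans (Nat.le_mul_of_pos_right _ h1)
        · intro n hn m hm h
          have h1 := (he n (mem_Icc.1 hn).1).2.2.1
          have h2 := (he m (mem_Icc.1 hm).1).2.2.1
          rw [← h1, ← h2, h]
        · intro q _
          have := powOmega_nonneg 1 q.1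
          positivity
        · intro n hn
          have h1 := (he n (mem_Icc.1 hn).1).2.2.1
          refine le_of_eq ?_
          rw [powOmega_one_left, one_div, ← mul_inv]
          congr 1
          conv_lhs => rw [← h1]
          push_cast
          ring
    _ = squarefreeSum 1 X * ∑ s ∈ Icc 1 X, ((s : ℝ) ^ 2)⁻¹ := by
        rw [squarefreeSum, sum_mul_sum, sum_product]
    _ ≤ squarefreeSum 1 X * 2 := by
        gcongr
        · exact squarefreeSum_nonneg _ _
        · exact sum_inv_sq_le_two X
    _ = _ := mul_comm _ _

/-- A lower bound of the right order `(log X) ^ R` for the sum of `R ^ ω(m) / m`; replacing `X` by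
`X ^ R` only costs a constant factor and allows an induction on `R`. -/
theorem exists_mul_log_pow_le_squarefreeSum (R : ℕ) :
    ∃ c : ℝ, 0 < c ∧ ∀ X : ℕ, c * Real.log X ^ R ≤ squarefreeSum R (X ^ R) := by
  induction R with
  | zero => exact ⟨1, one_pos, fun X ↦ by simpa using one_le_squarefreeSum 0 le_rfl⟩
  | succ R ih =>
    obtain ⟨c, hc, h⟩ := ih
    refine ⟨c / 2 ^ (R + 2), by positivity, fun X ↦ ?_⟩
    have h1 := squarefreeSum_mul_le R (X ^ R) X
    have h2 := log_le_squarefreeSum_one X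
    have h3 : 0 ≤ Real.log X := Real.log_natCast_nonneg X
    have h4 : c * Real.log X ^ R * Real.log X ≤
        squarefreeSum R (X ^ R) * (2 * squarefreeSum 1 X) :=
      mul_le_mul (h X) h2 h3 (squarefreeSum_nonneg _ _)
    rw [pow_succ X R, div_mul_eq_mul_div, div_le_iff₀ (by positivity)]
    calc c * Real.log X ^ (R + 1) = c * Real.log X ^ R * Real.log X := by ring
      _ ≤ 2 * (squarefreeSum R (X ^ R) * squarefreeSum 1 X) := by linarith
      _ ≤ 2 * (2 ^ (R + 1) * squarefreeSum (R + 1) (X ^ R * X)) := by linarith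
      _ = _ := by ring

end HeckeMoment

namespace HeckeMoment

open Finset

/-! ### Powers of a short Dirichlet polynomial -/

/-- The Dirichlet polynomial `∑ λ(m) / √m` over squarefree `m ≤ X`. -/
noncomputable def dirichletPoly (X : ℕ) (lam : ℕ → ℝ) : ℝ :=
  ∑ m ∈ squarefreeUpTo X, (√m)⁻¹ * lam m

/-- The triples `(m, l, d)` with `m ≤ X` squarefree, `l ≤ X ^ (j + 1)` and `d ∣ (m, l)`, which index
the expansion of `λ(m) λ(l)` by Hecke's multiplication rule. -/
def heckeTriples (X j : ℕ) : Finset (ℕ × ℕ × ℕ) :=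
  {q ∈ squarefreeUpTo X ×ˢ Icc 1 (X ^ (j + 1)) ×ˢ Icc 1 X | q.2.2 ∣ q.1 ∧ q.2.2 ∣ q.2.1}

/-- The coefficients of the expansion `A ^ j = ∑ b_n λ(n)` of the powers of
`A = ∑ λ(m) / √m` (squarefree `m ≤ X`) into a linear combination of Hecke eigenvalues. -/
noncomputable def powCoeff (X : ℕ) : ℕ → ℕ → ℝ
  | 0, n => if n = 1 then 1 else 0
  | j + 1, n => ∑ q ∈ heckeTriples X j with q.1 / q.2.2 * (q.2.1 / q.2.2) = n,
      (√q.1)⁻¹ * powCoeff X j q.2.1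

theorem mem_heckeTriples {X j m l d : ℕ} : (m, l, d) ∈ heckeTriples X j ↔
    ((1 ≤ m ∧ m ≤ X) ∧ Squarefree m) ∧ (1 ≤ l ∧ l ≤ X ^ (j + 1)) ∧ d ∣ m ∧ d ∣ l := by
  simp only [heckeTriples, mem_filter, mem_product, mem_squarefreeUpTo, mem_Icc]
  constructor
  · rintro ⟨⟨h1, h2, -⟩, h3⟩
    exact ⟨h1, h2, h3⟩
  · rintro ⟨h1, h2, h3⟩
    exact ⟨⟨h1, h2, Nat.pos_of_dvd_of_pos h3.1 h1.1.1, (Nat.le_of_dvd h1.1.1 h3.1).trans h1.1.2⟩,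
      h3⟩

theorem powCoeff_nonneg (X j n : ℕ) : 0 ≤ powCoeff X j n := by
  induction j generalizing n with
  | zero =>
    rw [powCoeff]
    split_ifs <;> norm_num
  | succ j ih =>
    rw [powCoeff]
    exact sum_nonneg fun q _ ↦ mul_nonneg (by positivity) (ih _)

theorem sum_heckeTriples (X j : ℕ) (F : ℕ × ℕ × ℕ → ℝ) :
    ∑ q ∈ heckeTriples X j, F q =
      ∑ m ∈ squarefreeUpTo X, ∑ l ∈ Icc 1 (X ^ (j + 1)), ∑ d ∈ (m.gcd l).divisors, F (m, l, d) := by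
  rw [heckeTriples, sum_filter, sum_product]
  refine sum_congr rfl fun m hm ↦ ?_
  rw [sum_product]
  refine sum_congr rfl fun l hl ↦ ?_
  rw [← sum_filter]
  refine sum_congr ?_ fun _ _ ↦ rfl
  rw [mem_squarefreeUpTo] at hm
  ext d
  simp only [mem_filter, mem_Icc, Nat.mem_divisors, Nat.dvd_gcd_iff]
  have hg : m.gcd l ≠ 0 := (Nat.gcd_pos_of_pos_left l hm.1.1).ne'
  constructor
  · rintro ⟨-, h⟩
    exact ⟨h, hg⟩
  · rintro ⟨h, -⟩
    exact ⟨⟨Nat.pos_of_dvd_of_pos h.1 hm.1.1, (Nat.le_of_dvd hm.1.1 h.1).trans hm.1.2⟩, h⟩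

/-- Pairing the coefficients of `A ^ (j + 1)` with an arbitrary sequence. -/
theorem sum_powCoeff_succ_mul (X j : ℕ) (g : ℕ → ℝ) :
    ∑ n ∈ Icc 1 (X ^ (j + 2)), powCoeff X (j + 1) n * g n =
      ∑ m ∈ squarefreeUpTo X, ∑ l ∈ Icc 1 (X ^ (j + 1)),
        (√m)⁻¹ * powCoeff X j l * ∑ d ∈ (m.gcd l).divisors, g (m / d * (l / d)) := by
  simp_rw [mul_sum]
  rw [← sum_heckeTriples X j fun q ↦
    (√q.1)⁻¹ * powCoeff X j q.2.1 * g (q.1 / q.2.2 * (q.2.1 / q.2.2))]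
  rw [← sum_fiberwise_of_maps_to (t := Icc 1 (X ^ (j + 2)))
    (g := fun q : ℕ × ℕ × ℕ ↦ q.1 / q.2.2 * (q.2.1 / q.2.2))]
  · refine sum_congr rfl fun n _ ↦ ?_
    rw [powCoeff, sum_mul]
    refine sum_congr rfl fun q hq ↦ ?_
    rw [(mem_filter.1 hq).2]
  · rintro ⟨m, l, d⟩ hq
    obtain ⟨⟨⟨h1, h2⟩, -⟩, ⟨h3, h4⟩, h5, h6⟩ := mem_heckeTriples.1 hq
    have hd := Nat.pos_of_dvd_of_pos h5 h1
    rw [mem_Icc]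
    refine ⟨Nat.mul_pos (Nat.div_pos (Nat.le_of_dvd h1 h5) hd)
      (Nat.div_pos (Nat.le_of_dvd h3 h6) hd), ?_⟩
    calc m / d * (l / d) ≤ X * X ^ (j + 1) :=
          Nat.mul_le_mul ((Nat.div_le_self _ _).trans h2) ((Nat.div_le_self _ _).trans h4)
      _ = X ^ (j + 2) := by ring

/-- Hecke's multiplication rule linearises the powers of the Dirichlet polynomial. -/
theorem dirichletPoly_pow {X : ℕ} (hX : 1 ≤ X) {lam : ℕ → ℝ} (h1 : lam 1 = 1)
    (hmul : ∀ m n, 0 < m → 0 < n →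
      lam m * lam n = ∑ d ∈ (m.gcd n).divisors, lam (m / d * (n / d))) (j : ℕ) :
    dirichletPoly X lam ^ j = ∑ n ∈ Icc 1 (X ^ (j + 1)), powCoeff X j n * lam n := by
  induction j with
  | zero =>
    rw [pow_zero, sum_eq_single 1]
    · simp [powCoeff, h1]
    · intro n _ hn
      simp [powCoeff, hn]
    · intro h
      exact absurd (mem_Icc.2 ⟨le_rfl, by simpa using hX⟩) h
  | succ j ih =>
    rw [sum_powCoeff_succ_mul, pow_succ', ih, dirichletPoly, sum_mul_sum]
    refine sum_congr rfl fun m hm ↦ sum_congr rfl fun l hl ↦ ?_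
    rw [← hmul m l (mem_squarefreeUpTo.1 hm).1.1 (mem_Icc.1 hl).1]
    ring

theorem sum_powCoeff_le {X : ℕ} (hX : 1 ≤ X) (j : ℕ) :
    ∑ n ∈ Icc 1 (X ^ (j + 1)), powCoeff X j n ≤ (X : ℝ) ^ (2 * j) := by
  induction j with
  | zero =>
    rw [sum_eq_single 1]
    · simp [powCoeff]
    · intro n _ hn
      simp [powCoeff, hn]
    · intro h
      exact absurd (mem_Icc.2 ⟨le_rfl, by simpa using hX⟩) h
  | succ j ih =>
    have h := sum_powCoeff_succ_mul X j fun _ ↦ 1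
    simp only [mul_one, sum_const, nsmul_eq_mul] at h
    rw [h]
    have hS : 0 ≤ ∑ l ∈ Icc 1 (X ^ (j + 1)), powCoeff X j l :=
      sum_nonneg fun _ _ ↦ powCoeff_nonneg _ _ _
    calc _ ≤ ∑ m ∈ squarefreeUpTo X, ∑ l ∈ Icc 1 (X ^ (j + 1)), powCoeff X j l * X := by
          refine sum_le_sum fun m hm ↦ sum_le_sum fun l hl ↦ ?_
          obtain ⟨⟨hm1, hm2⟩, -⟩ := mem_squarefreeUpTo.1 hm
          have e1 : (√m)⁻¹ ≤ 1 :=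
            inv_le_one_of_one_le₀ (Real.one_le_sqrt.2 (by exact_mod_cast hm1))
          have e2 : ((m.gcd l).divisors.card : ℝ) ≤ X := by
            exact_mod_cast (Nat.card_divisors_le_self _).trans
              ((Nat.le_of_dvd hm1 (Nat.gcd_dvd_left m l)).trans hm2)
          have e3 := powCoeff_nonneg X j l
          gcongr
          exact mul_le_of_le_one_left e3 e1
      _ = (squarefreeUpTo X).card * ((∑ l ∈ Icc 1 (X ^ (j + 1)), powCoeff X j l) * X) := by
          rw [sum_const, nsmul_eq_mul, sum_mul]
      _ ≤ X * ((X : ℝ) ^ (2 * j) * X) := by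
          have hc : ((squarefreeUpTo X).card : ℝ) ≤ X := by
            have := card_filter_le (Icc 1 X) Squarefree
            rw [Nat.card_Icc, Nat.add_sub_cancel] at this
            exact_mod_cast this
          gcongr
      _ = (X : ℝ) ^ (2 * (j + 1)) := by ring

/-- In Hecke's rule for `λ(m) λ(l)` the term `λ(1)` occurs only for `m = l = d`. The left side is thus
the part of the right side with `n ≤ X` squarefree. -/
theorem powCoeff_succ_one_le (X j : ℕ) :
    powCoeff X (j + 1) 1 ≤ ∑ n ∈ Icc 1 (X ^ (j + 1)), powCoeff X j n / √n := by
  rw [powCoeff]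
  refine sum_le_sum_of_injOn_of_le (fun q ↦ q.2.1) ?_ ?_ ?_ ?_
  · rintro ⟨m, l, d⟩ hq
    obtain ⟨-, ⟨h3, h4⟩, -⟩ := mem_heckeTriples.1 (mem_filter.1 hq).1
    exact mem_Icc.2 ⟨h3, h4⟩
  · have key : ∀ q ∈ ({q ∈ heckeTriples X j | q.1 / q.2.2 * (q.2.1 / q.2.2) = 1} : Finset _),
        q = (q.2.1, q.2.1, q.2.1) := by
      rintro ⟨m, l, d⟩ hq
      obtain ⟨hq1, hq2⟩ := mem_filter.1 hq
      obtain ⟨-, -, h5, h6⟩ := mem_heckeTriples.1 hq1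
      obtain ⟨h7, h8⟩ := mul_eq_one.1 hq2
      have e1 := Nat.eq_of_dvd_of_div_eq_one h5 h7
      have e2 := Nat.eq_of_dvd_of_div_eq_one h6 h8
      rw [← e1, ← e2]
    intro q hq q' hq' h
    rw [key q hq, key q' hq']
    simp only at h
    rw [h]
  · intro n _
    have := powCoeff_nonneg X j n
    positivity
  · rintro ⟨m, l, d⟩ hq
    obtain ⟨hq1, hq2⟩ := mem_filter.1 hq
    obtain ⟨-, -, h5, h6⟩ := mem_heckeTriples.1 hq1
    obtain ⟨h7, h8⟩ := mul_eq_one.1 hq2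
    have e1 := Nat.eq_of_dvd_of_div_eq_one h5 h7
    have e2 := Nat.eq_of_dvd_of_div_eq_one h6 h8
    subst e1
    subst e2
    simp only
    rw [div_eq_mul_inv, mul_comm]

/-- The squarefree `M` prime to `n` with `n M ≤ X`. -/
def cofactors (X n : ℕ) : Finset ℕ := {M ∈ squarefreeUpTo X | M.Coprime n ∧ n * M ≤ X}

theorem mem_cofactors {X n M : ℕ} (hn : 0 < n) :
    M ∈ cofactors X n ↔ 1 ≤ M ∧ Squarefree M ∧ M.Coprime n ∧ n * M ≤ X := by
  rw [cofactors, mem_filter, mem_squarefreeUpTo]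
  constructor
  · rintro ⟨⟨⟨h1, h2⟩, h3⟩, h4⟩
    exact ⟨h1, h3, h4⟩
  · rintro ⟨h1, h2, h3, h4⟩
    exact ⟨⟨⟨h1, (Nat.le_mul_of_pos_left M hn).trans h4⟩, h2⟩, h3, h4⟩

/-- Keeping only the terms `d = gcd(m, l)` in Hecke's multiplication rule. -/
theorem sum_le_powCoeff_succ {X n : ℕ} (j : ℕ) (hn : Squarefree n) :
    ∑ u ∈ n.divisors, ∑ d ∈ cofactors X n, (√(d * u : ℕ))⁻¹ * powCoeff X j (d * (n / u)) ≤
      powCoeff X (j + 1) n := by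
  have hn0 : 0 < n := Nat.pos_of_ne_zero hn.ne_zero
  rw [powCoeff, ← sum_product']
  refine sum_le_sum_of_injOn_of_le (fun q : ℕ × ℕ ↦ (q.2 * q.1, q.2 * (n / q.1), q.2)) ?_ ?_ ?_ ?_
  · rintro ⟨u, d⟩ hq
    obtain ⟨hu, hd⟩ := mem_product.1 hq
    obtain ⟨⟨v, hv⟩, -⟩ := Nat.mem_divisors.1 hu
    obtain ⟨hd1, hd2, hd3, hd4⟩ := (mem_cofactors hn0).1 hd
    simp only at hv hd1 hd2 hd3 hd4
    have hu0 : 0 < u := Nat.pos_of_ne_zero (by rintro rfl; lia)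
    have hv0 : 0 < v := Nat.pos_of_ne_zero (by rintro rfl; lia)
    have hnu : n / u = v := by rw [hv, Nat.mul_div_cancel_left _ hu0]
    have hX : 0 < X := lt_of_lt_of_le (Nat.mul_pos hn0 hd1) hd4
    simp only [hnu]
    rw [mem_filter, mem_heckeTriples]
    refine ⟨⟨⟨⟨Nat.mul_pos hd1 hu0, ?_⟩, ?_⟩, ⟨Nat.mul_pos hd1 hv0, ?_⟩, Nat.dvd_mul_right _ _,
      Nat.dvd_mul_right _ _⟩, ?_⟩
    · refine le_trans ?_ hd4
      rw [mul_comm]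
      exact Nat.mul_le_mul_right _ (Nat.le_of_dvd hn0 ⟨v, hv⟩)
    · rw [Nat.squarefree_mul (hd3.coprime_dvd_right ⟨v, hv⟩)]
      exact ⟨hd2, hn.squarefree_of_dvd ⟨v, hv⟩⟩
    · refine le_trans ?_ (hd4.trans (Nat.le_self_pow (by lia) X))
      rw [mul_comm]
      exact Nat.mul_le_mul_right _ (Nat.le_of_dvd hn0 (Dvd.intro_left u hv.symm))
    · simp only
      rw [Nat.mul_div_cancel_left _ hd1, Nat.mul_div_cancel_left _ hd1, hv]
  · rintro ⟨u, d⟩ hq ⟨u', d'⟩ hq' h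
    obtain ⟨-, hd⟩ := mem_product.1 (mem_coe.1 hq)
    have hd1 := ((mem_cofactors hn0).1 hd).1
    simp only [Prod.mk.injEq] at h
    obtain ⟨h1, -, h3⟩ := h
    subst h3
    rw [Nat.eq_of_mul_eq_mul_left hd1 h1]
  · intro q _
    exact mul_nonneg (by positivity) (powCoeff_nonneg _ _ _)
  · rintro ⟨u, d⟩ _
    exact le_rfl

/-- Splitting a squarefree integer `N` prime to `n` as a product `d M`. -/
theorem sum_cofactors_mul (X a b : ℕ) {n : ℕ} (hn : 0 < n) :
    ∑ d ∈ cofactors X n, powOmega a d / d * ∑ M ∈ cofactors X (n * d), powOmega b M / M =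
      ∑ N ∈ cofactors X n, powOmega (a + b) N / N := by
  simp_rw [mul_sum]
  rw [sum_sigma']
  have h : ∀ N ∈ cofactors X n, powOmega (a + b) N / (N : ℝ) =
      ∑ p ∈ N.divisorsAntidiagonal, powOmega a p.1 / p.1 * (powOmega b p.2 / p.2) := by
    intro N hN
    obtain ⟨-, hN2, -⟩ := (mem_cofactors hn).1 hN
    rw [← sum_powOmega a b hN2, sum_div]
    refine sum_congr rfl fun p hp ↦ ?_
    obtain ⟨hp, -⟩ := Nat.mem_divisorsAntidiagonal.1 hp
    rw [div_mul_div_comm, ← hp]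
    push_cast
    rfl
  rw [sum_congr rfl h, sum_sigma']
  refine sum_bij' (fun q _ ↦ ⟨q.1 * q.2, (q.1, q.2)⟩) (fun q _ ↦ ⟨q.2.1, q.2.2⟩) ?_ ?_ ?_ ?_ ?_
  · rintro ⟨d, M⟩ hq
    simp only [mem_sigma] at hq ⊢
    obtain ⟨hd, hM⟩ := hq
    obtain ⟨hd1, hd2, hd3, hd4⟩ := (mem_cofactors hn).1 hd
    obtain ⟨hM1, hM2, hM3, hM4⟩ := (mem_cofactors (Nat.mul_pos hn hd1)).1 hM
    refine ⟨(mem_cofactors hn).2 ⟨Nat.mul_pos hd1 hM1, ?_, ?_, by rwa [← mul_assoc]⟩, ?_⟩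
    · rw [Nat.squarefree_mul (Nat.Coprime.coprime_mul_left_right hM3).symm]
      exact ⟨hd2, hM2⟩
    · exact Nat.Coprime.mul_left hd3 (Nat.Coprime.coprime_mul_right_right hM3)
    · exact Nat.mem_divisorsAntidiagonal.2 ⟨rfl, (Nat.mul_pos hd1 hM1).ne'⟩
  · rintro ⟨N, d, M⟩ hq
    simp only [mem_sigma, Nat.mem_divisorsAntidiagonal] at hq ⊢
    obtain ⟨hN, rfl, h0⟩ := hq
    obtain ⟨hN1, hN2, hN3, hN4⟩ := (mem_cofactors hn).1 hN
    have hd : 0 < d := Nat.pos_of_ne_zero (by rintro rfl; simp at h0)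
    have hM : 0 < M := Nat.pos_of_ne_zero (by rintro rfl; simp at h0)
    refine ⟨(mem_cofactors hn).2 ⟨hd, hN2.of_mul_left, hN3.coprime_mul_right, ?_⟩,
      (mem_cofactors (Nat.mul_pos hn hd)).2 ⟨hM, hN2.of_mul_right, ?_, by rwa [mul_assoc]⟩⟩
    · exact le_trans (Nat.mul_le_mul_left n (Nat.le_mul_of_pos_right d hM)) hN4
    · exact Nat.Coprime.mul_right hN3.coprime_mul_left (Nat.coprime_of_squarefree_mul hN2).symm
  · rintro ⟨d, M⟩ _
    rfl
  · rintro ⟨N, d, M⟩ hq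
    simp only [mem_sigma, Nat.mem_divisorsAntidiagonal] at hq
    obtain ⟨-, rfl, -⟩ := hq
    rfl
  · rintro ⟨d, M⟩ _
    rfl

/-- A lower bound for the coefficients of `A ^ j` at squarefree `n = u v`, by induction on `j`: the
term `λ(d u) λ(d v)` of `A * A ^ j` contributes to `λ(n)`, the inductive bound at `d v` supplies
`j ^ ω(v) j ^ ω(d)`, the sum over `u v = n` turns `j ^ ω(v)` into `(j + 1) ^ ω(n)`, and the sum over
`d` turns `j choose 2` into `j + j choose 2 = (j + 1) choose 2`. -/
theorem powOmega_mul_sum_le {X : ℕ} (j : ℕ) {n : ℕ} (hn : Squarefree n) :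
    powOmega j n * ∑ M ∈ cofactors X n, powOmega (j.choose 2) M / M ≤ powCoeff X j n * √n := by
  induction j generalizing n with
  | zero =>
    have hn0 : 0 < n := Nat.pos_of_ne_zero hn.ne_zero
    rcases Nat.lt_or_ge 1 n with h | h
    · rw [powOmega_zero_of_one_lt h, zero_mul]
      exact mul_nonneg (powCoeff_nonneg _ _ _) (Real.sqrt_nonneg _)
    · obtain rfl : n = 1 := by lia
      calc _ ≤ ∑ M ∈ cofactors X 1, if M = 1 then (1 : ℝ) else 0 := by
            rw [powOmega_one_right, one_mul]
            refine sum_le_sum fun M hM ↦ ?_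
            split_ifs with h1
            · simp [h1]
            · have := ((mem_cofactors one_pos).1 hM).1
              rw [Nat.choose_eq_zero_of_lt (by norm_num), powOmega_zero_of_one_lt (by lia), zero_div]
        _ ≤ 1 := by
            rw [sum_ite_eq']
            split_ifs <;> norm_num
        _ = _ := by simp [powCoeff]
  | succ j ih =>
    have hn0 : 0 < n := Nat.pos_of_ne_zero hn.ne_zero
    have hterm : ∀ u ∈ n.divisors, ∀ d ∈ cofactors X n,
        powOmega j (n / u) * (powOmega j d / d *
          ∑ M ∈ cofactors X (n * d), powOmega (j.choose 2) M / M) ≤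
        (√(d * u : ℕ))⁻¹ * powCoeff X j (d * (n / u)) * √n := by
      intro u hu d hd
      obtain ⟨⟨v, hv⟩, -⟩ := Nat.mem_divisors.1 hu
      obtain ⟨hd1, hd2, hd3, hd4⟩ := (mem_cofactors hn0).1 hd
      have hu0 : 0 < u := Nat.pos_of_ne_zero (by rintro rfl; lia)
      have hv0 : 0 < v := Nat.pos_of_ne_zero (by rintro rfl; lia)
      have hnu : n / u = v := by rw [hv, Nat.mul_div_cancel_left _ hu0]
      have hvn : v ∣ n := Dvd.intro_left u hv.symm
      rw [hnu]
      have hdv : d.Coprime v := hd3.coprime_dvd_right hvn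
      have hsq : Squarefree (d * v) :=
        (Nat.squarefree_mul hdv).2 ⟨hd2, hn.squarefree_of_dvd hvn⟩
      have h1 := ih hsq
      rw [powOmega_mul j hdv] at h1
      have hsub : cofactors X (n * d) ⊆ cofactors X (d * v) := by
        intro M hM
        obtain ⟨e1, e2, e3, e4⟩ := (mem_cofactors (Nat.mul_pos hn0 hd1)).1 hM
        refine (mem_cofactors (Nat.mul_pos hd1 hv0)).2 ⟨e1, e2, ?_, ?_⟩
        · exact Nat.Coprime.coprime_dvd_right (by rw [mul_comm]; exact Nat.mul_dvd_mul_right hvn d) e3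
        · refine le_trans (Nat.mul_le_mul_right M ?_) e4
          rw [mul_comm]
          exact Nat.mul_le_mul_right d (Nat.le_of_dvd hn0 hvn)
      have h2 : ∑ M ∈ cofactors X (n * d), powOmega (j.choose 2) M / (M : ℝ) ≤
          ∑ M ∈ cofactors X (d * v), powOmega (j.choose 2) M / (M : ℝ) :=
        sum_le_sum_of_subset_of_nonneg hsub fun M _ _ ↦
          div_nonneg (powOmega_nonneg _ _) (Nat.cast_nonneg _)
      have hd0 : (0 : ℝ) < d := by exact_mod_cast hd1
      have hu0' : (0 : ℝ) < u := by exact_mod_cast hu0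
      have hv0' : (0 : ℝ) < v := by exact_mod_cast hv0
      have hs : (√(d * u : ℕ))⁻¹ * √n = √(d * v : ℕ) / d := by
        rw [hv]
        push_cast
        rw [Real.sqrt_mul hd0.le, Real.sqrt_mul hu0'.le, Real.sqrt_mul hd0.le]
        have e1 : √(d : ℝ) ≠ 0 := (Real.sqrt_pos.2 hd0).ne'
        have e2 : √(u : ℝ) ≠ 0 := (Real.sqrt_pos.2 hu0').ne'
        field_simp
        rw [Real.sq_sqrt hd0.le]
      have ha := powOmega_nonneg j v
      have hb := powOmega_nonneg j d
      calc _ ≤ powOmega j v * (powOmega j d / d *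
            ∑ M ∈ cofactors X (d * v), powOmega (j.choose 2) M / M) := by gcongr
        _ = powOmega j d * powOmega j v *
            (∑ M ∈ cofactors X (d * v), powOmega (j.choose 2) M / M) / d := by ring
        _ ≤ powCoeff X j (d * v) * √(d * v : ℕ) / d := by gcongr
        _ = powCoeff X j (d * v) * (√(d * v : ℕ) / d) := by ring
        _ = _ := by
          rw [← hs]
          ring
    have hdiv : ∑ u ∈ n.divisors, powOmega j (n / u) = powOmega (j + 1) n := by
      rw [← sum_powOmega j 1 hn, Nat.sum_div_divisors n (powOmega j),
        Nat.sum_divisorsAntidiagonal (fun a b ↦ powOmega j a * powOmega 1 b)]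
      simp
    have hch : (j + 1).choose 2 = j + j.choose 2 := by
      rw [Nat.choose_succ_succ' j 1, Nat.choose_one_right]
    calc powOmega (j + 1) n * ∑ M ∈ cofactors X n, powOmega ((j + 1).choose 2) M / M
        = ∑ u ∈ n.divisors, ∑ d ∈ cofactors X n, powOmega j (n / u) * (powOmega j d / d *
          ∑ M ∈ cofactors X (n * d), powOmega (j.choose 2) M / M) := by
          rw [← hdiv, hch, ← sum_cofactors_mul X j (j.choose 2) hn0, sum_mul_sum]
      _ ≤ ∑ u ∈ n.divisors, ∑ d ∈ cofactors X n,
          (√(d * u : ℕ))⁻¹ * powCoeff X j (d * (n / u)) * √n :=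
        sum_le_sum fun u hu ↦ sum_le_sum fun d hd ↦ hterm u hu d hd
      _ = (∑ u ∈ n.divisors, ∑ d ∈ cofactors X n,
          (√(d * u : ℕ))⁻¹ * powCoeff X j (d * (n / u))) * √n := by
        simp_rw [sum_mul]
      _ ≤ _ := by
        gcongr
        exact sum_le_powCoeff_succ j hn

/-- The diagonal coefficient is at least of order `(log X) ^ (j (j - 1) / 2)`. -/
theorem squarefreeSum_le_powCoeff_one (X j : ℕ) :
    squarefreeSum (j.choose 2) X ≤ powCoeff X j 1 := by
  have h := powOmega_mul_sum_le (X := X) j squarefree_one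
  have : cofactors X 1 = squarefreeUpTo X := by
    ext M
    rw [mem_cofactors one_pos, mem_squarefreeUpTo]
    simp
    tauto
  rw [this] at h
  simpa [squarefreeSum] using h

end HeckeMoment

namespace HeckeMoment

open Finset Filter Topology

/-! ### The lower bound in terms of the diagonal coefficient -/

variable {k : ℕ}

theorem mem_toFinset_heckeEigenforms {f : CuspForm 𝒮ℒ (k : ℤ)} :
    f ∈ (finite_heckeEigenforms (k := k)).toFinset ↔ f ∈ heckeEigenforms k := by simp

theorem inv_harmonicWeight_pos (hk : 2 ≤ k) {f : CuspForm 𝒮ℒ (k : ℤ)}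
    (hf : f ∈ heckeEigenforms k) : 0 < (harmonicWeight f)⁻¹ :=
  inv_pos.2 (harmonicWeight_pos hk (ne_zero_of_mem hf))

theorem eigenvalue_one {f : CuspForm 𝒮ℒ (k : ℤ)} (hf : f ∈ heckeEigenforms k) :
    eigenvalue f 1 = 1 := by
  rw [eigenvalue, fourierCoeff_one_of_mem hf]
  simp

theorem harmonicAverage_mono (hk : 2 ≤ k) {φ ψ : CuspForm 𝒮ℒ (k : ℤ) → ℝ}
    (h : ∀ f ∈ heckeEigenforms k, φ f ≤ ψ f) : harmonicAverage k φ ≤ harmonicAverage k ψ := by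
  refine sum_le_sum fun f hf ↦ ?_
  have hf' := mem_toFinset_heckeEigenforms.1 hf
  exact mul_le_mul_of_nonneg_left (h f hf') (inv_harmonicWeight_pos hk hf').le

theorem harmonicAverage_congr {φ ψ : CuspForm 𝒮ℒ (k : ℤ) → ℝ}
    (h : ∀ f ∈ heckeEigenforms k, φ f = ψ f) : harmonicAverage k φ = harmonicAverage k ψ :=
  sum_congr rfl fun f hf ↦ by rw [h f (mem_toFinset_heckeEigenforms.1 hf)]

theorem harmonicAverage_sub (a b : ℝ) (φ ψ : CuspForm 𝒮ℒ (k : ℤ) → ℝ) :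
    harmonicAverage k (fun f ↦ a * φ f - b * ψ f) =
      a * harmonicAverage k φ - b * harmonicAverage k ψ := by
  simp only [harmonicAverage, mul_sum, ← sum_sub_distrib]
  exact sum_congr rfl fun f _ ↦ by ring

theorem harmonicAverage_sum {ι : Type*} (s : Finset ι) (b : ι → ℝ)
    (φ : ι → CuspForm 𝒮ℒ (k : ℤ) → ℝ) :
    harmonicAverage k (fun f ↦ ∑ i ∈ s, b i * φ i f) = ∑ i ∈ s, b i * harmonicAverage k (φ i) := by
  simp only [harmonicAverage, mul_sum]
  rw [sum_comm]
  exact sum_congr rfl fun _ _ ↦ sum_congr rfl fun f _ ↦ by ring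

/-- The graph of `t ↦ t ^ r` with `r` even lies above its tangent at `a`. -/
theorem tangent_le_pow {r : ℕ} (hr : 0 < r) (hr2 : Even r) (t a : ℝ) :
    r * (t * a ^ (r - 1)) - (r - 1) * a ^ r ≤ t ^ r := by
  obtain ⟨n, rfl⟩ : ∃ n, r = n + 1 := ⟨r - 1, by lia⟩
  rcases eq_or_ne a 0 with rfl | ha
  · have hn : n ≠ 0 := by rintro rfl; simp at hr2
    simp [hn, hr2.pow_nonneg]
  · have key : ∀ x : ℝ, 1 + (n + 1 : ℕ) * x ≤ (1 + x) ^ (n + 1) := by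
      intro x
      rcases le_or_gt (-2) x with hx | hx
      · exact one_add_mul_le_pow hx _
      · refine le_trans ?_ (hr2.pow_nonneg _)
        push_cast
        nlinarith [(Nat.cast_nonneg n : (0 : ℝ) ≤ n)]
    have h := mul_le_mul_of_nonneg_left (key (t / a - 1)) (hr2.pow_nonneg a)
    rw [← mul_pow, add_sub_cancel, mul_div_cancel₀ _ ha] at h
    refine le_trans (le_of_eq ?_) h
    rw [Nat.add_sub_cancel, pow_succ]
    field_simp
    push_cast
    ring

theorem dirichletPoly_eigenvalue_pow {X : ℕ} (hX : 1 ≤ X) {f : CuspForm 𝒮ℒ (k : ℤ)}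
    (hf : f ∈ heckeEigenforms k) (j : ℕ) :
    dirichletPoly X (eigenvalue f) ^ j =
      ∑ n ∈ Icc 1 (X ^ (j + 1)), powCoeff X j n * eigenvalue f n :=
  dirichletPoly_pow hX (eigenvalue_one hf) (fun _ _ hm hn ↦ eigenvalue_mul hf hm hn) j

/-- The averages of the powers of the Dirichlet polynomial are given by the coefficient of `λ(1)`,
up to the error in the trace formula. -/
theorem harmonicAverage_dirichletPoly_pow_le (hk : 12 ≤ k) (hk2 : Even (k : ℤ)) {X : ℕ}
    (hX : 1 ≤ X) (j : ℕ) :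
    harmonicAverage k (fun f ↦ dirichletPoly X (eigenvalue f) ^ j) ≤ powCoeff X j 1 +
      256 * coprimeConst * (2 : ℝ)⁻¹ ^ k * Real.exp (4 * Real.pi * (X : ℝ) ^ (j + 1)) *
        (X : ℝ) ^ (2 * j) := by
  have h0 := coprimeConst_nonneg
  rw [harmonicAverage_congr fun f hf ↦ dirichletPoly_eigenvalue_pow hX hf j, harmonicAverage_sum]
  set E : ℝ := 256 * coprimeConst * (2 : ℝ)⁻¹ ^ k * Real.exp (4 * Real.pi * (X : ℝ) ^ (j + 1))
    with hE
  have hE0 : 0 ≤ E := by positivity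
  calc _ ≤ ∑ n ∈ Icc 1 (X ^ (j + 1)), powCoeff X j n * ((if n = 1 then 1 else 0) + E) := by
        refine sum_le_sum fun n hn ↦ ?_
        obtain ⟨hn1, hn2⟩ := mem_Icc.1 hn
        refine mul_le_mul_of_nonneg_left ?_ (powCoeff_nonneg X j n)
        have h1 := (abs_le.1
          (abs_harmonicAverage_eigenvalue_sub_le (k := k) (by lia) hk2 (n := n) hn1)).2
        have h2 : 256 * coprimeConst * (2 : ℝ)⁻¹ ^ k * Real.exp (4 * Real.pi * n) ≤ E := by
          have : (n : ℝ) ≤ (X : ℝ) ^ (j + 1) := by exact_mod_cast hn2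
          rw [hE]
          gcongr
        linarith
    _ = powCoeff X j 1 + E * ∑ n ∈ Icc 1 (X ^ (j + 1)), powCoeff X j n := by
        simp only [mul_add, sum_add_distrib, mul_ite, mul_one, mul_zero]
        rw [sum_ite_eq', if_pos (mem_Icc.2 ⟨le_rfl, Nat.one_le_pow _ _ hX⟩), mul_sum]
        congr 1
        exact sum_congr rfl fun n _ ↦ mul_comm _ _
    _ ≤ _ := by
        gcongr
        exact sum_powCoeff_le hX j

/-- The averages of the central value against the powers of the Dirichlet polynomial: the weights
`2 / √n` complete the diagonal coefficient of the `j`-th power to that of the `(j + 1)`-st. -/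
theorem le_harmonicAverage_centralValue_mul (hk : 12 ≤ k) (hk2 : Even (k : ℤ)) {X : ℕ}
    (hX : 1 ≤ X) (j : ℕ) :
    2 * powCoeff X (j + 1) 1 - (8 * coprimeConst + 1) * centralFactor k *
        ((X : ℝ) ^ (j + 1)) ^ (2 * k) * (X : ℝ) ^ (2 * j) ≤
      harmonicAverage k (fun f ↦ centralValue f * dirichletPoly X (eigenvalue f) ^ j) := by
  have h0 := coprimeConst_nonneg
  have hc := (centralFactor_pos (k := k) (by lia)).le
  have e1 : harmonicAverage k (fun f ↦ centralValue f * dirichletPoly X (eigenvalue f) ^ j) =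
      ∑ n ∈ Icc 1 (X ^ (j + 1)), powCoeff X j n *
        harmonicAverage k (fun f ↦ eigenvalue f n * centralValue f) := by
    rw [← harmonicAverage_sum]
    refine harmonicAverage_congr fun f hf ↦ ?_
    rw [dirichletPoly_eigenvalue_pow hX hf, mul_sum]
    exact sum_congr rfl fun n _ ↦ by ring
  rw [e1]
  set E : ℝ := (8 * coprimeConst + 1) * centralFactor k * ((X : ℝ) ^ (j + 1)) ^ (2 * k) with hE
  have hE0 : 0 ≤ E := by positivity
  calc _ ≤ 2 * (∑ n ∈ Icc 1 (X ^ (j + 1)), powCoeff X j n / √n) -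
        E * ∑ n ∈ Icc 1 (X ^ (j + 1)), powCoeff X j n := by
        gcongr
        · exact powCoeff_succ_one_le X j
        · exact sum_powCoeff_le hX j
    _ = ∑ n ∈ Icc 1 (X ^ (j + 1)), powCoeff X j n * (2 / √n - E) := by
        rw [mul_sum, mul_sum, ← sum_sub_distrib]
        exact sum_congr rfl fun n _ ↦ by ring
    _ ≤ _ := by
        refine sum_le_sum fun n hn ↦ ?_
        obtain ⟨hn1, hn2⟩ := mem_Icc.1 hn
        refine mul_le_mul_of_nonneg_left ?_ (powCoeff_nonneg X j n)
        have h1 := (abs_le.1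
          (abs_harmonicAverage_eigenvalue_mul_centralValue_sub_le hk hk2 (n := n) hn1)).1
        have h2 : (8 * coprimeConst + 1) * centralFactor k * (n : ℝ) ^ (2 * k) ≤ E := by
          have : (n : ℝ) ≤ (X : ℝ) ^ (j + 1) := by exact_mod_cast hn2
          rw [hE]
          gcongr
        linarith

/-- The moment dominates the diagonal coefficient as soon as the Dirichlet polynomial is so short
that both error terms are small. -/
theorem powCoeff_one_le_harmonicAverage {r : ℕ} (hr : 0 < r) (hr2 : Even r) (hk : 12 ≤ k)
    (hk2 : Even (k : ℤ)) {X : ℕ} (hX : 1 ≤ X)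
    (h1 : (8 * coprimeConst + 1) * centralFactor k * ((X : ℝ) ^ (r + 1)) ^ (2 * k + 2) ≤ 1 / 2)
    (h2 : 256 * coprimeConst * (2 : ℝ)⁻¹ ^ k * Real.exp (4 * Real.pi * (X : ℝ) ^ (r + 1)) *
      ((X : ℝ) ^ (r + 1)) ^ 2 ≤ 1 / 2) :
    powCoeff X r 1 ≤ harmonicAverage k (fun f ↦ centralValue f ^ r) := by
  have h0 := coprimeConst_nonneg
  have hc := (centralFactor_pos (k := k) (by lia)).le
  have hX' : (1 : ℝ) ≤ X := by exact_mod_cast hX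
  have hr1 : (1 : ℝ) ≤ r := by exact_mod_cast hr
  have hS1 := le_harmonicAverage_centralValue_mul hk hk2 hX (r - 1)
  have hS2 := harmonicAverage_dirichletPoly_pow_le hk hk2 hX r
  rw [Nat.sub_add_cancel hr] at hS1
  have hE1 : (8 * coprimeConst + 1) * centralFactor k * ((X : ℝ) ^ r) ^ (2 * k) *
      (X : ℝ) ^ (2 * (r - 1)) ≤ 1 / 2 := by
    refine le_trans ?_ h1
    rw [mul_assoc _ ((_ : ℝ) ^ (2 * k)), pow_add _ (2 * k), mul_comm 2 (r - 1), pow_mul _ (r - 1)]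
    gcongr
    all_goals first | exact hX' | lia
  have hE2 : 256 * coprimeConst * (2 : ℝ)⁻¹ ^ k * Real.exp (4 * Real.pi * (X : ℝ) ^ (r + 1)) *
      (X : ℝ) ^ (2 * r) ≤ 1 / 2 := by
    refine le_trans ?_ h2
    rw [mul_comm 2 r, pow_mul _ r]
    gcongr
    all_goals first | exact hX' | lia
  have hc1 : 1 ≤ powCoeff X r 1 :=
    (one_le_squarefreeSum _ hX).trans (squarefreeSum_le_powCoeff_one X r)
  have hmain : r * harmonicAverage k
        (fun f ↦ centralValue f * dirichletPoly X (eigenvalue f) ^ (r - 1)) -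
      (r - 1) * harmonicAverage k (fun f ↦ dirichletPoly X (eigenvalue f) ^ r) ≤
      harmonicAverage k (fun f ↦ centralValue f ^ r) := by
    rw [← harmonicAverage_sub]
    exact harmonicAverage_mono (by lia) fun f _ ↦ tangent_le_pow hr hr2 _ _
  have hA : (r : ℝ) * (2 * powCoeff X r 1 - 1 / 2) ≤ r * harmonicAverage k
        (fun f ↦ centralValue f * dirichletPoly X (eigenvalue f) ^ (r - 1)) := by
    gcongr
    linarith
  have hB : ((r : ℝ) - 1) * harmonicAverage k (fun f ↦ dirichletPoly X (eigenvalue f) ^ r) ≤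
      (r - 1) * (powCoeff X r 1 + 1 / 2) := by
    have : (0 : ℝ) ≤ r - 1 := by linarith
    gcongr
    linarith
  nlinarith

end HeckeMoment

namespace HeckeMoment

open Finset Filter Topology

/-! ### Asymptotics and the choice of the length -/

variable {k : ℕ}

/-- A weak form of Stirling's formula. -/
theorem pow_mul_exp_neg_le_Gamma {m : ℕ} (hm : 0 < m) :
    (m : ℝ) ^ m * Real.exp (-m) / m ≤ Real.Gamma m := by
  obtain ⟨n, rfl⟩ : ∃ n, m = n + 1 := ⟨m - 1, by lia⟩
  have h := Real.pow_div_factorial_le_exp ((n + 1 : ℕ) : ℝ) (by positivity) (n + 1)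
  have hf : ((n + 1).factorial : ℝ) = (n + 1 : ℕ) * Real.Gamma (n + 1 : ℕ) := by
    push_cast
    rw [Real.Gamma_nat_eq_factorial, Nat.factorial_succ]
    push_cast
    ring
  have hfp : (0 : ℝ) < (n + 1).factorial := by exact_mod_cast Nat.factorial_pos _
  rw [div_le_iff₀ hfp, hf] at h
  rw [div_le_iff₀ (by positivity), Real.exp_neg, ← div_eq_mul_inv, div_le_iff₀ (Real.exp_pos _)]
  linarith

theorem tendsto_pow_mul_pow_nat (a : ℕ) {q : ℝ} (h0 : 0 ≤ q) (h1 : q < 1) (K : ℝ) :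
    Tendsto (fun n : ℕ ↦ K * ((n : ℝ) ^ a * q ^ n)) atTop (𝓝 0) := by
  simpa using (tendsto_pow_const_mul_const_pow_of_abs_lt_one a
    (abs_lt.2 ⟨by linarith, h1⟩)).const_mul K

/-- The `Γ`-factor beats `Z ^ (2 k)` when `Z ≤ k ^ (1 / 8)`. -/
theorem eventually_centralFactor_mul_pow_le (C : ℝ) (hC : 0 ≤ C) :
    ∀ᶠ m : ℕ in atTop, ∀ Z : ℝ, 0 ≤ Z → Z ^ 8 ≤ (2 * m : ℕ) →
      C * centralFactor (2 * m) * Z ^ (2 * (2 * m) + 2) ≤ 1 / 2 := by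
  have hlim := tendsto_pow_mul_pow_nat 3 (q := 1 / 2) (by norm_num) (by norm_num) (8 * C ^ 2)
  have hbig : ∀ᶠ m : ℕ in atTop, 16 * Real.pi ^ 2 * Real.exp 2 ≤ m :=
    tendsto_natCast_atTop_atTop.eventually_ge_atTop _
  filter_upwards [hlim.eventually (gt_mem_nhds (show (0 : ℝ) < 1 / 4 by norm_num)), hbig,
    eventually_gt_atTop 0] with m h1 h2 h3 Z hZ0 hZ
  have hm : (0 : ℝ) < m := by exact_mod_cast h3
  have hm1 : (1 : ℝ) ≤ m := by exact_mod_cast h3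
  push_cast at hZ
  have hG := pow_mul_exp_neg_le_Gamma h3
  have hcf : centralFactor (2 * m) = 2 * (2 * Real.pi) ^ m / Real.Gamma m := by
    rw [centralFactor]
    have : ((2 * m : ℕ) : ℝ) / 2 = m := by
      push_cast
      ring
    rw [this, Real.rpow_natCast]
  have hcf2 : centralFactor (2 * m) ≤ 2 * m * (2 * Real.pi * Real.exp 1 / m) ^ m := by
    rw [hcf]
    calc _ ≤ 2 * (2 * Real.pi) ^ m / ((m : ℝ) ^ m * Real.exp (-m) / m) := by gcongr
      _ = _ := by
        rw [Real.exp_neg, div_pow, mul_pow _ (Real.exp 1), ← Real.exp_nat_mul, mul_one]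
        field_simp
  have hcf0 : 0 ≤ centralFactor (2 * m) := (centralFactor_pos (by lia)).le
  have hZ4 : Z ^ 4 ≤ 2 * m := by
    rcases le_total Z 1 with h | h
    · exact (pow_le_one₀ hZ0 h).trans (by linarith)
    · exact (pow_le_pow_right₀ h (by norm_num)).trans hZ
  have hsq : (C * centralFactor (2 * m) * Z ^ (2 * (2 * m) + 2)) ^ 2 ≤
      8 * C ^ 2 * ((m : ℝ) ^ 3 * (1 / 2) ^ m) := by
    calc (C * centralFactor (2 * m) * Z ^ (2 * (2 * m) + 2)) ^ 2
        ≤ (C * (2 * m * (2 * Real.pi * Real.exp 1 / m) ^ m) * Z ^ (2 * (2 * m) + 2)) ^ 2 := by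
          gcongr
      _ = 4 * C ^ 2 * m ^ 2 * ((2 * Real.pi * Real.exp 1 / m) ^ 2) ^ m * ((Z ^ 8) ^ m * Z ^ 4) := by
          generalize 2 * Real.pi * Real.exp 1 / m = W
          ring
      _ ≤ 4 * C ^ 2 * m ^ 2 * ((2 * Real.pi * Real.exp 1 / m) ^ 2) ^ m *
          ((2 * m) ^ m * (2 * m)) := by gcongr
      _ = 8 * C ^ 2 * (m ^ 3 * ((2 * Real.pi * Real.exp 1 / m) ^ 2 * (2 * m)) ^ m) := by
          rw [mul_pow _ (2 * (m : ℝ))]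
          generalize (2 * Real.pi * Real.exp 1 / m) ^ 2 = W
          ring
      _ ≤ 8 * C ^ 2 * (m ^ 3 * (1 / 2) ^ m) := by
          gcongr
          have he : Real.exp 2 = Real.exp 1 ^ 2 := by
            rw [← Real.exp_nat_mul]
            norm_num
          rw [he] at h2
          rw [div_pow, div_mul_eq_mul_div, div_le_iff₀ (by positivity)]
          nlinarith
  have hlt : (C * centralFactor (2 * m) * Z ^ (2 * (2 * m) + 2)) ^ 2 ≤ (1 / 2) ^ 2 := by
    refine hsq.trans (h1.le.trans (by norm_num))
  exact le_of_sq_le_sq hlt (by norm_num)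

/-- The factor `2 ^ (-k)` beats `exp (4 π Z)` when `Z ≤ k ^ (1 / 8)`. -/
theorem eventually_two_inv_pow_mul_exp_le (C : ℝ) (hC : 0 ≤ C) :
    ∀ᶠ k : ℕ in atTop, ∀ Z : ℝ, 1 ≤ Z → Z ^ 8 ≤ k →
      C * (2 : ℝ)⁻¹ ^ k * Real.exp (4 * Real.pi * Z) * Z ^ 2 ≤ 1 / 2 := by
  have hq : Real.exp (1 / 4) / 2 < 1 := by
    have h := Real.exp_one_lt_d9
    have h4 : Real.exp (1 / 4) ^ 4 = Real.exp 1 := by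
      rw [← Real.exp_nat_mul]
      norm_num
    rw [div_lt_one two_pos]
    by_contra! hcon
    have : (2 : ℝ) ^ 4 ≤ Real.exp (1 / 4) ^ 4 := by gcongr
    linarith
  have hlim := tendsto_pow_mul_pow_nat 1 (q := Real.exp (1 / 4) / 2) (by positivity) hq
    (C * Real.exp (16 * Real.pi ^ 2))
  filter_upwards [hlim.eventually (gt_mem_nhds (show (0 : ℝ) < 1 / 2 by norm_num))] with k h1 Z hZ1 hZ
  refine le_trans ?_ h1.le
  have hZ2 : Z ^ 2 ≤ k := (pow_le_pow_right₀ hZ1 (by norm_num)).trans hZ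
  calc C * (2 : ℝ)⁻¹ ^ k * Real.exp (4 * Real.pi * Z) * Z ^ 2
      ≤ C * (2 : ℝ)⁻¹ ^ k * (Real.exp (16 * Real.pi ^ 2) * Real.exp (1 / 4) ^ k) * k := by
        rw [← Real.exp_nat_mul, ← Real.exp_add]
        gcongr
        -- `4 π Z ≤ 16 π² + Z² / 4`
        nlinarith [sq_nonneg (Z - 8 * Real.pi)]
    _ = _ := by
        rw [div_pow, inv_pow]
        ring

theorem exists_pow_le_lt_succ_pow {q : ℕ} (hq : 0 < q) (k : ℕ) :
    ∃ Y : ℕ, Y ^ q ≤ k ∧ k < (Y + 1) ^ q := by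
  have h0 : 0 ^ q ≤ k := by simp [hq.ne']
  refine ⟨Nat.findGreatest (fun y ↦ y ^ q ≤ k) k,
    Nat.findGreatest_spec (P := fun y ↦ y ^ q ≤ k) (Nat.zero_le k) h0, ?_⟩
  by_contra! hcon
  have hle : Nat.findGreatest (fun y ↦ y ^ q ≤ k) k + 1 ≤ k :=
    (Nat.le_self_pow hq.ne' _).trans hcon
  exact Nat.findGreatest_is_greatest (P := fun y ↦ y ^ q ≤ k) (Nat.lt_succ_self _) hle hcon

/-- The lower bound for large weights. -/
theorem exists_mul_log_pow_le_harmonicAverage {r : ℕ} (hr : 0 < r) (hr2 : Even r) :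
    ∃ c : ℝ, 0 < c ∧ ∃ k₀ : ℕ, ∀ k : ℕ, k₀ ≤ k → Even k →
      c * Real.log k ^ r.choose 2 ≤ harmonicAverage k (fun f ↦ centralValue f ^ r) := by
  set R := r.choose 2 with hR
  have hr' : 2 ≤ r := by
    obtain ⟨n, rfl⟩ := hr2
    lia
  have hR0 : 0 < R := Nat.choose_pos hr'
  set q := 8 * (r + 1) * R with hq
  have hq0 : 0 < q := by positivity
  obtain ⟨c, hc, hcb⟩ := exists_mul_log_pow_le_squarefreeSum R
  have h0 := coprimeConst_nonneg
  obtain ⟨m₁, hm₁⟩ := eventually_atTop.1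
    (eventually_centralFactor_mul_pow_le (8 * coprimeConst + 1) (by positivity))
  obtain ⟨k₁, hk₁⟩ := eventually_atTop.1
    (eventually_two_inv_pow_mul_exp_le (256 * coprimeConst) (by positivity))
  refine ⟨c * ((2 * q : ℝ)⁻¹) ^ R, by positivity, max (max 12 (2 ^ q)) (max (2 * m₁) k₁), ?_⟩
  intro k hk hk2
  simp only [max_le_iff] at hk
  obtain ⟨⟨hk12, hkq⟩, hkm, hkk⟩ := hk
  -- With `X = Y ^ R` the length `X ^ (r + 1)` of all Dirichlet polynomials is at most `k ^ (1 / 8)`,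
  -- and `log Y` is still comparable to `log k`.
  obtain ⟨Y, hY1, hY2⟩ := exists_pow_le_lt_succ_pow hq0 k
  have hY : 2 ≤ Y := by
    have := lt_of_pow_lt_pow_left₀ q (Nat.zero_le _) (hkq.trans_lt hY2)
    lia
  have hX : 1 ≤ Y ^ R := Nat.one_le_pow _ _ (by lia)
  have hZ1 : (1 : ℝ) ≤ ((Y ^ R : ℕ) : ℝ) ^ (r + 1) := one_le_pow₀ (by exact_mod_cast hX)
  have hZ8 : (((Y ^ R : ℕ) : ℝ) ^ (r + 1)) ^ 8 ≤ k := by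
    have : ((Y ^ R) ^ (r + 1)) ^ 8 ≤ k := by
      rw [← pow_mul, ← pow_mul]
      refine le_trans (le_of_eq ?_) hY1
      congr 1
      rw [hq]
      ring
    exact_mod_cast this
  obtain ⟨m, hm⟩ := hk2
  have hkm2 : k = 2 * m := by lia
  have hmain := powCoeff_one_le_harmonicAverage hr hr2 hk12 ((Int.even_coe_nat k).2 ⟨m, hm⟩) hX
    (by
      have := hm₁ m (by lia) (((Y ^ R : ℕ) : ℝ) ^ (r + 1)) (by positivity)
        (by rw [← hkm2]; exact hZ8)
      rw [← hkm2] at this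
      exact this)
    (hk₁ k hkk _ hZ1 hZ8)
  refine le_trans ?_ ((squarefreeSum_le_powCoeff_one _ r).trans hmain)
  refine le_trans ?_ (hcb Y)
  rw [mul_assoc, ← mul_pow]
  have hlog : Real.log k ≤ 2 * q * Real.log Y := by
    have hYr : (2 : ℝ) ≤ Y := by exact_mod_cast hY
    have hkle : (k : ℝ) ≤ ((Y : ℝ) ^ 2) ^ q := by
      have h1 : (k : ℝ) ≤ ((Y : ℝ) + 1) ^ q := by exact_mod_cast hY2.le
      refine h1.trans ?_
      gcongr
      nlinarith
    calc Real.log k ≤ Real.log (((Y : ℝ) ^ 2) ^ q) :=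
          Real.log_le_log (by exact_mod_cast (by lia : 0 < k)) hkle
      _ = _ := by
        rw [Real.log_pow, Real.log_pow]
        push_cast
        ring
  have hlog0 : 0 ≤ Real.log k := Real.log_natCast_nonneg k
  gcongr
  rw [inv_mul_le_iff₀ (by positivity)]
  exact hlog

end HeckeMoment

namespace HeckeMoment

open MeasureTheory Filter Set EisensteinSeries ModularForm
open scoped Topology ComplexOrder

/-! ### A cusp form that is positive on the imaginary axis -/

variable {k : ℕ}

theorem qParam_axis {t : ℝ} (ht : 0 < t) :
    Function.Periodic.qParam 1 (ofComplex (Complex.I * t) : ℂ) =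
      (Real.exp (-(2 * Real.pi * t)) : ℝ) := by
  rw [ofComplex_apply_of_im_pos (by simpa using ht), Complex.ofReal_exp]
  simp only [Function.Periodic.qParam]
  congr 1
  push_cast
  change 2 * Real.pi * Complex.I * (Complex.I * t) / 1 = _
  linear_combination (2 * Real.pi * t : ℂ) * Complex.I_mul_I

theorem E₄_axis_pos {t : ℝ} (ht : 0 < t) : 0 < E₄ (ofComplex (Complex.I * t)) := by
  have h := ModularForm.hasSum_qExpansion E₄ one_pos one_mem_strictPeriods (ofComplex (Complex.I * t))
  rw [qParam_axis ht] at h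
  set q := Real.exp (-(2 * Real.pi * t)) with hq
  have hq0 : 0 < q := Real.exp_pos _
  have hb : ∀ m, 0 ≤ (qExpansion 1 E₄).coeff m • (q : ℂ) ^ m := by
    intro m
    rw [smul_eq_mul, E_qExpansion_coeff _ ⟨2, rfl⟩]
    refine mul_nonneg ?_ (by positivity)
    split_ifs
    · exact zero_le_one
    · refine mul_nonneg ?_ (Nat.cast_nonneg _)
      norm_num [show bernoulli 4 = -1 / 30 by decide +kernel]
  have h0 : (qExpansion 1 E₄).coeff 0 • (q : ℂ) ^ 0 = 1 := by
    rw [E_qExpansion_coeff_zero _ ⟨2, rfl⟩]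
    simp
  exact zero_lt_one.trans_le (h0.ge.trans (le_hasSum h 0 fun m _ ↦ hb m))

/-- The product formula shows `0 ≤ Δ(it)`, and `Δ` has no zeros. -/
theorem discriminant_axis_pos {t : ℝ} (ht : 0 < t) :
    0 < ModularForm.discriminant (ofComplex (Complex.I * t)) := by
  refine lt_of_le_of_ne ?_ (ModularForm.discriminant_ne_zero _).symm
  rw [ModularForm.discriminant_eq_q_prod]
  simp only [ModularForm.eta_q]
  rw [qParam_axis ht]
  have hq0 : 0 < Real.exp (-(2 * Real.pi * t)) := Real.exp_pos _
  refine mul_nonneg (by exact_mod_cast hq0.le) ?_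
  by_cases hm : Multipliable fun n : ℕ ↦
      (1 - ((Real.exp (-(2 * Real.pi * t)) : ℝ) : ℂ) ^ (n + 1)) ^ 24
  · refine ge_of_tendsto' hm.hasProd fun s ↦ Finset.prod_nonneg fun n _ ↦ ?_
    have : (0 : ℝ) ≤ (1 - Real.exp (-(2 * Real.pi * t)) ^ (n + 1)) ^ 24 :=
      Even.pow_nonneg (by decide) _
    exact_mod_cast this
  · rw [tprod_eq_one_of_not_multipliable hm]
    exact zero_le_one

/-- The cusp form `Δ E₄ ^ n`, where `k = 12 + 4 n`, is positive on the imaginary axis. -/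
theorem exists_axisIntegral_ne_zero (hk : 12 ≤ k) (hk4 : 4 ∣ k) :
    ∃ F : CuspForm 𝒮ℒ (k : ℤ), axisIntegral k F ≠ 0 := by
  obtain ⟨n, hn⟩ : ∃ n, k = 12 + 4 * n := ⟨(k - 12) / 4, by lia⟩
  have hw : ((n : ℤ) * (4 : ℕ) : ℤ) = (k : ℤ) - 12 := by
    rw [hn]
    push_cast
    ring
  set F : CuspForm 𝒮ℒ (k : ℤ) := CuspForm.ofMulDiscriminant (ModularForm.mcast hw (E₄.pow n))
    with hF
  have hpos : ∀ t : ℝ, 0 < t → 0 < F (ofComplex (Complex.I * t)) := by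
    intro t ht
    rw [hF, CuspForm.ofMulDiscriminant_apply]
    refine mul_pos (discriminant_axis_pos ht) ?_
    rw [ModularForm.coe_mcast, ModularForm.coe_pow, Pi.pow_apply]
    exact pow_pos (E₄_axis_pos ht) n
  have hpos' : ∀ t ∈ Ioi (1 : ℝ), 0 < (((t ^ ((k : ℝ) / 2 - 1) : ℝ) : ℂ) *
      F (ofComplex (Complex.I * t))).re := by
    intro t ht
    have ht0 : (0 : ℝ) < t := zero_lt_one.trans ht
    rw [Complex.re_ofReal_mul]
    exact mul_pos (Real.rpow_pos_of_pos ht0 _) (Complex.pos_iff.1 (hpos t ht0)).1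
  have hint : IntegrableOn (fun t : ℝ ↦ ((t ^ ((k : ℝ) / 2 - 1) : ℝ) : ℂ) *
      F (ofComplex (Complex.I * t))) (Ioi 1) :=
    (integrableOn_axis (by lia) F).mono_set (Ioi_subset_Ioi zero_le_one)
  refine ⟨F, fun h0 ↦ ?_⟩
  have hre : ∫ t in Ioi (1 : ℝ), (((t ^ ((k : ℝ) / 2 - 1) : ℝ) : ℂ) *
      F (ofComplex (Complex.I * t))).re = 0 := by
    have := Complex.reCLM.integral_comp_comm hint
    simp only [Complex.reCLM_apply] at this
    rw [this]
    rw [axisIntegral] at h0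
    rw [h0, Complex.zero_re]
  refine hre.not_gt ?_
  refine (setIntegral_pos_iff_support_of_nonneg_ae ?_ hint.re).2 ?_
  · exact (ae_restrict_iff' measurableSet_Ioi).2 (.of_forall fun t ht ↦ (hpos' t ht).le)
  · refine lt_of_lt_of_le ?_ (measure_mono (s := Ioi (1 : ℝ)) fun t ht ↦ ⟨(hpos' t ht).ne', ht⟩)
    simp

/-- Some eigenform has a nonzero central value, since the central value is linear on the space of
cusp forms and the eigenforms span. -/
theorem exists_centralValue_ne_zero (hk : 12 ≤ k) (hk4 : 4 ∣ k) :
    ∃ f ∈ heckeEigenforms k, centralValue f ≠ 0 := by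
  obtain ⟨F, hF⟩ := exists_axisIntegral_ne_zero hk hk4
  by_contra! hcon
  refine hF ?_
  have hz : ∀ f ∈ heckeEigenforms k, axisIntegral k f = 0 := by
    intro f hf
    have h := ofReal_centralValue hf
    rw [hcon f hf, Complex.ofReal_zero, eq_comm, mul_eq_zero] at h
    refine h.resolve_left ?_
    exact_mod_cast (centralFactor_pos (by lia)).ne'
  have hmem : F ∈ Submodule.span ℂ (heckeEigenforms k) := by
    rw [span_heckeEigenforms]
    trivial
  rw [← (finite_heckeEigenforms (k := k)).coe_toFinset, Submodule.mem_span_finset] at hmem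
  obtain ⟨c, -, rfl⟩ := hmem
  rw [axisIntegral_sum (by lia)]
  refine Finset.sum_eq_zero fun f hf ↦ ?_
  rw [hz f (mem_toFinset_heckeEigenforms.1 hf), mul_zero]

theorem harmonicAverage_centralValue_pow_pos {r : ℕ} (hr2 : Even r) (hk : 12 ≤ k) (hk4 : 4 ∣ k) :
    0 < harmonicAverage k (fun f ↦ centralValue f ^ r) := by
  obtain ⟨f, hf, hf0⟩ := exists_centralValue_ne_zero hk hk4
  refine Finset.sum_pos' (fun g hg ↦ ?_) ⟨f, mem_toFinset_heckeEigenforms.2 hf, ?_⟩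
  · exact mul_nonneg (inv_harmonicWeight_pos (by lia) (mem_toFinset_heckeEigenforms.1 hg)).le
      (hr2.pow_nonneg _)
  · exact mul_pos (inv_harmonicWeight_pos (by lia) hf) (hr2.pow_pos hf0)

end HeckeMoment

theorem theorem1 (r : ℕ) (hr : 0 < r) (hr2 : Even r) :
    ∃ C : ℝ, 0 < C ∧ ∀ (k : ℕ) (hk : 0 < k), 12 ≤ k → k ≡ 0 [MOD 4] →
      (HeckeMoment.harmonicMoment hk r).im = 0 ∧
      C * Real.log k ^ (r * (r - 1) / 2) ≤ (HeckeMoment.harmonicMoment hk r).re := by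
  open HeckeMoment in
  obtain ⟨c, hc, k₀, hk₀⟩ := exists_mul_log_pow_le_harmonicAverage hr hr2
  rw [← Nat.choose_two_right]
  -- Below `k₀` the quotient of the positive moment by the power of the logarithm has a minimum.
  obtain ⟨c', hc', hsmall⟩ : ∃ c' : ℝ, 0 < c' ∧ ∀ k < k₀, 12 ≤ k → 4 ∣ k →
      c' * Real.log k ^ r.choose 2 ≤
        harmonicAverage k (fun f ↦ centralValue f ^ r) := by
    have hlog : ∀ k : ℕ, 12 ≤ k → 0 < Real.log k ^ r.choose 2 := fun k hk ↦
      pow_pos (Real.log_pos (by exact_mod_cast (by lia : 1 < k))) _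
    rcases ({k ∈ Finset.range k₀ | 12 ≤ k ∧ 4 ∣ k}).eq_empty_or_nonempty with he | hne
    · refine ⟨1, one_pos, fun k h1 h2 h3 ↦ ?_⟩
      exact absurd ⟨h2, h3⟩ (Finset.filter_eq_empty_iff.1 he (Finset.mem_range.2 h1))
    · obtain ⟨m, hm, hmin⟩ := Finset.exists_min_image _ (fun k ↦
        harmonicAverage k (fun f ↦ centralValue f ^ r) / Real.log k ^ r.choose 2) hne
      obtain ⟨-, hm1, hm2⟩ := Finset.mem_filter.1 hm
      refine ⟨_, div_pos (harmonicAverage_centralValue_pow_pos hr2 hm1 hm2) (hlog m hm1),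
        fun k h1 h2 h3 ↦ ?_⟩
      rw [← le_div_iff₀ (hlog k h2)]
      exact hmin k (Finset.mem_filter.2 ⟨Finset.mem_range.2 h1, h2, h3⟩)
  refine ⟨min c c', lt_min hc hc', fun k hk hk12 hmod ↦ ?_⟩
  have hk4 : 4 ∣ k := (Nat.modEq_zero_iff_dvd).1 hmod
  rw [harmonicMoment_eq hk hk4, Complex.ofReal_im, Complex.ofReal_re]
  refine ⟨rfl, ?_⟩
  have hlog : 0 ≤ Real.log k ^ r.choose 2 := pow_nonneg (Real.log_natCast_nonneg k) _
  rcases lt_or_ge k k₀ with h | h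
  · exact (mul_le_mul_of_nonneg_right (min_le_right _ _) hlog).trans (hsmall k h hk12 hk4)
  · exact (mul_le_mul_of_nonneg_right (min_le_left _ _) hlog).trans
      (hk₀ k h (even_iff_two_dvd.2 (dvd_trans (by norm_num) hk4)))
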